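/- Let $1\le j<k$ and $s\ge 2$ be integers. An *$s$-fold $k$-graph* $H$ on a vertex set $V$ consists of sets $E_1,\dots,E_s$ of $k$-element subsets of $V$; the elements of $E_i$ are its $i$-edges. In *$j$-jigsaw percolation* on $H$, one starts with the partition of the set of all $j$-element subsets of $V$ into singletons; its classes are called clusters. At each time step one forms the auxiliary graph on the current clusters in which two distinct clusters $C,C'$ are adjacent if for every colour $i\in\{1,\dots,s\}$ there are $J\in C$, $J'\in C'$ and an $i$-edge $e\in E_i$ with $J\cup J'\subset e$; the new clusters are the unions of the clusters in each connected component of this auxiliary graph. $H$ *$j$-percolates* if at some time there is exactly one cluster. For $p_1,\dots,p_s\in[0,1]$, let $H_k(n,p_1,\dots,p_s)$ be the random $s$-fold $k$-graph on $\{1,\dots,n\}$ in which each $k$-set is an $i$-edge with probability $p_i$, independently for all colours $i$ and all $k$-sets. **Theorem.** For all integers $1\le j<k$ and $s\ge2$ there is a constant $c=c(s,k,j)>0$ such that the following holds for all sequences $0\le p_1=p_1(n)\le\dots\le p_s=p_s(n)\le 1$, with $H\sim H_k(n,p_1,\dots,p_s)$. 1. If for all sufficiently large $n$ we have $$p_1\le\frac{\log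 n}{c\,n^{k-j}}\qquad\text{or}\qquad \prod_{i=1}^{r}p_i\le\frac{1}{c\,n^{r(k-j-1)+1}(\log n)^{r-1}}\ \text{ for some } 2\le r\le s,$$ then the probability that $H$ does not $j$-percolate tends to $1$ as $n\to\infty$. 2. If for all sufficiently large $n$ we have $$p_1\ge\frac{c\log n}{n^{k-j}}\qquad\text{and}\qquad \prod_{i=1}^{r}p_i\ge\frac{c}{n^{r(k-j-1)+1}(\log n)^{r-1}}\ \text{ for every } 2\le r\le s,$$ then the probability that $H$ $j$-percolates tends to $1$ as $n\to\infty$. -/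

import Mathlib

open MeasureTheory ProbabilityTheory Filter Topology

/-- An `s`-fold `k`-graph on the vertex set `V`: for every colour `i : Fin s` a set of `k`-element
subsets of `V`, the `i`-edges. -/
abbrev MultiKGraph (V : Type*) (k s : ℕ) : Type _ :=
  Fin s → Set (Set.powersetCard V k)

namespace MultiKGraph

variable {V : Type*} {k s : ℕ}

/-- The auxiliary graph on the clusters (classes of the partition `C` of the `j`-sets): two distinct
clusters are adjacent iff for each colour `i` some `i`-edge contains a `j`-set of the first
and a `j`-set of the second. -/
def clusterGraph (H : MultiKGraph V k s) {j : ℕ} (C : Setoid (Set.powersetCard V j)) :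
    SimpleGraph (Quotient C) where
  Adj A B := A ≠ B ∧ ∀ i : Fin s, ∃ J J' : Set.powersetCard V j,
    Quotient.mk C J = A ∧ Quotient.mk C J' = B ∧
      ∃ e ∈ H i, (J : Finset V) ⊆ (e : Finset V) ∧ (J' : Finset V) ⊆ (e : Finset V)
  symm := ⟨fun _ _ h => ⟨h.1.symm, fun i => by
    obtain ⟨J, J', hJ, hJ', e, he, h1, h2⟩ := h.2 i
    exact ⟨J', J, hJ', hJ, e, he, h2, h1⟩⟩⟩
  loopless := ⟨fun _ h => h.1 rfl⟩

/-- One step of `j`-jigsaw percolation: clusters in the same component of the auxiliary graph are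
united. -/
def jigsawStep (H : MultiKGraph V k s) {j : ℕ} (C : Setoid (Set.powersetCard V j)) :
    Setoid (Set.powersetCard V j) :=
  Setoid.comap (Quotient.mk C) (H.clusterGraph C).reachableSetoid

/-- The partition of the `j`-sets at time `t`, starting from the partition into singletons. Once the
auxiliary graph has no edges the partition stays constant. -/
def jigsaw (H : MultiKGraph V k s) (j : ℕ) : ℕ → Setoid (Set.powersetCard V j)
  | 0 => ⊥
  | t + 1 => H.jigsawStep (H.jigsaw j t)

/-- `H` `j`-percolates: at some time there is exactly one cluster. -/
def Percolates (H : MultiKGraph V k s) (j : ℕ) : Prop :=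
  ∃ t : ℕ, Nat.card (Quotient (H.jigsaw j t)) = 1

end MultiKGraph

/-- The law of the binomial random `s`-fold `k`-graph `H_k(n, p_1, …, p_s)` on `n` vertices: every
`k`-set is an `i`-edge with probability `p i`, independently for all colours and all `k`-sets. -/
noncomputable def randomMultiKGraph (n k : ℕ) {s : ℕ} (p : Fin s → unitInterval) :
    Measure (MultiKGraph (Fin n) k s) :=
  Measure.pi fun i => setBernoulli (Set.univ : Set (Set.powersetCard (Fin n) k)) (p i)

/-! Above the threshold, fix a `(j-1)`-set `I` and two further vertices `x`, `y`, and keep only the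
edges through `I` that meet a set `A` of about `n/3` vertices in exactly two points. This link is an
`s`-fold multigraph on `A` with order `n^(k-j-1)` potential parallel edges per pair, so in essence
the case `j = 1`, `k = 2` remains. There a single cluster is grown: it absorbs a vertex that is
joined to it in every colour, possibly through different cluster vertices. The bottleneck is the
size `log n`. By the threshold conditions one trial reaches size `ε log n` with probability at least
about `n^(-1/4)`, so that among `√n` seeds failure of all trials is less likely than any fixed power
of `n`. After that the cluster doubles in fresh pools of vertices, reaches linear size and captures
`x` and `y` (`exists_joined_bound`). A union bound over all `(I, x, y)` shows that any two `j`-sets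
differing in one element share a cluster, and such exchanges connect all `j`-sets
(`exists_percolates_bound`).

Below the threshold there are two obstructions. If `p_1` is small, some `j`-set lies in no edge of
the first colour and never merges (`isolated_bound`). Otherwise a product condition fails. Merging
two clusters at most doubles the number of covered vertices, so percolation has to pass a family of
`j`-sets that is connected in every colour and covers a set `U` of between `L` and `2L` vertices,
where `L` is about `ε log n` (`MultiKGraph.Percolates.exists_cutConnected`). Connectedness in one
colour yields edges that explore `U` from one `j`-set, an edge with `j + g` vertices in `U`
contributing at most `g` new ones (`MultiKGraph.CutConnected.exists_explores`). A weighted count of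
explorations (`sum_explored_le`) bounds the probability of this, the bounds multiply over the
colours of the violated product, and the sum over all `U` tends to zero (`exists_product_bound`). -/

/-! ### Finite product Bernoulli measures and events depending on few coordinates -/

/-- The Bernoulli law on propositions. -/
noncomputable def propBernoulli (p : unitInterval) : Measure Prop :=
  unitInterval.toNNReal p • Measure.dirac True +
    unitInterval.toNNReal (unitInterval.symm p) • Measure.dirac False

lemma setBernoulli_univ_eq_map {E : Type*} [Fintype E] (p : unitInterval) :
    setBernoulli (Set.univ : Set E) p =
      (Measure.infinitePi fun _ : E => propBernoulli p).map (fun f : E → Prop => {i | f i}) := by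
  rw [setBernoulli_eq_map]; simp [propBernoulli]

lemma propBernoulli_true (p : unitInterval) :
    propBernoulli p {True} = unitInterval.toNNReal p := by
  simp [propBernoulli]

lemma propBernoulli_false (p : unitInterval) :
    propBernoulli p {False} = unitInterval.toNNReal (unitInterval.symm p) := by
  simp [propBernoulli]

instance (p : unitInterval) : IsProbabilityMeasure (propBernoulli p) := by
  constructor
  have h : (Set.univ : Set Prop) = {True} ∪ {False} := by
    ext x; by_cases x <;> simp_all
  rw [h, measure_union (by simp) (MeasurableSet.of_discrete), propBernoulli_true,
    propBernoulli_false, ← ENNReal.coe_add]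
  norm_cast
  ext
  simp

/-- The probability of the event `A` when each coordinate `c` holds independently with
probability `q c`. -/
noncomputable def pr {κ : Type*} [Fintype κ] (q : κ → unitInterval) (A : (κ → Prop) → Prop) : ℝ :=
  (Measure.pi fun c => propBernoulli (q c)).real {ω | A ω}

section Pr

variable {κ : Type*} [Fintype κ] {q : κ → unitInterval} {A B : (κ → Prop) → Prop}

lemma pr_nonneg : 0 ≤ pr q A := measureReal_nonneg

lemma pr_le_one : pr q A ≤ 1 := measureReal_le_one

lemma pr_mono (h : ∀ ω, A ω → B ω) : pr q A ≤ pr q B := measureReal_mono h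

lemma pr_true : pr q (fun _ => True) = 1 := by simp [pr]

lemma pr_false : pr q (fun _ => False) = 0 := by simp [pr]

lemma pr_not : pr q (fun ω => ¬ A ω) = 1 - pr q A := by
  have := probReal_compl_eq_one_sub (μ := Measure.pi fun c => propBernoulli (q c))
    (s := {ω | A ω}) (MeasurableSet.of_discrete)
  exact this

lemma pr_or_le : pr q (fun ω => A ω ∨ B ω) ≤ pr q A + pr q B := measureReal_union_le _ _

lemma pr_exists_le {α : Type*} (S : Finset α) (A : α → (κ → Prop) → Prop) :
    pr q (fun ω => ∃ a ∈ S, A a ω) ≤ ∑ a ∈ S, pr q (A a) := by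
  have := measureReal_biUnion_finset_le (μ := Measure.pi fun c => propBernoulli (q c)) S
    (fun a => {ω | A a ω})
  refine le_trans (le_of_eq ?_) this
  unfold pr; congr 1; ext; simp

lemma pr_exists_eq {α : Type*} (S : Finset α) (A : α → (κ → Prop) → Prop)
    (h : ∀ a ∈ S, ∀ b ∈ S, ∀ ω, A a ω → A b ω → a = b) :
    pr q (fun ω => ∃ a ∈ S, A a ω) = ∑ a ∈ S, pr q (A a) := by
  have := measureReal_biUnion_finset (μ := Measure.pi fun c => propBernoulli (q c)) (s := S)
    (f := fun a => {ω | A a ω}) (by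
      intro a ha b hb hab
      refine Set.disjoint_left.2 fun ω h1 h2 => hab (h a ha b hb ω h1 h2))
      (fun _ _ => MeasurableSet.of_discrete)
  refine Eq.trans ?_ this
  unfold pr; congr 1; ext; simp

lemma pr_and_of_disjoint {D D' : Set κ} (hA : DependsOn A D) (hB : DependsOn B D')
    (h : Disjoint D D') : pr q (fun ω => A ω ∧ B ω) = pr q A * pr q B := by
  classical
  obtain ⟨g, hg⟩ := dependsOn_iff_exists_comp.1 hA
  obtain ⟨g', hg'⟩ := dependsOn_iff_exists_comp.1 hB
  have hind : iIndepFun (fun (c : κ) (ω : κ → Prop) => ω c)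
      (Measure.pi fun c => propBernoulli (q c)) :=
    iIndepFun_pi (X := fun _ => id) (fun _ => aemeasurable_id)
  have hd : Disjoint D.toFinset D'.toFinset := by simpa [Set.disjoint_toFinset] using h
  have h2 := (hind.indepFun_finset D.toFinset D'.toFinset hd
    (fun i => measurable_pi_apply i)).measure_inter_preimage_eq_mul
      {x | g (fun i => x ⟨i, by simp⟩)} {x | g' (fun i => x ⟨i, by simp⟩)}
      MeasurableSet.of_discrete MeasurableSet.of_discrete
  have h3 := congrArg ENNReal.toReal h2
  rw [ENNReal.toReal_mul] at h3
  subst hg hg'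
  exact h3

lemma DependsOn.event_mono {ι : Type*} {A : (ι → Prop) → Prop} {D D' : Set ι} (hA : DependsOn A D)
    (h : D ⊆ D') : DependsOn A D' := fun _ _ hxy => hA fun i hi => hxy i (h hi)

lemma DependsOn.event_and {ι : Type*} {A B : (ι → Prop) → Prop} {D : Set ι} (hA : DependsOn A D)
    (hB : DependsOn B D) : DependsOn (fun ω => A ω ∧ B ω) D := fun x y hxy => by
  simp only [hA hxy, hB hxy]

lemma DependsOn.event_not {ι : Type*} {A : (ι → Prop) → Prop} {D : Set ι} (hA : DependsOn A D) :
    DependsOn (fun ω => ¬ A ω) D := fun x y hxy => by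
  simp only [hA hxy]

lemma DependsOn.event_forall {ι α : Type*} {A : α → (ι → Prop) → Prop} {D : Set ι}
    (hA : ∀ a, DependsOn (A a) D) : DependsOn (fun ω => ∀ a, A a ω) D := fun x y hxy => by
  simp only [hA _ hxy]

lemma DependsOn.event_exists {ι α : Type*} {A : α → (ι → Prop) → Prop} {D : Set ι}
    (hA : ∀ a, DependsOn (A a) D) : DependsOn (fun ω => ∃ a, A a ω) D := fun x y hxy => by
  simp only [hA _ hxy]

lemma dependsOn_event_const {ι : Type*} {D : Set ι} (P : Prop) :
    DependsOn (fun _ : ι → Prop => P) D := fun _ _ _ => rfl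

lemma dependsOn_event_apply {ι : Type*} {D : Set ι} {c : ι} (hc : c ∈ D) :
    DependsOn (fun ω : ι → Prop => ω c) D := fun _ _ h => h c hc

lemma pr_forall_of_disjoint {α : Type*} [DecidableEq α] (S : Finset α)
    (A : α → (κ → Prop) → Prop) (D : α → Set κ)
    (hA : ∀ a ∈ S, DependsOn (A a) (D a))
    (hD : ∀ a ∈ S, ∀ b ∈ S, a ≠ b → Disjoint (D a) (D b)) :
    pr q (fun ω => ∀ a ∈ S, A a ω) = ∏ a ∈ S, pr q (A a) := by
  induction S using Finset.induction_on with
  | empty => simp [pr_true]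
  | insert a S ha ih =>
    rw [Finset.prod_insert ha, ← ih (fun b hb => hA b (by simp [hb]))
      (fun b hb c hc => hD b (by simp [hb]) c (by simp [hc])),
      ← pr_and_of_disjoint (D := D a) (D' := ⋃ b ∈ S, D b) (hA a (by simp))]
    · congr 1; ext ω; simp
    · refine DependsOn.event_forall fun b => ?_
      by_cases hb : b ∈ S
      · have : DependsOn (A b) (⋃ b ∈ S, D b) :=
          (hA b (by simp [hb])).event_mono (Set.subset_biUnion_of_mem (u := D) hb)
        intro x y hxy
        simp only [this hxy]
      · intro x y hxy
        simp [hb]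
    · simp only [Set.disjoint_iUnion_right]
      intro b hb
      exact hD a (by simp) b (by simp [hb]) (by rintro rfl; exact ha hb)

lemma pr_apply (c : κ) : pr q (fun ω => ω c) = q c := by
  classical
  have h : {ω : κ → Prop | ω c} =
      Set.pi Set.univ (fun d => if d = c then {True} else Set.univ) := by
    ext ω
    simp only [Set.mem_ofPred_eq, Set.mem_pi, Set.mem_univ, true_imp_iff]
    constructor
    · intro h d
      split_ifs with hd
      · subst hd; simpa using h
      · simp
    · intro h
      simpa using h c
  unfold pr
  rw [h, measureReal_def, Measure.pi_pi, Finset.prod_eq_single c]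
  · simp [propBernoulli_true]
  · intro d _ hd; simp [hd]
  · simp

lemma pr_forall_mem (S : Finset κ) : pr q (fun ω => ∀ c ∈ S, ω c) = ∏ c ∈ S, (q c : ℝ) := by
  classical
  rw [pr_forall_of_disjoint S (fun c ω => ω c) (fun c => {c})]
  · simp [pr_apply]
  · exact fun a _ => dependsOn_event_apply rfl
  · intro a _ b _ hab; simpa using hab

lemma pr_forall_not_mem (S : Finset κ) :
    pr q (fun ω => ∀ c ∈ S, ¬ ω c) = ∏ c ∈ S, (1 - (q c : ℝ)) := by
  classical
  rw [pr_forall_of_disjoint S (fun c ω => ¬ ω c) (fun c => {c})]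
  · simp [pr_apply, pr_not]
  · exact fun a _ => (dependsOn_event_apply (D := {a}) rfl).event_not
  · intro a _ b _ hab; simpa using hab

end Pr

/-- The random multigraph as an event space of coordinates `(i, e)`. -/
lemma randomMultiKGraph_real (n k : ℕ) {s : ℕ} (p : Fin s → unitInterval)
    (P : MultiKGraph (Fin n) k s → Prop) :
    (randomMultiKGraph n k p).real {H | P H} =
      pr (fun c : Fin s × Set.powersetCard (Fin n) k => p c.1)
        (fun ω => P (fun i => {e | ω (i, e)})) := by
  classical
  have key : randomMultiKGraph n k p =
      (Measure.pi fun c : Fin s × Set.powersetCard (Fin n) k => propBernoulli (p c.1)).map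
        (fun ω i => {e | ω (i, e)}) := by
    refine Measure.ext_of_singleton fun H => ?_
    rw [randomMultiKGraph, Measure.pi_singleton, Measure.map_apply (Measurable.of_discrete)
      (MeasurableSet.of_discrete)]
    have h1 : (fun (ω : Fin s × Set.powersetCard (Fin n) k → Prop) (i : Fin s) =>
        {e | ω (i, e)}) ⁻¹' {H} = {fun c => c.2 ∈ H c.1} := by
      ext ω
      simp only [Set.mem_preimage, Set.mem_singleton_iff]
      constructor
      · rintro rfl; rfl
      · rintro rfl; rfl
    rw [h1, Measure.pi_singleton, Fintype.prod_prod_type]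
    refine Finset.prod_congr rfl fun i _ => ?_
    rw [setBernoulli_univ_eq_map, Measure.infinitePi_eq_pi, Measure.map_apply
      (Measurable.of_discrete) (MeasurableSet.of_discrete), ← Measure.pi_singleton
      (fun _ => propBernoulli (p i)) (fun e => e ∈ H i)]
    congr 1
  rw [key, map_measureReal_apply (Measurable.of_discrete) (MeasurableSet.of_discrete)]
  rfl

/-! ### Closed partitions and exchange moves -/

namespace MultiKGraph

variable {V : Type*} {k s j : ℕ}

/-- Two `j`-sets lie in a common `i`-edge. -/
def Linked (H : MultiKGraph V k s) (i : Fin s) (J J' : Set.powersetCard V j) : Prop :=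
  ∃ e ∈ H i, (J : Finset V) ⊆ (e : Finset V) ∧ (J' : Finset V) ⊆ (e : Finset V)

lemma Linked.symm {H : MultiKGraph V k s} {i : Fin s} {J J' : Set.powersetCard V j}
    (h : H.Linked i J J') : H.Linked i J' J := by
  obtain ⟨e, he, h1, h2⟩ := h
  exact ⟨e, he, h2, h1⟩

/-- A partition of the `j`-sets in which no two distinct clusters are adjacent. -/
def IsClosedPartition (H : MultiKGraph V k s) (C : Setoid (Set.powersetCard V j)) : Prop :=
  ∀ J J', (∀ i, ∃ K K', C J K ∧ C J' K' ∧ H.Linked i K K') → C J J'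

lemma le_jigsawStep (H : MultiKGraph V k s) (C : Setoid (Set.powersetCard V j)) :
    C ≤ H.jigsawStep C := by
  intro x y h
  have : (Quotient.mk C x) = Quotient.mk C y := Quotient.sound h
  change (H.clusterGraph C).Reachable (Quotient.mk C x) (Quotient.mk C y)
  rw [this]

lemma isClosedPartition_of_jigsawStep_eq (H : MultiKGraph V k s)
    (C : Setoid (Set.powersetCard V j)) (h : H.jigsawStep C = C) : H.IsClosedPartition C := by
  intro J J' hl
  by_contra hC
  apply hC
  rw [← h]
  change (H.clusterGraph C).Reachable (Quotient.mk C J) (Quotient.mk C J')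
  refine SimpleGraph.Adj.reachable ⟨fun h' => hC (Quotient.exact h'), fun i => ?_⟩
  obtain ⟨K, K', h1, h2, h3⟩ := hl i
  exact ⟨K, K', (Quotient.sound h1).symm, (Quotient.sound h2).symm, h3⟩

/-- The partitions only get coarser and there are finitely many of them, so the process becomes
stationary, and a stationary partition has no adjacent clusters. -/
lemma exists_isClosedPartition_jigsaw [Finite V] (H : MultiKGraph V k s) :
    ∃ t, H.IsClosedPartition (H.jigsaw j t) := by
  have : Finite (Setoid (Set.powersetCard V j)) :=
    Finite.of_injective (fun C : Setoid (Set.powersetCard V j) => fun x y => C x y)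
      (fun C C' h => Setoid.ext fun x y => by
        have := congrFun (congrFun h x) y
        exact iff_of_eq this)
  have hm : Monotone (H.jigsaw j) := monotone_nat_of_le_succ fun t => H.le_jigsawStep _
  obtain ⟨t, ht⟩ := WellFoundedGT.monotone_chain_condition ⟨H.jigsaw j, hm⟩
  exact ⟨t, H.isClosedPartition_of_jigsawStep_eq _ (ht (t + 1) (by omega)).symm⟩

/-- The relation that exchanges one element connects all `j`-sets. -/
lemma setoid_all_of_exchange [DecidableEq V] (C : Setoid (Set.powersetCard V j))
    (h : ∀ (I : Finset V) (x y : V), I.card + 1 = j → x ∉ I → y ∉ I → x ≠ y →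
      ∀ J J' : Set.powersetCard V j, (J : Finset V) = insert x I → (J' : Finset V) = insert y I →
        C J J') (J J' : Set.powersetCard V j) : C J J' := by
  induction hd : ((J : Finset V) \ (J' : Finset V)).card using Nat.strong_induction_on
    generalizing J with
  | _ d ih =>
    by_cases hJ : (J : Finset V) \ (J' : Finset V) = ∅
    · have : J = J' := Set.powersetCard.eq_iff_subset.2 (Finset.sdiff_eq_empty_iff_subset.1 hJ)
      subst this
      exact C.refl _
    · obtain ⟨a, ha⟩ := Finset.nonempty_iff_ne_empty.2 hJ
      have hne : J' ≠ J := by rintro rfl; simp at hJ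
      obtain ⟨b, hb, hb'⟩ := (Set.powersetCard.exists_mem_notMem_iff_ne J' J).1 hne
      rw [Finset.mem_sdiff] at ha
      have hb1 : b ∈ (J' : Finset V) := hb
      have hb2 : b ∉ (J : Finset V) := hb'
      have hcard : ((J : Finset V).erase a).card + 1 = j := by
        rw [Finset.card_erase_add_one ha.1, Set.powersetCard.card_eq]
      have hbI : b ∉ (J : Finset V).erase a := fun h => hb2 (Finset.mem_of_mem_erase h)
      have hK : (insert b ((J : Finset V).erase a)).card = j := by
        rw [Finset.card_insert_of_notMem hbI, hcard]
      let K : Set.powersetCard V j := ⟨_, hK⟩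
      have h1 : C J K := h ((J : Finset V).erase a) a b hcard (by simp) hbI
        (by rintro rfl; exact hb2 ha.1) J K (Finset.insert_erase ha.1).symm rfl
      refine C.trans h1 (ih _ ?_ K rfl)
      rw [← hd]
      apply Finset.card_lt_card
      refine ⟨?_, fun hs => ?_⟩
      · intro x hx
        simp only [K, Finset.mem_sdiff, Finset.mem_insert, Finset.mem_erase] at hx ⊢
        rcases hx with ⟨rfl | hx, hx'⟩
        · exact absurd hb1 hx'
        · exact ⟨hx.2, hx'⟩
      · have := hs (Finset.mem_sdiff.2 ha)
        simp only [K, Finset.mem_sdiff, Finset.mem_insert, Finset.mem_erase] at this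
        rcases this with ⟨rfl | hx, hx'⟩
        · exact hb2 ha.1
        · exact hx.1 rfl

/-- Quantifying over all closed partitions removes time from the supercritical argument: growth of
clusters can be replayed inside an arbitrary closed `C`. -/
lemma percolates_of_exchange [Finite V] [DecidableEq V] (H : MultiKGraph V k s)
    [Nonempty (Set.powersetCard V j)]
    (h : ∀ (I : Finset V) (x y : V), I.card + 1 = j → x ∉ I → y ∉ I → x ≠ y →
      ∀ C : Setoid (Set.powersetCard V j), H.IsClosedPartition C →
      ∀ J J' : Set.powersetCard V j, (J : Finset V) = insert x I → (J' : Finset V) = insert y I →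
        C J J') : H.Percolates j := by
  obtain ⟨t, ht⟩ := H.exists_isClosedPartition_jigsaw (j := j)
  refine ⟨t, ?_⟩
  have hall := setoid_all_of_exchange (H.jigsaw j t)
    fun I x y hI hx hy hxy => h I x y hI hx hy hxy _ ht
  rw [Nat.card_eq_one_iff_unique]
  refine ⟨⟨fun a b => ?_⟩, ⟨Quotient.mk _ (Classical.arbitrary _)⟩⟩
  induction a, b using Quotient.inductionOn₂ with
  | _ a b => exact Quotient.sound (hall a b)

/-! ### Families spanned in every colour, at every scale -/

section Spanned

/-- The family `A` of `j`-sets cannot be split into two parts not linked by an `i`-edge. -/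
def CutConnected (H : MultiKGraph V k s) (i : Fin s) (A : Finset (Set.powersetCard V j)) : Prop :=
  ∀ D ⊆ A, D.Nonempty → D ≠ A → ∃ J ∈ D, ∃ J' ∈ A, J' ∉ D ∧ H.Linked i J J'

/-- A part `D` that splits `A` or `B` is crossed by a link inside that family. Otherwise `D`
contains exactly one of the two, and the given link between them crosses. -/
lemma CutConnected.union [DecidableEq V] {H : MultiKGraph V k s} {i : Fin s}
    {A B : Finset (Set.powersetCard V j)}
    (hA : H.CutConnected i A) (hB : H.CutConnected i B)
    (h : ∃ J ∈ A, ∃ J' ∈ B, H.Linked i J J') : H.CutConnected i (A ∪ B) := by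
  intro D hD hne hneq
  by_cases h1 : (D ∩ A).Nonempty ∧ D ∩ A ≠ A
  · obtain ⟨J, hJ, J', hJ', h2, h3⟩ := hA (D ∩ A) Finset.inter_subset_right h1.1 h1.2
    simp only [Finset.mem_inter, not_and] at hJ h2
    exact ⟨J, hJ.1, J', by simp [hJ'], fun h => h2 h hJ', h3⟩
  by_cases h2 : (D ∩ B).Nonempty ∧ D ∩ B ≠ B
  · obtain ⟨J, hJ, J', hJ', h2, h3⟩ := hB (D ∩ B) Finset.inter_subset_right h2.1 h2.2
    simp only [Finset.mem_inter, not_and] at hJ h2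
    exact ⟨J, hJ.1, J', by simp [hJ'], fun h => h2 h hJ', h3⟩
  obtain ⟨J, hJ, J', hJ', hl⟩ := h
  have hA' : D ∩ A = ∅ ∨ A ⊆ D := by
    by_contra hcon
    push Not at hcon
    exact h1 ⟨Finset.nonempty_iff_ne_empty.2 hcon.1.ne_empty,
      fun h => hcon.2 (by rw [← h]; exact Finset.inter_subset_left)⟩
  have hB' : D ∩ B = ∅ ∨ B ⊆ D := by
    by_contra hcon
    push Not at hcon
    exact h2 ⟨Finset.nonempty_iff_ne_empty.2 hcon.1.ne_empty,
      fun h => hcon.2 (by rw [← h]; exact Finset.inter_subset_left)⟩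
  rcases hA' with hA' | hA' <;> rcases hB' with hB' | hB'
  · exfalso
    obtain ⟨x, hx⟩ := hne
    rcases Finset.mem_union.1 (hD hx) with h | h
    · exact Finset.notMem_empty x (hA' ▸ Finset.mem_inter.2 ⟨hx, h⟩)
    · exact Finset.notMem_empty x (hB' ▸ Finset.mem_inter.2 ⟨hx, h⟩)
  · exact ⟨J', hB' hJ', J, by simp [hJ],
      fun h => Finset.notMem_empty J (hA' ▸ Finset.mem_inter.2 ⟨h, hJ⟩), hl.symm⟩
  · exact ⟨J, hA' hJ, J', by simp [hJ'],
      fun h => Finset.notMem_empty J' (hB' ▸ Finset.mem_inter.2 ⟨h, hJ'⟩), hl⟩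
  · exact absurd (Finset.Subset.antisymm hD (Finset.union_subset hA' hB')) hneq

/-- The vertices covered by a family of `j`-sets. -/
def cover [DecidableEq V] (A : Finset (Set.powersetCard V j)) : Finset V :=
  A.biUnion fun J => (J : Finset V)

/-- If clusters of cover size in `[L, 2L)` do not occur, all clusters stay small. -/
lemma jigsaw_class_small [Fintype V] [DecidableEq V] (H : MultiKGraph V k s) {L : ℕ} (hjL : j < L)
    (hno : ∀ A : Finset (Set.powersetCard V j), A.Nonempty → (∀ i, H.CutConnected i A) →
      (cover A).card < 2 * L → (cover A).card < L) (t : ℕ) (J : Set.powersetCard V j) :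
    ∃ A : Finset (Set.powersetCard V j), (∀ J', J' ∈ A ↔ H.jigsaw j t J J') ∧
      (∀ i, H.CutConnected i A) ∧ (cover A).card < L := by
  classical
  induction t generalizing J with
  | zero =>
    refine ⟨{J}, fun J' => ?_, fun i D hD hne hneq => ?_, ?_⟩
    · rw [Finset.mem_singleton]
      exact eq_comm
    · rcases Finset.subset_singleton_iff.1 hD with h | h
      · simp [h] at hne
      · exact absurd h hneq
    · simpa [cover, Set.powersetCard.card_eq] using hjL
  | succ t ih =>
    let C := H.jigsaw j t
    -- One step may unite many clusters and thereby jump over the window `[L, 2L)`, so they are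
    -- united one at a time. `S` collects the small connected unions of time-`t` clusters around
    -- `J`; a largest member must be the whole class.
    let S : Finset (Finset (Set.powersetCard V j)) := Finset.univ.filter fun D =>
      J ∈ D ∧ (∀ i, H.CutConnected i D) ∧ (cover D).card < L ∧
      (∀ x ∈ D, ∀ y, C x y → y ∈ D) ∧ ∀ x ∈ D, H.jigsaw j (t + 1) J x
    have hS : S.Nonempty := by
      obtain ⟨A, h1, h2, h3⟩ := ih J
      refine ⟨A, Finset.mem_filter.2 ⟨Finset.mem_univ _, (h1 J).2 (C.refl _), h2, h3, ?_, ?_⟩⟩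
      · exact fun x hx y hxy => (h1 y).2 (C.trans ((h1 x).1 hx) hxy)
      · exact fun x hx => H.le_jigsawStep _ ((h1 x).1 hx)
    obtain ⟨D, hD, hmax⟩ := S.exists_max_image Finset.card hS
    obtain ⟨-, hJD, hcon, hsm, hsat, hsub⟩ := Finset.mem_filter.1 hD
    refine ⟨D, fun J' => ⟨hsub J', fun hJ' => ?_⟩, hcon, hsm⟩
    by_contra hJD'
    have hreach : (H.clusterGraph C).Reachable (Quotient.mk C J) (Quotient.mk C J') := hJ'
    obtain ⟨w⟩ := hreach
    have hmem : ∀ x, Quotient.mk C x ∈ {q : Quotient C | ∃ y ∈ D, Quotient.mk C y = q} → x ∈ D := by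
      rintro x ⟨y, hy, hxy⟩
      exact hsat y hy x (Quotient.exact hxy)
    -- A walk leaving `D` crosses an edge of the auxiliary graph, and the cluster `B` behind it is
    -- linked to `D` in every colour. Both cover fewer than `L` vertices, so the union stays below
    -- `2 * L` and, by `hno`, below `L`.
    obtain ⟨d, -, hd1, hd2⟩ := w.exists_boundary_dart
      {q | ∃ y ∈ D, Quotient.mk C y = q} ⟨J, hJD, rfl⟩ (fun h => hJD' (hmem _ h))
    obtain ⟨x, hx, hx'⟩ := hd1
    obtain ⟨y, hy⟩ := Quotient.exists_rep d.snd
    have hadj := d.adj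
    obtain ⟨B, hB1, hB2, hB3⟩ := ih y
    have hyB : y ∈ B := (hB1 y).2 (C.refl _)
    have hlink : ∀ i, ∃ K ∈ D, ∃ K' ∈ B, H.Linked i K K' := by
      intro i
      obtain ⟨K, K', h1, h2, h3⟩ := hadj.2 i
      refine ⟨K, hmem K ⟨x, hx, hx'.trans h1.symm⟩, K', (hB1 K').2 ?_, h3⟩
      exact Quotient.exact (hy.trans h2.symm)
    have hun : ∀ i, H.CutConnected i (D ∪ B) := fun i => (hcon i).union (hB2 i) (hlink i)
    have hcov : (cover (D ∪ B)).card < 2 * L := by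
      have : cover (D ∪ B) = cover D ∪ cover B := Finset.union_biUnion
      rw [this]
      have := Finset.card_union_le (cover D) (cover B)
      omega
    have hDB : D ∪ B ∈ S := by
      refine Finset.mem_filter.2 ⟨Finset.mem_univ _, by simp [hJD], hun,
        hno _ ⟨J, by simp [hJD]⟩ hun hcov, ?_, ?_⟩
      · intro a ha b hab
        rcases Finset.mem_union.1 ha with h | h
        · exact Finset.mem_union_left _ (hsat a h b hab)
        · exact Finset.mem_union_right _ ((hB1 b).2 (C.trans ((hB1 a).1 h) hab))
      · intro a ha
        rcases Finset.mem_union.1 ha with h | h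
        · exact hsub a h
        · have h1 : (H.clusterGraph C).Reachable (Quotient.mk C J) (Quotient.mk C x) := hsub x hx
          have h2 : Quotient.mk C a = d.snd := by
            rw [← hy]; exact (Quotient.sound ((hB1 a).1 h)).symm
          change (H.clusterGraph C).Reachable (Quotient.mk C J) (Quotient.mk C a)
          rw [h2]
          rw [hx'] at h1
          exact h1.trans hadj.reachable
    have h1 := hmax _ hDB
    have h2 : D ∪ B = D := (Finset.eq_of_subset_of_card_le Finset.subset_union_left h1).symm
    apply hd2
    rw [← hy]
    exact ⟨y, h2 ▸ Finset.mem_union_right _ hyB, rfl⟩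

/-- Percolation passes through an internally spanned family at every scale. -/
lemma Percolates.exists_cutConnected [Fintype V] [DecidableEq V] {H : MultiKGraph V k s}
    (h : H.Percolates j) (hj : 1 ≤ j) {L : ℕ} (hjL : j < L) (hL : L ≤ Fintype.card V) :
    ∃ A : Finset (Set.powersetCard V j), A.Nonempty ∧ (∀ i, H.CutConnected i A) ∧
      L ≤ (cover A).card ∧ (cover A).card < 2 * L := by
  by_contra hcon
  push Not at hcon
  obtain ⟨t, ht⟩ := h
  obtain ⟨hsub, ⟨q⟩⟩ := Nat.card_eq_one_iff_unique.1 ht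
  obtain ⟨J, -⟩ := Quotient.exists_rep q
  obtain ⟨A, h1, h2, h3⟩ := H.jigsaw_class_small hjL (fun A hA hA' hA2 => by
    by_contra hlt
    have := hcon A hA hA' (by omega)
    omega) t J
  -- All `j`-sets are in one class, and `1 ≤ j ≤ |V|` puts every vertex into some `j`-set.
  have hcov : cover A = Finset.univ := by
    rw [Finset.eq_univ_iff_forall]
    intro v
    obtain ⟨K, hK1, -, hK2⟩ := Finset.exists_subsuperset_card_eq (s := {v}) (t := Finset.univ)
      (n := j) (by simp) (by simpa using hj) (by rw [Finset.card_univ]; omega)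
    refine Finset.mem_biUnion.2 ⟨⟨K, hK2⟩, (h1 _).2 ?_, hK1 (by simp)⟩
    exact Quotient.exact (hsub.elim _ _)
  rw [hcov, Finset.card_univ] at h3
  omega

end Spanned

end MultiKGraph

/-! ### Growing a cluster through disjoint pools -/

section Exploration

variable {V E : Type*} [DecidableEq V] {s : ℕ}

/-- The vertex `y` is joined to the set `X` in every colour; an edge `e` joins the two vertices of
its label `lab e`. -/
def AllAdj (lab : E → Finset V) (ω : Fin s × E → Prop) (X : Finset V) (y : V) : Prop :=
  ∀ i, ∃ x ∈ X, ∃ e, ω (i, e) ∧ lab e = {x, y}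

/-- The coordinates belonging to pairs between `X` and `Y`. -/
def pairCoords (s : ℕ) (lab : E → Finset V) (X Y : Finset V) : Set (Fin s × E) :=
  {c | ∃ x ∈ X, ∃ y ∈ Y, lab c.2 = {x, y}}

/-- Starting from `X`, one finds in every pool of the list the prescribed number of vertices joined
to all that was found before, and finally the targets `T` are joined to the result. -/
def Reach (lab : E → Finset V) (T : Finset V) (ω : Fin s × E → Prop) :
    List (Finset V × ℕ) → Finset V → Prop
  | [], X => ∀ t ∈ T, AllAdj lab ω X t
  | (R, h) :: L, X => ∃ Y ⊆ R, Y.card = h ∧ (∀ y ∈ Y, AllAdj lab ω X y) ∧ Reach lab T ω L (X ∪ Y)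

/-- All pools together with the targets. -/
def poolUnion (T : Finset V) : List (Finset V × ℕ) → Finset V
  | [] => T
  | (R, _) :: L => R ∪ poolUnion T L

/-- The pools are disjoint from each other and from the targets. -/
def Pooled (T : Finset V) : List (Finset V × ℕ) → Prop
  | [] => True
  | (R, _) :: L => Disjoint R (poolUnion T L) ∧ Pooled T L

lemma pairCoords_mono (lab : E → Finset V) {X Y X' Y' : Finset V} (hX : X ⊆ X') (hY : Y ⊆ Y') :
    pairCoords s lab X Y ⊆ pairCoords s lab X' Y' := by
  rintro c ⟨x, hx, y, hy, h⟩
  exact ⟨x, hX hx, y, hY hy, h⟩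

/-- A pair between `X` and `R` has no end in `Z`. This is the source of independence between an
exposed pool and the later ones. -/
lemma disjoint_pairCoords (lab : E → Finset V) {X R Y Z : Finset V} (hX : Disjoint X Z)
    (hR : Disjoint R Z) : Disjoint (pairCoords s lab X R) (pairCoords s lab Y Z) := by
  rw [Set.disjoint_left]
  rintro c ⟨x, hx, y, hy, h⟩ ⟨x', hx', z, hz, h'⟩
  have : z ∈ ({x, y} : Finset V) := by rw [← h, h']; simp
  rcases Finset.mem_insert.1 this with rfl | h1
  · exact Finset.disjoint_left.1 hX hx hz
  · rw [Finset.mem_singleton] at h1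
    subst h1
    exact Finset.disjoint_left.1 hR hy hz

lemma dependsOn_allAdj (lab : E → Finset V) (X : Finset V) (y : V) :
    DependsOn (fun ω : Fin s × E → Prop => AllAdj lab ω X y) (pairCoords s lab X {y}) := by
  intro ω ω' h
  refine propext (forall_congr' fun i => ?_)
  constructor
  · rintro ⟨x, hx, e, he, hl⟩
    exact ⟨x, hx, e, (h (i, e) ⟨x, hx, y, by simp, hl⟩) ▸ he, hl⟩
  · rintro ⟨x, hx, e, he, hl⟩
    exact ⟨x, hx, e, (h (i, e) ⟨x, hx, y, by simp, hl⟩).symm ▸ he, hl⟩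

/-- Every pair that is still queried has an end in a remaining pool or in `T`. -/
lemma dependsOn_reach (lab : E → Finset V) (T : Finset V) (L : List (Finset V × ℕ))
    (X : Finset V) :
    DependsOn (fun ω : Fin s × E → Prop => Reach lab T ω L X)
      (pairCoords s lab (X ∪ poolUnion T L) (poolUnion T L)) := by
  induction L generalizing X with
  | nil =>
    refine DependsOn.event_forall fun t => ?_
    by_cases ht : t ∈ T
    · refine fun ω ω' h => ?_
      have := (dependsOn_allAdj lab X t).event_mono (pairCoords_mono lab
        (Finset.subset_union_left (s₂ := T)) (Finset.singleton_subset_iff.2 ht)) h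
      simp only [this]
    · intro ω ω' _
      simp [ht]
  | cons P L ih =>
    obtain ⟨R, h⟩ := P
    refine DependsOn.event_exists fun Y => ?_
    by_cases hY : Y ⊆ R
    · have h1 : DependsOn (fun ω : Fin s × E → Prop => ∀ y ∈ Y, AllAdj lab ω X y)
          (pairCoords s lab (X ∪ poolUnion T ((R, h) :: L)) (poolUnion T ((R, h) :: L))) := by
        refine DependsOn.event_forall fun y => ?_
        by_cases hy : y ∈ Y
        · refine fun ω ω' h' => ?_
          have := (dependsOn_allAdj lab X y).event_mono (pairCoords_mono lab
            (Finset.subset_union_left (s₂ := poolUnion T ((R, h) :: L)))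
            (Finset.singleton_subset_iff.2
              (Finset.mem_union_left (poolUnion T L) (hY hy)))) h'
          simp only [this]
        · intro ω ω' _
          simp [hy]
      have h2 := (ih (X ∪ Y)).event_mono (D' := pairCoords s lab
          (X ∪ poolUnion T ((R, h) :: L)) (poolUnion T ((R, h) :: L))) (pairCoords_mono lab
          (by
            intro z hz
            simp only [poolUnion, Finset.mem_union] at hz ⊢
            rcases hz with (hz | hz) | hz
            · exact Or.inl hz
            · exact Or.inr (Or.inl (hY hz))
            · exact Or.inr (Or.inr hz)) Finset.subset_union_right)
      intro ω ω' h'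
      simp only [h1 h', h2 h']
    · intro ω ω' _
      simp [hY]

variable [Fintype E] {q : Fin s × E → unitInterval}

open Classical in
/-- Conditioning on the set of vertices of the pool `R` that are joined to `X`. -/
lemma pr_expose (lab : E → Finset V) (X R : Finset V) (h : ℕ) (B : (Fin s × E → Prop) → Prop)
    (a b : ℝ)
    (hfail : ∀ S ⊆ R, S.card < h → ∃ C D, Disjoint (pairCoords s lab X R) D ∧ DependsOn C D ∧
      pr q C ≤ a ∧ ∀ ω, (R.filter fun y => AllAdj lab ω X y) = S → B ω → C ω)
    (hsucc : ∀ S ⊆ R, h ≤ S.card → ∃ C D, Disjoint (pairCoords s lab X R) D ∧ DependsOn C D ∧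
      pr q C ≤ b ∧ ∀ ω, (R.filter fun y => AllAdj lab ω X y) = S → B ω → C ω) :
    pr q B ≤ pr q (fun ω => (R.filter fun y => AllAdj lab ω X y).card < h) * a +
      (1 - pr q (fun ω => (R.filter fun y => AllAdj lab ω X y).card < h)) * b := by
  let N : (Fin s × E → Prop) → Finset V := fun ω => R.filter fun y => AllAdj lab ω X y
  have hN : ∀ S, DependsOn (fun ω => N ω = S) (pairCoords s lab X R) := by
    intro S ω ω' hω
    have : N ω = N ω' := by
      refine Finset.filter_congr fun y hy => ?_
      exact iff_of_eq ((dependsOn_allAdj lab X y).event_mono (pairCoords_mono lab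
        subset_rfl (Finset.singleton_subset_iff.2 hy)) hω)
    simp only [this]
  -- Given the exposed set `S`, the event `B` is replaced by some `C` that sees only unexposed
  -- pairs, so the probabilities multiply.
  have hall : ∀ S ⊆ R, pr q (fun ω => N ω = S ∧ B ω) ≤
      pr q (fun ω => N ω = S) * (if S.card < h then a else b) := by
    intro S hS
    split_ifs with hc
    · obtain ⟨C, D, h1, h2, h3, h4⟩ := hfail S hS hc
      calc pr q (fun ω => N ω = S ∧ B ω) ≤ pr q (fun ω => N ω = S ∧ C ω) :=
            pr_mono fun ω hω => ⟨hω.1, h4 ω hω.1 hω.2⟩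
        _ = pr q (fun ω => N ω = S) * pr q C := pr_and_of_disjoint (hN S) h2 h1
        _ ≤ _ := mul_le_mul_of_nonneg_left h3 pr_nonneg
    · obtain ⟨C, D, h1, h2, h3, h4⟩ := hsucc S hS (not_lt.1 hc)
      calc pr q (fun ω => N ω = S ∧ B ω) ≤ pr q (fun ω => N ω = S ∧ C ω) :=
            pr_mono fun ω hω => ⟨hω.1, h4 ω hω.1 hω.2⟩
        _ = pr q (fun ω => N ω = S) * pr q C := pr_and_of_disjoint (hN S) h2 h1
        _ ≤ _ := mul_le_mul_of_nonneg_left h3 pr_nonneg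
  have hNR : ∀ ω, N ω ∈ R.powerset := fun ω => Finset.mem_powerset.2 (Finset.filter_subset _ _)
  have e1 : pr q (fun ω => (N ω).card < h) =
      ∑ S ∈ R.powerset.filter (fun S => S.card < h), pr q (fun ω => N ω = S) := by
    rw [← pr_exists_eq _ (fun S ω => N ω = S)]
    · congr 1; ext ω
      constructor
      · exact fun hω => ⟨N ω, Finset.mem_filter.2 ⟨hNR ω, hω⟩, rfl⟩
      · rintro ⟨S, hS, rfl⟩
        exact (Finset.mem_filter.1 hS).2
    · rintro S - S' - ω rfl rfl; rfl
  have e2 : 1 - pr q (fun ω => (N ω).card < h) =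
      ∑ S ∈ R.powerset.filter (fun S => ¬ S.card < h), pr q (fun ω => N ω = S) := by
    rw [← pr_not, ← pr_exists_eq _ (fun S ω => N ω = S)]
    · congr 1; ext ω
      constructor
      · exact fun hω => ⟨N ω, Finset.mem_filter.2 ⟨hNR ω, hω⟩, rfl⟩
      · rintro ⟨S, hS, rfl⟩
        exact (Finset.mem_filter.1 hS).2
    · rintro S - S' - ω rfl rfl; rfl
  calc pr q B ≤ pr q (fun ω => ∃ S ∈ R.powerset, N ω = S ∧ B ω) :=
        pr_mono fun ω hω => ⟨N ω, hNR ω, rfl, hω⟩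
    _ ≤ ∑ S ∈ R.powerset, pr q (fun ω => N ω = S ∧ B ω) :=
        pr_exists_le _ (fun S ω => N ω = S ∧ B ω)
    _ ≤ ∑ S ∈ R.powerset, pr q (fun ω => N ω = S) * (if S.card < h then a else b) :=
        Finset.sum_le_sum fun S hS => hall S (Finset.mem_powerset.1 hS)
    _ = _ := by
        rw [e2, e1, Finset.sum_mul, Finset.sum_mul, ← Finset.sum_filter_add_sum_filter_not
          R.powerset (fun S => S.card < h)]
        congr 1
        · refine Finset.sum_congr rfl fun S hS => ?_
          rw [if_pos (Finset.mem_filter.1 hS).2]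
        · refine Finset.sum_congr rfl fun S hS => ?_
          rw [if_neg (Finset.mem_filter.1 hS).2]

end Exploration

/-! ### Probability of being joined in every colour -/

section AdjacencyProbability

variable {V E : Type*} [DecidableEq V] {s : ℕ} [Fintype E] {p : Fin s → unitInterval}
  {lab : E → Finset V} {b : ℕ}

/-- Lower bound for the probability that a vertex is joined in every colour to `m` vertices, when
two vertices are joined at rates `ρ i`. -/
noncomputable def adjBound (ρ : Fin s → ℝ) (m : ℝ) : ℝ := ∏ i, (1 - Real.exp (-(ρ i * m)))

lemma adjBound_nonneg {ρ : Fin s → ℝ} (hρ : ∀ i, 0 ≤ ρ i) {m : ℝ} (hm : 0 ≤ m) :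
    0 ≤ adjBound ρ m := by
  refine Finset.prod_nonneg fun i _ => ?_
  have : Real.exp (-(ρ i * m)) ≤ 1 := Real.exp_le_one_iff.2 (by
    have := mul_nonneg (hρ i) hm; linarith)
  linarith

lemma pr_not_adj_le (hb : ∀ u v : V, u ≠ v → b ≤ Nat.card {e // lab e = {u, v}}) (i : Fin s)
    (X : Finset V) {y : V} (hy : y ∉ X) :
    pr (fun c : Fin s × E => p c.1) (fun ω => ¬ ∃ x ∈ X, ∃ e, ω (i, e) ∧ lab e = {x, y}) ≤
      Real.exp (-(p i * b * X.card)) := by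
  classical
  let S : Finset (Fin s × E) := Finset.univ.filter fun c => c.1 = i ∧ ∃ x ∈ X, lab c.2 = {x, y}
  have h1 : (fun ω : Fin s × E → Prop => ¬ ∃ x ∈ X, ∃ e, ω (i, e) ∧ lab e = {x, y}) =
      fun ω => ∀ c ∈ S, ¬ ω c := by
    funext ω
    apply propext
    constructor
    · rintro h ⟨i', e⟩ hc hω
      obtain ⟨-, rfl, x, hx, hl⟩ := Finset.mem_filter.1 hc
      exact h ⟨x, hx, e, hω, hl⟩
    · rintro h ⟨x, hx, e, hω, hl⟩
      exact h (i, e) (Finset.mem_filter.2 ⟨Finset.mem_univ _, rfl, x, hx, hl⟩) hω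
  have h2 : b * X.card ≤ S.card := by
    have hsub : X.biUnion (fun x => (Finset.univ.filter fun e => lab e = {x, y}).image
        (fun e => (i, e))) ⊆ S := by
      intro c hc
      simp only [Finset.mem_biUnion, Finset.mem_image, Finset.mem_filter, Finset.mem_univ,
        true_and] at hc
      obtain ⟨x, hx, e, he, rfl⟩ := hc
      exact Finset.mem_filter.2 ⟨Finset.mem_univ _, rfl, x, hx, he⟩
    refine le_trans ?_ (Finset.card_le_card hsub)
    rw [Finset.card_biUnion]
    · rw [mul_comm, ← smul_eq_mul]
      refine Finset.card_nsmul_le_sum _ _ _ fun x hx => ?_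
      rw [Finset.card_image_of_injective _ (fun a b h => (Prod.ext_iff.1 h).2)]
      have := hb x y (by rintro rfl; exact hy hx)
      rwa [Nat.card_eq_fintype_card, Fintype.card_subtype] at this
    · intro x hx x' hx' hne
      refine Finset.disjoint_left.2 fun c hc hc' => ?_
      simp only [Finset.mem_image, Finset.mem_filter, Finset.mem_univ, true_and] at hc hc'
      obtain ⟨e, he, rfl⟩ := hc
      obtain ⟨e', he', h⟩ := hc'
      obtain rfl : e' = e := (Prod.ext_iff.1 h).2
      have : x ∈ ({x', y} : Finset V) := by rw [← he', he]; simp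
      rcases Finset.mem_insert.1 this with h | h
      · exact hne h
      · rw [Finset.mem_singleton] at h; subst h; exact hy hx
  rw [h1, pr_forall_not_mem]
  have h3 : ∏ c ∈ S, (1 - (p c.1 : ℝ)) = (1 - (p i : ℝ)) ^ S.card := by
    rw [Finset.prod_congr rfl (g := fun _ => 1 - (p i : ℝ)), Finset.prod_const]
    intro c hc
    rw [(Finset.mem_filter.1 hc).2.1]
  rw [h3]
  have hp0 := (p i).2.1
  have hp1 := (p i).2.2
  calc (1 - (p i : ℝ)) ^ S.card ≤ (1 - (p i : ℝ)) ^ (b * X.card) :=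
        pow_le_pow_of_le_one (by linarith) (by linarith) h2
    _ ≤ (Real.exp (-(p i : ℝ))) ^ (b * X.card) :=
        pow_le_pow_left₀ (by linarith) (by have := Real.add_one_le_exp (-(p i : ℝ)); linarith) _
    _ = _ := by
        rw [← Real.exp_nat_mul]; congr 1; push_cast; ring

lemma adjBound_le_pr (hb : ∀ u v : V, u ≠ v → b ≤ Nat.card {e // lab e = {u, v}})
    (X : Finset V) {y : V} (hy : y ∉ X) :
    adjBound (fun i => (p i : ℝ) * b) X.card ≤
      pr (fun c : Fin s × E => p c.1) (fun ω => AllAdj lab ω X y) := by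
  classical
  have := pr_forall_of_disjoint (q := fun c : Fin s × E => p c.1) (Finset.univ : Finset (Fin s))
    (fun i ω => ∃ x ∈ X, ∃ e, ω (i, e) ∧ lab e = {x, y}) (fun i => {c | c.1 = i})
    (fun i _ => by
      intro ω ω' h
      have : ∀ e, ω (i, e) = ω' (i, e) := fun e => h (i, e) rfl
      simp only [this])
    (fun i _ i' _ hne => Set.disjoint_left.2 fun c h1 h2 => hne (h1.symm.trans h2))
  simp only [Finset.mem_univ, true_imp_iff] at this
  unfold AllAdj
  rw [this]
  refine Finset.prod_le_prod (fun i _ => ?_) fun i _ => ?_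
  · have : Real.exp (-((p i : ℝ) * b * X.card)) ≤ 1 := Real.exp_le_one_iff.2 (by
      have : 0 ≤ (p i : ℝ) * b * X.card := by have := (p i).2.1; positivity
      linarith)
    linarith
  · have h := pr_not_adj_le (p := p) hb i X hy
    rw [pr_not] at h
    linarith

-- A Chernoff bound, by revealing `R` one vertex at a time: a vertex joined with probability `t`
-- changes the bound by the factor `t / e + (1 - t) ≤ 1 - t / 2 ≤ exp (-a / 2)`.
open Classical in
lemma pr_few_le {q : Fin s × E → unitInterval} {X R : Finset V} (hXR : Disjoint X R) {a : ℝ}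
    (ha : ∀ y ∈ R, a ≤ pr q (fun ω => AllAdj lab ω X y)) (h : ℕ) :
    pr q (fun ω => (R.filter fun y => AllAdj lab ω X y).card < h) ≤
      Real.exp (h - R.card * a / 2) := by
  induction R using Finset.induction_on generalizing h with
  | empty =>
    simp only [Finset.filter_empty, Finset.card_empty, Nat.cast_zero, zero_mul, zero_div, sub_zero]
    refine pr_le_one.trans ?_
    rw [← Real.exp_zero]
    exact Real.exp_le_exp.2 (Nat.cast_nonneg _)
  | insert y R hy ih =>
    rcases h with _ | h
    · simp only [not_lt_zero, pr_false]; positivity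
    have hX : Disjoint X R := hXR.mono_right (Finset.subset_insert _ _)
    have ih' := ih hX fun z hz => ha z (by simp [hz])
    have hyX : y ∉ X := fun hyX => Finset.disjoint_left.1 hXR hyX (by simp)
    have hdep : ∀ m, DependsOn (fun ω : Fin s × E → Prop =>
        (R.filter fun y => AllAdj lab ω X y).card < m) (pairCoords s lab X R) := by
      intro m ω ω' hω
      have : (R.filter fun y => AllAdj lab ω X y) = R.filter fun y => AllAdj lab ω' X y := by
        refine Finset.filter_congr fun z hz => ?_
        exact iff_of_eq ((dependsOn_allAdj lab X z).event_mono (pairCoords_mono lab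
          subset_rfl (Finset.singleton_subset_iff.2 hz)) hω)
      simp only [this]
    have hdisj : Disjoint (pairCoords s lab X {y}) (pairCoords s lab X R) :=
      (disjoint_pairCoords lab hX (by simpa using hy))
    set A : (Fin s × E → Prop) → Prop := fun ω => AllAdj lab ω X y with hA
    have hAdep := dependsOn_allAdj (s := s) lab X y
    have e1 := pr_and_of_disjoint (q := q) hAdep (hdep h) hdisj
    have e2 := pr_and_of_disjoint (q := q) hAdep.event_not (hdep (h + 1)) hdisj
    have hle : pr q (fun ω => ((insert y R).filter fun y => AllAdj lab ω X y).card < h + 1) ≤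
        pr q (fun ω => A ω ∧ (R.filter fun y => AllAdj lab ω X y).card < h) +
        pr q (fun ω => ¬ A ω ∧ (R.filter fun y => AllAdj lab ω X y).card < h + 1) := by
      refine le_trans (pr_mono fun ω hω => ?_) pr_or_le
      rw [Finset.filter_insert] at hω
      by_cases hAω : A ω
      · left
        rw [if_pos hAω, Finset.card_insert_of_notMem (by simp [hy])] at hω
        exact ⟨hAω, by omega⟩
      · right
        rw [if_neg hAω] at hω
        exact ⟨hAω, hω⟩
    rw [e1, e2, pr_not] at hle
    have ha' := ha y (by simp)
    have h0 : 0 ≤ pr q (fun ω => AllAdj lab ω X y) := pr_nonneg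
    have h1 : pr q (fun ω => AllAdj lab ω X y) ≤ 1 := pr_le_one
    set t := pr q (fun ω => AllAdj lab ω X y)
    set r : ℝ := Real.exp (h - R.card * a / 2)
    have hr : 0 < r := Real.exp_pos _
    have i1 : pr q (fun ω => (R.filter fun y => AllAdj lab ω X y).card < h) ≤ r := ih' h
    have i2 : pr q (fun ω => (R.filter fun y => AllAdj lab ω X y).card < h + 1) ≤
        r * Real.exp 1 := by
      refine (ih' (h + 1)).trans (le_of_eq ?_)
      rw [← Real.exp_add]; congr 1; push_cast; ring
    have he : (2 : ℝ) ≤ Real.exp 1 := by have := Real.add_one_le_exp (1 : ℝ); linarith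
    have i3 : Real.exp ((h + 1 : ℕ) - (insert y R).card * a / 2) =
        r * Real.exp 1 * Real.exp (- (a / 2)) := by
      rw [← Real.exp_add, ← Real.exp_add, Finset.card_insert_of_notMem hy]; congr 1
      push_cast; ring
    have i4 : 1 - a / 2 ≤ Real.exp (-(a / 2)) := by
      have := Real.add_one_le_exp (-(a / 2)); linarith
    rw [i3]
    calc _ ≤ t * r + (1 - t) * (r * Real.exp 1) := by
          refine hle.trans (add_le_add (mul_le_mul_of_nonneg_left i1 h0)
            (mul_le_mul_of_nonneg_left i2 (by linarith)))
      _ ≤ r * Real.exp 1 * (1 - t / 2) := by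
          have := mul_le_mul_of_nonneg_left he (mul_nonneg h0 hr.le)
          linarith
      _ ≤ r * Real.exp 1 * (1 - a / 2) := by
          apply mul_le_mul_of_nonneg_left _ (by positivity); linarith
      _ ≤ _ := by apply mul_le_mul_of_nonneg_left i4 (by positivity)

-- Nucleation needs this sharper form: there the expected number of joined vertices may be far below
-- one, and the bound of `pr_few_le` with `h = 1` would exceed one.
open Classical in
lemma pr_none_le {q : Fin s × E → unitInterval} {X R : Finset V} (hXR : Disjoint X R) {a : ℝ}
    (ha : ∀ y ∈ R, a ≤ pr q (fun ω => AllAdj lab ω X y)) :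
    pr q (fun ω => (R.filter fun y => AllAdj lab ω X y).card < 1) ≤ Real.exp (-(R.card * a)) := by
  have h1 : (fun ω : Fin s × E → Prop => (R.filter fun y => AllAdj lab ω X y).card < 1) =
      fun ω => ∀ y ∈ R, ¬ AllAdj lab ω X y := by
    funext ω
    rw [Nat.lt_one_iff, Finset.card_eq_zero, Finset.filter_eq_empty_iff]
  rw [h1, pr_forall_of_disjoint R (fun y ω => ¬ AllAdj lab ω X y)
    (fun y => pairCoords s lab X {y}) (fun y _ => (dependsOn_allAdj lab X y).event_not)]
  · calc ∏ y ∈ R, pr q (fun ω => ¬ AllAdj lab ω X y) ≤ ∏ y ∈ R, Real.exp (-a) := by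
          refine Finset.prod_le_prod (fun _ _ => pr_nonneg) fun y hy => ?_
          rw [pr_not]
          have := ha y hy
          have := Real.add_one_le_exp (-a)
          linarith
      _ = _ := by rw [Finset.prod_const, ← Real.exp_nat_mul]; congr 1; ring
  · intro y hy z hz hne
    exact disjoint_pairCoords lab (by
      rw [Finset.disjoint_singleton_right]
      exact fun h => Finset.disjoint_left.1 hXR h hz) (by simpa using hne)

end AdjacencyProbability

/-! ### Repeated trials from many seeds -/

section Trials

variable {V E : Type*} [DecidableEq V] {s : ℕ} [Fintype E] {p : Fin s → unitInterval}
  {lab : E → Finset V} {b : ℕ} {T : Finset V}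

/-- The error bound for `Reach` from a set of size `m`. -/
noncomputable def reachErr (ρ : Fin s → ℝ) (T : Finset V) : List (Finset V × ℕ) → ℕ → ℝ
  | [], m => T.card * ∑ i, Real.exp (-(ρ i * m))
  | (R, h) :: L, m => Real.exp (h - R.card * adjBound ρ m / 2) + reachErr ρ T L (m + h)

omit [DecidableEq V] in
lemma reachErr_nonneg (ρ : Fin s → ℝ) (T : Finset V) (L : List (Finset V × ℕ)) (m : ℕ) :
    0 ≤ reachErr ρ T L m := by
  induction L generalizing m with
  | nil => unfold reachErr; positivity
  | cons P L ih => unfold reachErr; have := ih (m + P.2); positivity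

omit [DecidableEq V] in
lemma reachErr_cons (ρ : Fin s → ℝ) (T R : Finset V) (h : ℕ) (L : List (Finset V × ℕ)) (m : ℕ) :
    reachErr ρ T ((R, h) :: L) m =
      Real.exp (h - R.card * adjBound ρ m / 2) + reachErr ρ T L (m + h) := rfl

lemma pr_not_allAdj_le (hb : ∀ u v : V, u ≠ v → b ≤ Nat.card {e // lab e = {u, v}})
    (X : Finset V) {y : V} (hy : y ∉ X) :
    pr (fun c : Fin s × E => p c.1) (fun ω => ¬ AllAdj lab ω X y) ≤
      ∑ i, Real.exp (-(p i * b * X.card)) := by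
  calc pr (fun c : Fin s × E => p c.1) (fun ω => ¬ AllAdj lab ω X y)
      ≤ pr (fun c : Fin s × E => p c.1) (fun ω => ∃ i ∈ Finset.univ,
          ¬ ∃ x ∈ X, ∃ e, ω (i, e) ∧ lab e = {x, y}) := pr_mono fun ω hω => by
        unfold AllAdj at hω
        rw [not_forall] at hω
        obtain ⟨i, hi⟩ := hω
        exact ⟨i, Finset.mem_univ _, hi⟩
    _ ≤ _ := pr_exists_le _ _
    _ ≤ _ := Finset.sum_le_sum fun i _ => pr_not_adj_le hb i X hy

/-- The pools are exposed one by one and each is charged by `pr_few_le`. Exactly `h` of the found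
vertices are kept, so the error depends only on the sizes, and the pairs queried later avoid the
exposed ones. -/
lemma pr_not_reach_le (hb : ∀ u v : V, u ≠ v → b ≤ Nat.card {e // lab e = {u, v}})
    (L : List (Finset V × ℕ)) (hL : Pooled T L) (X : Finset V) (hX : Disjoint X (poolUnion T L)) :
    pr (fun c : Fin s × E => p c.1) (fun ω => ¬ Reach lab T ω L X) ≤
      reachErr (fun i => (p i : ℝ) * b) T L X.card := by
  classical
  induction L generalizing X with
  | nil =>
    calc pr (fun c : Fin s × E => p c.1) (fun ω => ¬ Reach lab T ω [] X)
        ≤ pr (fun c : Fin s × E => p c.1) (fun ω => ∃ t ∈ T, ¬ AllAdj lab ω X t) :=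
          pr_mono fun ω hω => by
            unfold Reach at hω
            push Not at hω
            exact hω
      _ ≤ _ := pr_exists_le _ _
      _ ≤ ∑ t ∈ T, ∑ i, Real.exp (-(p i * b * X.card)) :=
          Finset.sum_le_sum fun t ht => pr_not_allAdj_le hb X
            (fun h => Finset.disjoint_left.1 hX h ht)
      _ = _ := by rw [Finset.sum_const, nsmul_eq_mul]; rfl
  | cons P L ih =>
    obtain ⟨R, h⟩ := P
    obtain ⟨hR, hL'⟩ := hL
    have hXR : Disjoint X R := hX.mono_right Finset.subset_union_left
    have hXL : Disjoint X (poolUnion T L) := hX.mono_right Finset.subset_union_right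
    have hexp := pr_expose (q := fun c : Fin s × E => p c.1) lab X R h
      (fun ω => ¬ Reach lab T ω ((R, h) :: L) X) 1
      (reachErr (fun i => (p i : ℝ) * b) T L (X.card + h))
      (fun S _ _ => ⟨fun _ => True, ∅, by simp, dependsOn_event_const _, pr_true.le,
        fun _ _ _ => trivial⟩)
      (fun S hS hcard => by
        obtain ⟨Y, hY, hYc⟩ := Finset.exists_subset_card_eq hcard
        have hYR := hY.trans hS
        have hYd : Disjoint (X ∪ Y) (poolUnion T L) :=
          Finset.disjoint_union_left.2 ⟨hXL, hR.mono_left hYR⟩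
        refine ⟨_, _, disjoint_pairCoords lab hXL hR,
          (dependsOn_reach lab T L (X ∪ Y)).event_not, ?_, ?_⟩
        · refine (ih hL' _ hYd).trans (le_of_eq ?_)
          rw [Finset.card_union_of_disjoint (hXR.mono_right hYR), hYc]
        · intro ω hω hn hr
          refine hn ⟨Y, hYR, hYc, fun y hy => ?_, hr⟩
          have : y ∈ R.filter fun y => AllAdj lab ω X y := hω ▸ hY hy
          exact (Finset.mem_filter.1 this).2)
    have hfew := pr_few_le (q := fun c : Fin s × E => p c.1) hXR (fun y hy => adjBound_le_pr hb X
      (fun h => Finset.disjoint_left.1 hXR h hy)) h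
    refine hexp.trans ?_
    have herr := reachErr_nonneg (fun i => (p i : ℝ) * b) T L (X.card + h)
    set f := pr (fun c : Fin s × E => p c.1)
      (fun ω => (R.filter fun y => AllAdj lab ω X y).card < h)
    have hf0 : 0 ≤ f := pr_nonneg
    have := mul_nonneg hf0 herr
    rw [reachErr_cons]
    linarith

/-- The list that searches the pools `Ps` for one vertex each and then proceeds with `L`. -/
def onePerPool (Ps : List (Finset V)) (L : List (Finset V × ℕ)) : List (Finset V × ℕ) :=
  Ps.map (fun P => (P, 1)) ++ L

lemma poolUnion_onePerPool_map_subset (f : Finset V → Finset V) (hf : ∀ P, f P ⊆ P)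
    (Ps : List (Finset V)) (L : List (Finset V × ℕ)) :
    poolUnion T (onePerPool (Ps.map f) L) ⊆ poolUnion T (onePerPool Ps L) := by
  induction Ps with
  | nil => simp [onePerPool]
  | cons P Ps ih => exact Finset.union_subset_union (hf P) ih

lemma poolUnion_subset_onePerPool (Ps : List (Finset V)) (L : List (Finset V × ℕ)) :
    poolUnion T L ⊆ poolUnion T (onePerPool Ps L) := by
  induction Ps with
  | nil => simp [onePerPool]
  | cons P Ps ih => exact ih.trans Finset.subset_union_right

lemma Pooled.onePerPool_map (f : Finset V → Finset V) (hf : ∀ P, f P ⊆ P)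
    (Ps : List (Finset V)) (L : List (Finset V × ℕ)) (h : Pooled T (onePerPool Ps L)) :
    Pooled T (onePerPool (Ps.map f) L) := by
  induction Ps with
  | nil => exact h
  | cons P Ps ih =>
    exact ⟨h.1.mono (hf P) (poolUnion_onePerPool_map_subset f hf Ps L), ih h.2⟩

lemma disjoint_poolUnion_map_sdiff (X : Finset V)
    (Ps : List (Finset V)) (L : List (Finset V × ℕ)) (h : Disjoint X (poolUnion T L)) :
    Disjoint X (poolUnion T (onePerPool (Ps.map (· \ X)) L)) := by
  induction Ps with
  | nil => exact h
  | cons P Ps ih => exact Finset.disjoint_union_right.2 ⟨Finset.disjoint_sdiff, ih⟩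

omit [Fintype E] in
lemma Reach.onePerPool_mono {ω : Fin s × E → Prop} (f g : Finset V → Finset V)
    (hfg : ∀ P, f P ⊆ g P) (Ps : List (Finset V)) (L : List (Finset V × ℕ)) (X : Finset V)
    (h : Reach lab T ω (onePerPool (Ps.map f) L) X) :
    Reach lab T ω (onePerPool (Ps.map g) L) X := by
  induction Ps generalizing X with
  | nil => exact h
  | cons P Ps ih =>
    obtain ⟨Y, h1, h2, h3, h4⟩ := h
    exact ⟨Y, h1.trans (hfg P), h2, h3, ih _ h4⟩

/-- One trial: a search from `X` through the remaining pools, together with a background event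
`C X` that is insensitive to the pairs meeting `X`. -/
lemma pr_trial_le (hb : ∀ u v : V, u ≠ v → b ≤ Nat.card {e // lab e = {u, v}})
    {L : List (Finset V × ℕ)} {M w : ℕ} {β N : ℝ} {σ : ℕ → ℝ} (hN : 0 ≤ N) (hβ0 : 0 ≤ β)
    (hσ0 : ∀ m, 0 ≤ σ m)
    (hσ : ∀ m, 1 ≤ m → m ≤ M →
      Real.exp (-(w * adjBound (fun i => (p i : ℝ) * b) m)) ≤ 1 - σ m)
    (hβ : ∀ X, Disjoint X (poolUnion T L) → X.card = M + 1 →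
      pr (fun c : Fin s × E => p c.1) (fun ω => ¬ Reach lab T ω L X) ≤ β)
    (Z : Finset V) (C : Finset V → (Fin s × E → Prop) → Prop)
    (hCanti : ∀ X X' ω, X ⊆ X' → C X ω → C X' ω)
    (hCdep : ∀ X, Disjoint X Z → DependsOn (C X) {c | Disjoint (lab c.2) X})
    (hCN : ∀ X, Disjoint X Z → X.card ≤ M + 1 → pr (fun c : Fin s × E => p c.1) (C X) ≤ N)
    (Ps : List (Finset V)) (X : Finset V) (hpool : Pooled T (onePerPool Ps L))
    (hX : Disjoint X (poolUnion T (onePerPool Ps L))) (hXZ : Disjoint X Z)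
    (hPs : ∀ P ∈ Ps, w ≤ P.card ∧ Disjoint P Z) (hX1 : 1 ≤ X.card)
    (hlen : X.card + Ps.length = M + 1) :
    pr (fun c : Fin s × E => p c.1) (fun ω => ¬ Reach lab T ω (onePerPool Ps L) X ∧ C X ω) ≤
      (1 - ∏ i ∈ Finset.range Ps.length, σ (X.card + i)) * N + β := by
  classical
  induction Ps generalizing X with
  | nil =>
    simp only [List.length_nil, Finset.range_zero, Finset.prod_empty, sub_self, zero_mul, zero_add]
    -- The nucleus is complete. The pools of `L` are shared by all trials, so independence of the
    -- background is given up here and `β` is added instead of being multiplied.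
    refine le_trans (pr_mono fun ω hω => hω.1) (hβ X hX (by simpa using hlen))
  | cons P Ps ih =>
    obtain ⟨hP, hpool'⟩ := hpool
    have hXP : Disjoint X P := hX.mono_right Finset.subset_union_left
    have hXL : Disjoint X (poolUnion T (onePerPool Ps L)) := hX.mono_right Finset.subset_union_right
    have hlen' : X.card + Ps.length + 1 = M + 1 := by simpa [add_assoc] using hlen
    have havoid : ∀ Y, X ⊆ Y → Disjoint (pairCoords s lab X P) {c | Disjoint (lab c.2) Y} := by
      intro Y hXY
      rw [Set.disjoint_left]
      rintro c ⟨x, hx, y, hy, h⟩ hc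
      exact Finset.disjoint_left.1 hc (by rw [h]; simp) (hXY hx)
    set Δ := ∏ i ∈ Finset.range Ps.length, σ (X.card + 1 + i) with hΔ
    have hexp := pr_expose (q := fun c : Fin s × E => p c.1) lab X P 1
      (fun ω => ¬ Reach lab T ω (onePerPool (P :: Ps) L) X ∧ C X ω) N ((1 - Δ) * N + β)
      -- A trial that stops here leaves the background event, which ignores all pairs meeting `X`
      -- and keeps its unconditional bound `N`.
      (fun S _ _ => ⟨C X, _, havoid X subset_rfl, hCdep X hXZ, hCN X hXZ (by omega),
        fun _ _ h => h.2⟩)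
      (fun S hS hcard => by
        obtain ⟨y, hy⟩ := Finset.card_pos.1 hcard
        have hyP := hS hy
        have hyX : y ∉ X := fun h => Finset.disjoint_left.1 hXP h hyP
        have hcardXy : (X ∪ {y}).card = X.card + 1 := by
          rw [Finset.card_union_of_disjoint (by simpa using hyX), Finset.card_singleton]
        have hyd : Disjoint (X ∪ {y}) (poolUnion T (onePerPool Ps L)) :=
          Finset.disjoint_union_left.2 ⟨hXL, hP.mono_left (by simpa using hyP)⟩
        have hyZ : Disjoint (X ∪ {y}) Z := Finset.disjoint_union_left.2
          ⟨hXZ, (hPs P (by simp)).2.mono_left (by simpa using hyP)⟩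
        have hdis := Set.disjoint_union_right.2 ⟨disjoint_pairCoords (s := s) lab
          (Y := (X ∪ {y}) ∪ poolUnion T (onePerPool Ps L)) hXL hP,
          havoid (X ∪ {y}) Finset.subset_union_left⟩
        have hmain := ih (X ∪ {y}) hpool' hyd hyZ (fun Q hQ => hPs Q (by simp [hQ])) (by omega)
          (by omega)
        rw [hcardXy] at hmain
        refine ⟨fun ω => ¬ Reach lab T ω (onePerPool Ps L) (X ∪ {y}) ∧ C (X ∪ {y}) ω, _, hdis,
          ?_, hmain, ?_⟩
        · refine DependsOn.event_and ?_ ?_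
          · exact ((dependsOn_reach lab T _ (X ∪ {y})).event_not).event_mono
              Set.subset_union_left
          · exact (hCdep _ hyZ).event_mono Set.subset_union_right
        · rintro ω hω ⟨h1, h2⟩
          refine ⟨fun hr => h1 ⟨{y}, by simpa using hyP, by simp, fun z hz => ?_, hr⟩,
            hCanti _ _ _ Finset.subset_union_left h2⟩
          rw [Finset.mem_singleton] at hz
          subst hz
          have : z ∈ P.filter fun y => AllAdj lab ω X y := hω ▸ hy
          exact (Finset.mem_filter.1 this).2)
    have hnone := pr_none_le (q := fun c : Fin s × E => p c.1) hXP (fun y hy => adjBound_le_pr hb X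
      (fun h => Finset.disjoint_left.1 hXP h hy))
    have hfσ : Real.exp (-(P.card * adjBound (fun i => (p i : ℝ) * b) X.card)) ≤
        1 - σ X.card := by
      refine le_trans (Real.exp_le_exp.2 (neg_le_neg ?_)) (hσ X.card hX1 (by omega))
      refine mul_le_mul_of_nonneg_right (by exact_mod_cast (hPs P (by simp)).1)
        (adjBound_nonneg (fun i => ?_) (by positivity))
      have := (p i).2.1
      positivity
    refine hexp.trans ?_
    set f := pr (fun c : Fin s × E => p c.1)
      (fun ω => (P.filter fun y => AllAdj lab ω X y).card < 1)
    have hf0 : 0 ≤ f := pr_nonneg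
    have hf1 : f ≤ 1 - σ X.card := hnone.trans hfσ
    have hprod : ∏ i ∈ Finset.range (P :: Ps).length, σ (X.card + i) = σ X.card * Δ := by
      rw [List.length_cons, Finset.prod_range_succ', mul_comm]
      simp only [add_zero, hΔ]
      congr 1
      refine Finset.prod_congr rfl fun i _ => ?_
      congr 1; ring
    rw [hprod]
    have hΔ0 : 0 ≤ Δ := Finset.prod_nonneg fun i _ => hσ0 _
    -- The exposure gives `f * N + (1 - f) * ((1 - Δ) * N + β)`, which is at most the claim because
    -- `f ≤ 1 - σ X.card`.
    have h1 : 0 ≤ Δ * N * (1 - σ X.card - f) :=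
      mul_nonneg (mul_nonneg hΔ0 hN) (by linarith)
    have h2 : 0 ≤ f * β := mul_nonneg hf0 hβ0
    nlinarith

/-- Repeated trials from the starting vertices in `S`. -/
lemma pr_all_trials_le (hb : ∀ u v : V, u ≠ v → b ≤ Nat.card {e // lab e = {u, v}})
    {L : List (Finset V × ℕ)} {M w : ℕ} {β : ℝ} {σ : ℕ → ℝ} (hβ0 : 0 ≤ β)
    (hσ0 : ∀ m, 0 ≤ σ m) (hσ1 : ∀ m, σ m ≤ 1)
    (hσ : ∀ m, 1 ≤ m → m ≤ M →
      Real.exp (-(w * adjBound (fun i => (p i : ℝ) * b) m)) ≤ 1 - σ m)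
    (hβ : ∀ X, Disjoint X (poolUnion T L) → X.card = M + 1 →
      pr (fun c : Fin s × E => p c.1) (fun ω => ¬ Reach lab T ω L X) ≤ β)
    (Ps : List (Finset V)) (S : Finset V) (hpool : Pooled T (onePerPool Ps L))
    (hS : Disjoint S (poolUnion T (onePerPool Ps L)))
    (hPs : ∀ P ∈ Ps, w + S.card * (M + 1) ≤ P.card) (hlen : Ps.length = M) :
    pr (fun c : Fin s × E => p c.1) (fun ω => ∀ a ∈ S, ¬ Reach lab T ω (onePerPool Ps L) {a}) ≤
      (1 - ∏ i ∈ Finset.range M, σ (1 + i)) ^ S.card + S.card * β := by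
  classical
  induction S using Finset.induction_on generalizing Ps with
  | empty => simpa using pr_le_one
  | insert a S ha ih =>
    set Δ := ∏ i ∈ Finset.range M, σ (1 + i) with hΔ
    have hΔ0 : 0 ≤ Δ := Finset.prod_nonneg fun i _ => hσ0 _
    have hΔ1 : Δ ≤ 1 := Finset.prod_le_one (fun i _ => hσ0 _) fun i _ => hσ1 _
    have haP : Disjoint {a} (poolUnion T (onePerPool Ps L)) :=
      hS.mono_left (by simp)
    have hSP : Disjoint S (poolUnion T (onePerPool Ps L)) :=
      hS.mono_left (Finset.subset_insert _ _)
    have hZP : ∀ P ∈ Ps, Disjoint P (S ∪ poolUnion T L) := by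
      clear ih hPs hlen hS
      induction Ps with
      | nil => simp
      | cons Q Ps ih =>
        intro P hP
        rcases List.mem_cons.1 hP with rfl | hP
        · exact Finset.disjoint_union_right.2 ⟨(hSP.mono_right Finset.subset_union_left).symm,
            hpool.1.mono_right (poolUnion_subset_onePerPool Ps L)⟩
        · exact ih hpool.2 (haP.mono_right Finset.subset_union_right)
            (hSP.mono_right Finset.subset_union_right) P hP
    have htrial := pr_trial_le (p := p) (T := T) hb (L := L) (M := M) (w := w) (β := β)
      (N := (1 - Δ) ^ S.card + S.card * β)
      (σ := σ) (by have : 0 ≤ 1 - Δ := by linarith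
                   positivity) hβ0 hσ0 hσ hβ
      (S ∪ poolUnion T L)
      -- The remaining trials are restricted to pools without the vertices `X` already used. Failure
      -- on the full pools implies failure on these, and the restricted failure involves no pair
      -- meeting `X`.
      (fun X ω => ∀ a ∈ S, ¬ Reach lab T ω (onePerPool (Ps.map (· \ X)) L) {a})
      (fun X X' ω hXX' h a ha hr => h a ha (hr.onePerPool_mono _ _
        (fun P => Finset.sdiff_subset_sdiff subset_rfl hXX') Ps L {a}))
      (fun X hX => by
        have hX1 := Finset.disjoint_union_right.1 hX
        refine DependsOn.event_forall fun a => ?_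
        by_cases ha : a ∈ S
        · have h1 := ((dependsOn_reach (s := s) lab T (onePerPool (Ps.map (· \ X)) L)
            {a}).event_not).event_mono (D' := {c | Disjoint (lab c.2) X}) (by
              rintro c ⟨x, hx, y, hy, h⟩
              have hd := disjoint_poolUnion_map_sdiff X Ps L hX1.2
              simp only [Set.mem_ofPred_eq]
              rw [h, Finset.disjoint_insert_left, Finset.disjoint_singleton_left]
              refine ⟨fun hxX => ?_, fun hyX => Finset.disjoint_left.1 hd hyX hy⟩
              rcases Finset.mem_union.1 hx with h | h
              · rw [Finset.mem_singleton] at h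
                subst h
                exact Finset.disjoint_left.1 hX1.1 hxX ha
              · exact Finset.disjoint_left.1 hd hxX h)
          intro ω ω' h'
          have := h1 h'
          simp only [this]
        · intro ω ω' _
          simp [ha])
      (fun X hX hXc => by
        have hX1 := Finset.disjoint_union_right.1 hX
        refine ih (Ps.map (· \ X)) (hpool.onePerPool_map _ (fun _ => Finset.sdiff_subset) Ps L)
          (hSP.mono_right (poolUnion_onePerPool_map_subset _ (fun _ => Finset.sdiff_subset) Ps L))
          (fun P hP => ?_) (by simpa using hlen)
        obtain ⟨Q, hQ, rfl⟩ := List.mem_map.1 hP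
        -- The current trial removes at most `M + 1` vertices from a pool; the surplus in the
        -- assumed pool size pays for this once per seed.
        have h1 := hPs Q hQ
        rw [Finset.card_insert_of_notMem ha] at h1
        have h2 := Finset.le_card_sdiff X Q
        have h3 : (S.card + 1) * (M + 1) = S.card * (M + 1) + (M + 1) := by ring
        omega)
      Ps {a} hpool haP (by
        refine Finset.disjoint_union_right.2 ⟨by simpa using ha,
          haP.mono_right (poolUnion_subset_onePerPool Ps L)⟩)
      (fun P hP => ⟨by have := hPs P hP; have := Nat.zero_le ((insert a S).card * (M + 1)); omega,
        hZP P hP⟩) (by simp) (by simp [hlen, add_comm])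
    have hle : pr (fun c : Fin s × E => p c.1)
        (fun ω => ∀ a' ∈ insert a S, ¬ Reach lab T ω (onePerPool Ps L) {a'}) ≤
        (1 - Δ) * ((1 - Δ) ^ S.card + S.card * β) + β := by
      refine le_trans (pr_mono fun ω hω => ?_) (htrial.trans (le_of_eq ?_))
      · refine ⟨hω a (by simp), fun a' ha' hr => hω a' (by simp [ha']) ?_⟩
        have := hr.onePerPool_mono _ id (fun P => Finset.sdiff_subset) Ps L {a'}
        simpa using this
      · rw [hlen, Finset.card_singleton]
    refine hle.trans ?_
    rw [Finset.card_insert_of_notMem ha, pow_succ]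
    have : 0 ≤ Δ * (S.card * β) := by positivity
    push_cast
    nlinarith

end Trials

/-! ### Consequences of the threshold conditions for a single growth step -/

section AdjBound

variable {s : ℕ} {ρ : Fin s → ℝ}

lemma min_one_half_le_one_sub_exp {x : ℝ} (hx : 0 ≤ x) : min 1 x / 2 ≤ 1 - Real.exp (-x) := by
  have h1 : Real.exp (-x) ≤ 1 / (1 + x) := by
    rw [Real.exp_neg, ← one_div]
    exact one_div_le_one_div_of_le (by linarith) (by have := Real.add_one_le_exp x; linarith)
  have h2 : 1 - 1 / (1 + x) = x / (1 + x) := by field_simp; ring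
  have h3 : min 1 x / 2 ≤ x / (1 + x) := by
    rw [div_le_div_iff₀ (by norm_num) (by linarith)]
    rcases le_total 1 x with h | h
    · rw [min_eq_left h]; linarith
    · rw [min_eq_right h]; nlinarith
  linarith

lemma prod_min_le_adjBound (hρ : ∀ i, 0 ≤ ρ i) {m : ℝ} (hm : 0 ≤ m) :
    (1 / 2 : ℝ) ^ s * ∏ i, min 1 (ρ i * m) ≤ adjBound ρ m := by
  have : (1 / 2 : ℝ) ^ s = ∏ _i : Fin s, (1 / 2 : ℝ) := by simp
  rw [this, ← Finset.prod_mul_distrib]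
  refine Finset.prod_le_prod (fun i _ => ?_) fun i _ => ?_
  · have := mul_nonneg (hρ i) hm
    have : 0 ≤ min 1 (ρ i * m) := le_min zero_le_one this
    positivity
  · have := min_one_half_le_one_sub_exp (mul_nonneg (hρ i) hm)
    linarith

/-- The threshold assumptions on the rates, with `x` in the role of the number of vertices and `l`
of its logarithm. -/
structure RateBound (ρ : Fin s → ℝ) (c x l : ℝ) : Prop where
  nonneg : ∀ i, 0 ≤ ρ i
  mono : Monotone ρ
  single : ∀ i, c * l / x ≤ ρ i
  prod : ∀ r : ℕ, 2 ≤ r → r ≤ s →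
    c / (x * l ^ (r - 1)) ≤ ∏ i ∈ Finset.univ.filter (fun i : Fin s => (i : ℕ) < r), ρ i

/-- Let `r` be the number of colours with `ρ i * m < 1`. By monotonicity these are the first `r`,
and the other factors are at least `1/2`. The three outcomes are `r ≥ 2` (product condition), `r =
1` (condition on single rates) and `r = 0`. -/
lemma RateBound.adjBound_cases {c x l : ℝ} (h : RateBound ρ c x l) (hx : 0 < x) (hl : 0 < l)
    {m : ℝ} (hm : 0 < m) :
    (∃ r, 2 ≤ r ∧ r ≤ s ∧ (1 / 2 : ℝ) ^ s * c * m * (m / l) ^ (r - 1) ≤ x * adjBound ρ m) ∨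
      (1 / 2 : ℝ) ^ s * c * m * l ≤ x * adjBound ρ m ∨ (1 / 2 : ℝ) ^ s ≤ adjBound ρ m := by
  classical
  have hA := prod_min_le_adjBound h.nonneg hm.le
  have hex : ∃ r : ℕ, ∀ i : Fin s, r ≤ i → 1 ≤ ρ i * m := ⟨s, fun i hi => by omega⟩
  obtain ⟨r, hr, hmin⟩ : ∃ r : ℕ, (∀ i : Fin s, r ≤ i → 1 ≤ ρ i * m) ∧
      ∀ i : Fin s, (i : ℕ) < r → ρ i * m < 1 := by
    refine ⟨Nat.find hex, Nat.find_spec hex, fun i hi => ?_⟩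
    have := Nat.find_min hex hi
    push Not at this
    obtain ⟨i', h1, h2⟩ := this
    exact lt_of_le_of_lt (mul_le_mul_of_nonneg_right (h.mono h1) hm.le) h2
  wlog hrs : r ≤ s generalizing r
  · exact this s (fun i hi => by omega) (fun i hi => hmin i (by omega)) le_rfl
  have hprod : ∏ i, min 1 (ρ i * m) =
      (∏ i ∈ Finset.univ.filter (fun i : Fin s => (i : ℕ) < r), ρ i) * m ^ r := by
    have hcard : (Finset.univ.filter (fun i : Fin s => (i : ℕ) < r)).card = r := by
      rw [Fin.card_filter_val_lt]; omega
    rw [← Finset.prod_filter_mul_prod_filter_not Finset.univ (fun i : Fin s => (i : ℕ) < r)]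
    have h2 : ∏ i ∈ Finset.univ.filter (fun i : Fin s => ¬ (i : ℕ) < r), min 1 (ρ i * m) = 1 :=
      Finset.prod_eq_one fun i hi => min_eq_left (hr i (not_lt.1 (Finset.mem_filter.1 hi).2))
    rw [h2, mul_one, ← hcard, ← Finset.prod_const, hcard, ← Finset.prod_mul_distrib]
    exact Finset.prod_congr rfl fun i hi =>
      min_eq_right (hmin i (Finset.mem_filter.1 hi).2).le
  rw [hprod] at hA
  have hκ : 0 < (1 / 2 : ℝ) ^ s := by positivity
  obtain _ | _ | r := r
  · right; right
    simpa using hA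
  · right; left
    have h0 : 0 < s := by omega
    have e : Finset.univ.filter (fun i : Fin s => (i : ℕ) < 0 + 1) = {⟨0, h0⟩} := by
      ext i; simp [Fin.ext_iff]
    rw [e, Finset.prod_singleton] at hA
    have h1 := h.single ⟨0, h0⟩
    rw [div_le_iff₀ hx] at h1
    calc (1 / 2 : ℝ) ^ s * c * m * l = (1 / 2 : ℝ) ^ s * m * (c * l) := by ring
      _ ≤ (1 / 2 : ℝ) ^ s * m * (ρ ⟨0, h0⟩ * x) := by gcongr
      _ = x * ((1 / 2 : ℝ) ^ s * (ρ ⟨0, h0⟩ * m ^ (0 + 1))) := by ring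
      _ ≤ _ := by gcongr
  · left
    refine ⟨r + 2, by omega, hrs, ?_⟩
    have h1 := h.prod (r + 2) (by omega) hrs
    set Q := ∏ i ∈ Finset.univ.filter (fun i : Fin s => (i : ℕ) < r + 2), ρ i
    have e : r + 2 - 1 = r + 1 := by omega
    rw [e] at h1 ⊢
    rw [div_le_iff₀ (by positivity)] at h1
    calc (1 / 2 : ℝ) ^ s * c * m * (m / l) ^ (r + 1)
        = (1 / 2 : ℝ) ^ s * m ^ (r + 2) / l ^ (r + 1) * c := by
          rw [div_pow]; ring
      _ ≤ (1 / 2 : ℝ) ^ s * m ^ (r + 2) / l ^ (r + 1) * (Q * (x * l ^ (r + 1))) := by gcongr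
      _ = x * ((1 / 2 : ℝ) ^ s * (Q * m ^ (r + 2))) := by field_simp
      _ ≤ _ := by gcongr

/-- Success probability of a nucleation step. -/
lemma RateBound.nucleus_step {c x l ε : ℝ} (h : RateBound ρ c x l) (hx : 0 < x) (hl : 0 < l)
    (hs : 2 ≤ s) (hε : 0 < ε) (hc : 50 * 2 ^ s / ε ^ (s - 1) ≤ c) (hcx : c * l ≤ x)
    {M m w : ℕ} (hM : ε * l ≤ M) (hMl : M ≤ l) (hm : 1 ≤ m) (hmM : m ≤ M)
    (hw : x / (50 * M) ≤ w) :
    Real.exp (-(w * adjBound ρ m)) ≤ 1 - ((m : ℝ) / M) ^ s / 2 := by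
  have hm0 : (0 : ℝ) < m := by exact_mod_cast hm
  have hM0 : (0 : ℝ) < M := by exact_mod_cast (lt_of_lt_of_le hm hmM)
  have hmM' : (m : ℝ) ≤ M := by exact_mod_cast hmM
  have hc0 : 0 < c := lt_of_lt_of_le (by positivity) hc
  have hml : (m : ℝ) / l ≤ 1 := by rw [div_le_one hl]; linarith
  have hml0 : 0 ≤ (m : ℝ) / l := by positivity
  have hκ : 0 < (1 / 2 : ℝ) ^ s := by positivity
  have hA0 := adjBound_nonneg h.nonneg hm0.le
  -- As `m ≤ l`, the worst product condition is the one with exponent `s - 1`. The other two cases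
  -- give at least as much because `1 ≤ m` and `c * l ≤ x`.
  have key : (1 / 2 : ℝ) ^ s * c * m * (m / l) ^ (s - 1) ≤ x * adjBound ρ m := by
    have hpow1 : ((m : ℝ) / l) ^ (s - 1) ≤ 1 := pow_le_one₀ hml0 hml
    rcases h.adjBound_cases hx hl hm0 with ⟨r, h2, hr, hA⟩ | hA | hA
    · refine le_trans ?_ hA
      have := pow_le_pow_of_le_one hml0 hml (show r - 1 ≤ s - 1 by omega)
      gcongr
    · refine le_trans ?_ hA
      have : ((m : ℝ) / l) ^ (s - 1) ≤ l := by
        have h1 : (1 : ℝ) ≤ m := by exact_mod_cast hm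
        linarith
      gcongr
    · calc (1 / 2 : ℝ) ^ s * c * m * (m / l) ^ (s - 1) ≤ (1 / 2 : ℝ) ^ s * c * m * 1 := by gcongr
        _ ≤ (1 / 2 : ℝ) ^ s * (c * l) := by
          rw [mul_one, mul_assoc]
          have : (m : ℝ) ≤ l := by linarith
          gcongr
        _ ≤ (1 / 2 : ℝ) ^ s * x := by gcongr
        _ ≤ adjBound ρ m * x := by gcongr
        _ = _ := by ring
  -- Since `ε * l ≤ M`, passing from `l` to `M` costs a factor `ε ^ (s - 1)`, which `c` absorbs.
  have hml2 : ε * (m / M) ≤ m / l := by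
    rw [le_div_iff₀ hl]
    calc ε * (m / M) * l = (ε * l) * (m / M) := by ring
      _ ≤ M * (m / M) := by gcongr
      _ = m := by field_simp
  have hwA : ((m : ℝ) / M) ^ s ≤ w * adjBound ρ m := by
    have hsucc : ((m : ℝ) / M) ^ s = (m / M) * (m / M) ^ (s - 1) := by
      rw [← pow_succ']; congr 1; omega
    have hc' : 50 ≤ (1 / 2 : ℝ) ^ s * c * ε ^ (s - 1) := by
      rw [div_le_iff₀ (by positivity)] at hc
      calc (50 : ℝ) = (1 / 2 : ℝ) ^ s * (50 * 2 ^ s) := by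
            rw [mul_comm (50 : ℝ), ← mul_assoc, ← mul_pow]; norm_num
        _ ≤ (1 / 2 : ℝ) ^ s * (c * ε ^ (s - 1)) := by gcongr
        _ = _ := by ring
    calc ((m : ℝ) / M) ^ s = 50 * ((m / M) * (m / M) ^ (s - 1)) / 50 := by rw [hsucc]; ring
      _ ≤ ((1 / 2 : ℝ) ^ s * c * ε ^ (s - 1)) * ((m / M) * (m / M) ^ (s - 1)) / 50 := by gcongr
      _ = (1 / 2 : ℝ) ^ s * c * m * (ε * (m / M)) ^ (s - 1) / (50 * M) := by
          rw [mul_pow]; field_simp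
      _ ≤ (1 / 2 : ℝ) ^ s * c * m * (m / l) ^ (s - 1) / (50 * M) := by gcongr
      _ ≤ x * adjBound ρ m / (50 * M) := by gcongr
      _ = x / (50 * M) * adjBound ρ m := by ring
      _ ≤ _ := by gcongr
  have hy0 : 0 ≤ ((m : ℝ) / M) ^ s := by positivity
  have hy1 : ((m : ℝ) / M) ^ s ≤ 1 := pow_le_one₀ (by positivity) (by rwa [div_le_one hM0])
  have := min_one_half_le_one_sub_exp hy0
  rw [min_eq_right hy1] at this
  have := Real.exp_le_exp.2 (neg_le_neg hwA)
  linarith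

/-- The product is `(M! / M^M)^s / 2^M`. The ratio is at least `exp (-M)`, since `M^M / M!` is a
term of the exponential series, and `2^M ≤ exp M`. -/
lemma exp_neg_le_prod_nucleus (s M : ℕ) :
    Real.exp (-((s + 1) * M)) ≤ ∏ i ∈ Finset.range M, (((1 + i : ℕ) : ℝ) / M) ^ s / 2 := by
  have h1 : ∏ i ∈ Finset.range M, (((1 + i : ℕ) : ℝ) / M) ^ s / 2 =
      ((M.factorial : ℝ) / M ^ M) ^ s / 2 ^ M := by
    rw [Finset.prod_div_distrib, Finset.prod_pow, Finset.prod_div_distrib]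
    simp only [Finset.prod_const, Finset.card_range]
    congr 3
    rw [← Finset.prod_range_add_one_eq_factorial]
    push_cast
    exact Finset.prod_congr rfl fun i _ => by ring
  rw [h1]
  rcases Nat.eq_zero_or_pos M with rfl | hM
  · simp
  have hM0 : (0 : ℝ) < M := by exact_mod_cast hM
  have h2 : Real.exp (-M) ≤ (M.factorial : ℝ) / M ^ M := by
    have := Real.pow_div_factorial_le_exp (M : ℝ) hM0.le M
    rw [Real.exp_neg, inv_eq_one_div, div_le_div_iff₀ (Real.exp_pos _) (by positivity)]
    rw [div_le_iff₀ (by positivity)] at this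
    linarith
  have h3 : Real.exp (-M) ≤ 1 / 2 ^ M := by
    have : (2 : ℝ) ^ M ≤ Real.exp M := by
      have h : (2 : ℝ) ≤ Real.exp 1 := by have := Real.add_one_le_exp (1 : ℝ); linarith
      calc (2 : ℝ) ^ M ≤ Real.exp 1 ^ M := by gcongr
        _ = _ := by rw [← Real.exp_nat_mul]; simp
    rw [Real.exp_neg, inv_eq_one_div]
    exact one_div_le_one_div_of_le (by positivity) this
  calc Real.exp (-((s + 1) * M)) = Real.exp (-M) ^ s * Real.exp (-M) := by
        rw [← Real.exp_nat_mul, ← Real.exp_add]; congr 1; ring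
    _ ≤ ((M.factorial : ℝ) / M ^ M) ^ s * (1 / 2 ^ M) := by gcongr
    _ = _ := by ring

/-- A doubling step succeeds with high probability. -/
lemma RateBound.doubling_step {c x l ε a K : ℝ} (h : RateBound ρ c x l) (hx : 0 < x) (hl : 0 < l)
    (hs : 2 ≤ s) (hε : 0 < ε) (hε1 : ε ≤ 1) (ha : 0 ≤ a) (hK : K = 2 + 2 * a / ε)
    (hc : 96 * K * 2 ^ s / ε ^ (s - 1) ≤ c) {m B : ℕ} {w : ℝ} (hm : ε * l * 2 ^ B ≤ m)
    (hm' : m ≤ (1 / 2 : ℝ) ^ s / (96 * K) * (x / l))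
    (hw1 : x / (48 * 2 ^ B) ≤ w) (hw2 : x / (96 * l) ≤ w) :
    Real.exp (m - w * adjBound ρ m / 2) ≤ Real.exp (-(a * l)) := by
  have hB : (1 : ℝ) ≤ 2 ^ B := one_le_pow₀ (by norm_num)
  have hm0 : (0 : ℝ) < m := lt_of_lt_of_le (by positivity) hm
  have hK0 : 0 < K := by rw [hK]; positivity
  have hc0 : 0 < c := lt_of_lt_of_le (by positivity) hc
  have hA0 := adjBound_nonneg h.nonneg hm0.le
  have hκ : 0 < (1 / 2 : ℝ) ^ s := by positivity
  have hεs : ε ^ (s - 1) ≤ 1 := pow_le_one₀ hε.le hε1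
  have hc' : 96 * K ≤ (1 / 2 : ℝ) ^ s * c * ε ^ (s - 1) := by
    rw [div_le_iff₀ (by positivity)] at hc
    calc 96 * K = (1 / 2 : ℝ) ^ s * (96 * K * 2 ^ s) := by
          rw [mul_comm (96 * K), ← mul_assoc, ← mul_pow]; norm_num
      _ ≤ (1 / 2 : ℝ) ^ s * (c * ε ^ (s - 1)) := by gcongr
      _ = _ := by ring
  -- The lower bound `x / (48 * 2 ^ B)` on `w` serves the product conditions, whose yield has grown
  -- by a factor `2 ^ B`; the bound `x / (96 * l)` serves the two other cases. The upper bound on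
  -- `m` is used only in the last one.
  have hKm : K * m ≤ w * adjBound ρ m := by
    rcases h.adjBound_cases hx hl hm0 with ⟨r, h2, hr, hA⟩ | hA | hA
    · have h1 : ε ^ (s - 1) * 2 ^ B ≤ (m / l) ^ (r - 1) := by
        calc ε ^ (s - 1) * 2 ^ B ≤ ε ^ (r - 1) * (2 ^ B) ^ (r - 1) := by
              have e1 := pow_le_pow_of_le_one hε.le hε1 (show r - 1 ≤ s - 1 by omega)
              have e2 : (2 ^ B : ℝ) ≤ (2 ^ B) ^ (r - 1) := le_self_pow₀ hB (by omega)
              gcongr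
          _ = (ε * 2 ^ B) ^ (r - 1) := by rw [mul_pow]
          _ ≤ _ := by
              have : ε * 2 ^ B ≤ m / l := by rw [le_div_iff₀ hl]; linarith
              gcongr
      calc K * m = 96 * K * m * 2 ^ B / (96 * 2 ^ B) := by field_simp
        _ ≤ ((1 / 2 : ℝ) ^ s * c * ε ^ (s - 1)) * m * 2 ^ B / (48 * 2 ^ B) := by
            gcongr; norm_num
        _ = (1 / 2 : ℝ) ^ s * c * m * (ε ^ (s - 1) * 2 ^ B) / (48 * 2 ^ B) := by ring
        _ ≤ (1 / 2 : ℝ) ^ s * c * m * (m / l) ^ (r - 1) / (48 * 2 ^ B) := by gcongr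
        _ ≤ x * adjBound ρ m / (48 * 2 ^ B) := by gcongr
        _ = x / (48 * 2 ^ B) * adjBound ρ m := by ring
        _ ≤ _ := by gcongr
    · calc K * m = 96 * K * m / 96 := by ring
        _ ≤ ((1 / 2 : ℝ) ^ s * c * ε ^ (s - 1)) * m / 96 := by gcongr
        _ ≤ ((1 / 2 : ℝ) ^ s * c * 1) * m / 96 := by gcongr
        _ = (1 / 2 : ℝ) ^ s * c * m * l / (96 * l) := by field_simp
        _ ≤ x * adjBound ρ m / (96 * l) := by gcongr
        _ = x / (96 * l) * adjBound ρ m := by ring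
        _ ≤ _ := by gcongr
    · calc K * m ≤ K * ((1 / 2 : ℝ) ^ s / (96 * K) * (x / l)) := by gcongr
        _ = x / (96 * l) * (1 / 2 : ℝ) ^ s := by field_simp
        _ ≤ w * adjBound ρ m := by
            have : 0 ≤ w := le_trans (by positivity) hw2
            gcongr
  have hml : ε * l ≤ m := by
    refine le_trans ?_ hm
    exact le_mul_of_one_le_right (by positivity) hB
  -- Half of `K * m` pays for the `m` vertices asked for, and what is left over, `(a / ε) * m`, is
  -- at least `a * l`.
  have h3 : 2 * a * l ≤ 2 * a / ε * m := by
    calc 2 * a * l = 2 * a / ε * (ε * l) := by field_simp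
      _ ≤ _ := by gcongr
  apply Real.exp_le_exp.2
  rw [hK] at hKm
  linarith

/-- The last step, in which every vertex of the pool is joined with positive probability. -/
lemma RateBound.half_pow_le_adjBound {c x l : ℝ} (h : RateBound ρ c x l) {m : ℝ}
    (hm0 : 0 ≤ m) (hm : 1 ≤ c * l / x * m) : (1 / 2 : ℝ) ^ s ≤ adjBound ρ m := by
  have := prod_min_le_adjBound h.nonneg hm0
  rwa [Finset.prod_eq_one, mul_one] at this
  intro i _
  exact min_eq_left (hm.trans (mul_le_mul_of_nonneg_right (h.single i) hm0))

end AdjBound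

/-! ### Sizes of the pools and the total error of the growth -/

section Pools

variable {V : Type*} [DecidableEq V] {s : ℕ} {T : Finset V}

/-- The error bound `reachErr` in terms of the sizes of the pools. -/
noncomputable def sizeErr (ρ : Fin s → ℝ) (t : ℕ) : List (ℕ × ℕ) → ℕ → ℝ
  | [], m => t * ∑ i, Real.exp (-(ρ i * m))
  | (w, h) :: L, m => Real.exp (h - w * adjBound ρ m / 2) + sizeErr ρ t L (m + h)

lemma exists_pools (sizes : List (ℕ × ℕ)) (U : Finset V) (hU : Disjoint U T)
    (hsum : (sizes.map Prod.fst).sum ≤ U.card) :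
    ∃ L : List (Finset V × ℕ), Pooled T L ∧ poolUnion T L ⊆ U ∪ T ∧
      (poolUnion T L).card = (sizes.map Prod.fst).sum + T.card ∧
      ∀ (ρ : Fin s → ℝ) (m : ℕ), reachErr ρ T L m = sizeErr ρ T.card sizes m := by
  induction sizes generalizing U with
  | nil => exact ⟨[], trivial, Finset.subset_union_right, by simp [poolUnion], fun _ _ => rfl⟩
  | cons a sizes ih =>
    obtain ⟨w, h⟩ := a
    simp only [List.map_cons, List.sum_cons] at hsum
    obtain ⟨R, hR, hRc⟩ := Finset.exists_subset_card_eq (show w ≤ U.card by omega)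
    obtain ⟨L, h1, h2, h3, h4⟩ := ih (U \ R) (hU.mono_left Finset.sdiff_subset) (by
      rw [Finset.card_sdiff_of_subset hR]; omega)
    have hd : Disjoint R (poolUnion T L) := Disjoint.mono_right h2
      (Finset.disjoint_union_right.2 ⟨Finset.disjoint_sdiff, hU.mono_left hR⟩)
    refine ⟨(R, h) :: L, ⟨hd, h1⟩, ?_, ?_, fun ρ m => ?_⟩
    · refine Finset.union_subset (hR.trans Finset.subset_union_left) (h2.trans ?_)
      exact Finset.union_subset_union_left Finset.sdiff_subset
    · change (R ∪ poolUnion T L).card = _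
      rw [Finset.card_union_of_disjoint hd, h3, hRc]
      simp only [List.map_cons, List.sum_cons]
      omega
    · rw [reachErr_cons, h4, hRc]; rfl

lemma exists_nucleus_pools (L : List (Finset V × ℕ)) (hL : Pooled T L) (M w : ℕ) (U : Finset V)
    (hU : Disjoint U (poolUnion T L)) (hsum : M * w ≤ U.card) :
    ∃ Ps : List (Finset V), Ps.length = M ∧ Pooled T (onePerPool Ps L) ∧
      poolUnion T (onePerPool Ps L) ⊆ U ∪ poolUnion T L ∧ ∀ P ∈ Ps, w ≤ P.card := by
  induction M generalizing U with
  | zero => exact ⟨[], rfl, hL, Finset.subset_union_right, by simp⟩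
  | succ M ih =>
    rw [add_mul, one_mul] at hsum
    obtain ⟨R, hR, hRc⟩ := Finset.exists_subset_card_eq (show w ≤ U.card by omega)
    obtain ⟨Ps, h1, h2, h3, h4⟩ := ih (U \ R) (hU.mono_left Finset.sdiff_subset) (by
      rw [Finset.card_sdiff_of_subset hR]; omega)
    have hd : Disjoint R (poolUnion T (onePerPool Ps L)) := Disjoint.mono_right h3
      (Finset.disjoint_union_right.2 ⟨Finset.disjoint_sdiff, hU.mono_left hR⟩)
    refine ⟨R :: Ps, by simp [h1], ⟨hd, h2⟩, ?_, ?_⟩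
    · refine Finset.union_subset (hR.trans Finset.subset_union_left) (h3.trans ?_)
      exact Finset.union_subset_union_left Finset.sdiff_subset
    · intro P hP
      rcases List.mem_cons.1 hP with rfl | hP
      · exact hRc.ge
      · exact h4 P hP

end Pools

section DoublingSizes

variable {s : ℕ} {ρ : Fin s → ℝ}

/-- Pool sizes for `r` doubling steps, starting with step `B` from a set of size `m * 2 ^ B`,
followed by one step with pool size `wl` and requirement `hl`. -/
noncomputable def doublingSizes (x l : ℝ) (m wl hl : ℕ) : ℕ → ℕ → List (ℕ × ℕ)
  | _, 0 => [(wl, hl)]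
  | B, r + 1 => (⌈x / (48 * 2 ^ B) + x / (96 * l)⌉₊, m * 2 ^ B) ::
      doublingSizes x l m wl hl (B + 1) r

lemma sum_doublingSizes_le {x l : ℝ} (hx : 0 ≤ x) (hl : 0 < l) (m wl hl' B r : ℕ) :
    (((doublingSizes x l m wl hl' B r).map Prod.fst).sum : ℝ) ≤
      x / (24 * 2 ^ B) + r * (x / (96 * l) + 1) + wl := by
  induction r generalizing B with
  | zero => simp only [doublingSizes, List.map_cons, List.map_nil, List.sum_cons, List.sum_nil,
      add_zero, Nat.cast_zero, zero_mul]; have : 0 ≤ x / (24 * 2 ^ B) := by positivity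
            linarith
  | succ r ih =>
    simp only [doublingSizes, List.map_cons, List.sum_cons]
    have h1 := ih (B + 1)
    have h2 := (Nat.ceil_lt_add_one (a := x / (48 * 2 ^ B) + x / (96 * l)) (by positivity)).le
    have h3 : x / (24 * 2 ^ (B + 1)) = x / (48 * 2 ^ B) := by rw [pow_succ]; congr 1; ring
    have h4 : x / (24 * 2 ^ B) = x / (48 * 2 ^ B) + x / (48 * 2 ^ B) := by field_simp; ring
    rw [h3] at h1
    rw [Nat.cast_add, Nat.cast_add_one]
    linarith

lemma sizeErr_doublingSizes_le {x l δ η : ℝ} (t m wl hl B r : ℕ)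
    (hstep : ∀ b, B ≤ b → b < B + r → Real.exp ((m * 2 ^ b : ℕ) -
      ⌈x / (48 * 2 ^ b) + x / (96 * l)⌉₊ * adjBound ρ (m * 2 ^ b : ℕ) / 2) ≤ δ)
    (hlast : sizeErr ρ t [(wl, hl)] (m * 2 ^ (B + r)) ≤ η) :
    sizeErr ρ t (doublingSizes x l m wl hl B r) (m * 2 ^ B) ≤ r * δ + η := by
  induction r generalizing B with
  | zero => simpa [doublingSizes] using hlast
  | succ r ih =>
    have h1 := hstep B le_rfl (by omega)
    have h2 := ih (B + 1) (fun b hb hb' => hstep b (by omega) (by omega))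
      (by rwa [show B + 1 + r = B + (r + 1) by ring])
    have e : m * 2 ^ B + m * 2 ^ B = m * 2 ^ (B + 1) := by ring
    simp only [doublingSizes]
    change Real.exp _ + sizeErr ρ t _ (m * 2 ^ B + m * 2 ^ B) ≤ _
    rw [e]
    push_cast at h1 h2 ⊢
    linarith

/-- The full error bound for the growth from a nucleus of size `m ≥ ε log n`. -/
lemma RateBound.exists_growth {c x l ε a K : ℝ} (h : RateBound ρ c x l)
    (hx : x = Real.exp l) (hl : 4 ≤ l)
    (hs : 2 ≤ s) (hε : 0 < ε) (hε1 : ε ≤ 1) (ha : 0 ≤ a) (hK : K = 2 + 2 * a / ε)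
    (hc1 : 96 * K * 2 ^ s / ε ^ (s - 1) ≤ c) (hc2 : 96 * K * 2 ^ s ≤ c)
    (hc3 : 400 * a * 2 ^ s ≤ c) (hxl : 400 * 2 ^ s ≤ x) (hxa : 100 * 2 ^ s * (a * l) ≤ x)
    {m : ℕ} (hm : ε * l ≤ m) (hm1 : 1 ≤ m) (t : ℕ) :
    ∃ sizes : List (ℕ × ℕ), ((sizes.map Prod.fst).sum : ℝ) ≤ x / 8 + 2 * l + 1 ∧
      sizeErr ρ t sizes m ≤ (2 * l + 1 + t * s) * Real.exp (-(a * l)) := by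
  have hx0 : 0 < x := hx ▸ Real.exp_pos l
  have hl0 : 0 < l := by linarith
  have hκ : 0 < (1 / 2 : ℝ) ^ s := by positivity
  have hκ1 : (1 / 2 : ℝ) ^ s ≤ 1 := pow_le_one₀ (by norm_num) (by norm_num)
  have hκ2 : (1 / 2 : ℝ) ^ s * 2 ^ s = 1 := by rw [← mul_pow]; norm_num
  have hK2 : 2 ≤ K := by rw [hK]; have : 0 ≤ 2 * a / ε := by positivity
                         linarith
  have hK0 : 0 < K := by linarith
  have hc0 : 0 < c := lt_of_lt_of_le (by positivity) hc2
  have hm0 : (1 : ℝ) ≤ m := by exact_mod_cast hm1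
  set δ := (1 / 2 : ℝ) ^ s / (96 * K) with hδ
  have hδ0 : 0 < δ := by positivity
  have hδ1 : δ ≤ 1 := by
    rw [hδ, div_le_one (by positivity)]; linarith
  have hex : ∃ B : ℕ, δ * (x / l) ≤ (m * 2 ^ B : ℕ) := by
    obtain ⟨B, hB⟩ := pow_unbounded_of_one_lt (δ * (x / l)) (one_lt_two)
    refine ⟨B, hB.le.trans ?_⟩
    push_cast
    exact le_mul_of_one_le_left (by positivity) hm0
  classical
  -- Doubling stops at the first size of order `x / l`. There `ρ i * m ≥ 1` in every colour, and one
  -- last pool yields linearly many vertices.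
  obtain ⟨B, hB, hBmin⟩ : ∃ B : ℕ, δ * (x / l) ≤ (m * 2 ^ B : ℕ) ∧
      ∀ b < B, ((m * 2 ^ b : ℕ) : ℝ) ≤ δ * (x / l) :=
    ⟨Nat.find hex, Nat.find_spec hex, fun b hb => (not_le.1 (Nat.find_min hex hb)).le⟩
  have hB2 : (B : ℝ) ≤ 2 * l := by
    rcases B with _ | B
    · simp; linarith
    · have h1 := hBmin B (by omega)
      have h2 : (2 : ℝ) ^ B ≤ Real.exp l := by
        calc (2 : ℝ) ^ B ≤ m * 2 ^ B := le_mul_of_one_le_left (by positivity) hm0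
          _ ≤ δ * (x / l) := by exact_mod_cast h1
          _ ≤ 1 * (x / 1) := by gcongr; linarith
          _ = _ := by rw [hx]; ring
      have h3 := Real.log_le_log (by positivity) h2
      rw [Real.log_pow, Real.log_exp] at h3
      have h4 := Real.log_two_gt_d9
      push_cast
      nlinarith
  -- In the last pool each vertex is joined with probability at least `(1/2)^s`. Asking for `(1/2)^s
  -- * x / 200` vertices leaves room in the exponent `(1/2)^s * x / 48` of the Chernoff bound.
  set wl := ⌈x / 24⌉₊ with hwl
  set hl' := ⌊(1 / 2 : ℝ) ^ s * x / 200⌋₊ with hhl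
  have hwl1 : x / 24 ≤ wl := Nat.le_ceil _
  have hwl2 : (wl : ℝ) ≤ x / 24 + 1 := (Nat.ceil_lt_add_one (by positivity)).le
  have hκx : 400 ≤ (1 / 2 : ℝ) ^ s * x := by
    calc (400 : ℝ) = (1 / 2 : ℝ) ^ s * (400 * 2 ^ s) := by linear_combination (-400) * hκ2
      _ ≤ _ := by gcongr
  have hκa : 100 * (a * l) ≤ (1 / 2 : ℝ) ^ s * x := by
    calc 100 * (a * l) = (1 / 2 : ℝ) ^ s * (100 * 2 ^ s * (a * l)) := by
          linear_combination (-(100 * (a * l))) * hκ2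
      _ ≤ _ := by gcongr
  have hhl1 : (1 / 2 : ℝ) ^ s * x / 400 ≤ hl' := by
    have := Nat.sub_one_lt_floor ((1 / 2 : ℝ) ^ s * x / 200)
    rw [← hhl] at this
    linarith
  have hhl2 : (hl' : ℝ) ≤ (1 / 2 : ℝ) ^ s * x / 200 := Nat.floor_le (by positivity)
  refine ⟨doublingSizes x l m wl hl' 0 B, ?_, ?_⟩
  · refine (sum_doublingSizes_le hx0.le hl0 m wl hl' 0 B).trans ?_
    -- The geometric parts use `x / 24`, the at most `2 * l` extra parts use `x / 48`, and the last
    -- pool uses `x / 24`; together this is below `x / 8`.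
    have h1 : (B : ℝ) * (x / (96 * l) + 1) ≤ 2 * l * (x / (96 * l) + 1) := by gcongr
    have h2 : 2 * l * (x / (96 * l) + 1) = x / 48 + 2 * l := by field_simp; ring
    rw [pow_zero, mul_one]
    linarith
  · have hlast : sizeErr ρ t [(wl, hl')] (m * 2 ^ (0 + B)) ≤
        (1 + t * s) * Real.exp (-(a * l)) := by
      rw [zero_add]
      have hA : (1 / 2 : ℝ) ^ s ≤ adjBound ρ (m * 2 ^ B : ℕ) := by
        refine h.half_pow_le_adjBound (by positivity) ?_
        calc (1 : ℝ) ≤ c * δ := by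
              rw [hδ, ← mul_div_assoc, le_div_iff₀ (by positivity)]
              calc 1 * (96 * K) = (96 * K * 2 ^ s) * (1 / 2 : ℝ) ^ s := by
                    linear_combination (-(96 * K)) * hκ2
                _ ≤ _ := by gcongr
          _ = c * l / x * (δ * (x / l)) := by field_simp
          _ ≤ _ := by gcongr
      have h1 : Real.exp (hl' - wl * adjBound ρ (m * 2 ^ B : ℕ) / 2) ≤ Real.exp (-(a * l)) := by
        apply Real.exp_le_exp.2
        have : x / 24 * (1 / 2 : ℝ) ^ s ≤ wl * adjBound ρ (m * 2 ^ B : ℕ) := by gcongr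
        nlinarith
      have h2 : ∑ i, Real.exp (-(ρ i * (m * 2 ^ B + hl' : ℕ))) ≤ s * Real.exp (-(a * l)) := by
        calc ∑ i, Real.exp (-(ρ i * (m * 2 ^ B + hl' : ℕ)))
            ≤ ∑ _i : Fin s, Real.exp (-(a * l)) := by
              refine Finset.sum_le_sum fun i _ => Real.exp_le_exp.2 (neg_le_neg ?_)
              have h3 := h.single i
              calc a * l = (400 * a * 2 ^ s) * l / x * ((1 / 2 : ℝ) ^ s * x / 400) := by
                    field_simp
                    linear_combination (-a) * hκ2
                _ ≤ c * l / x * hl' := by gcongr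
                _ ≤ ρ i * (m * 2 ^ B + hl' : ℕ) := by
                    have := h.nonneg i
                    gcongr
                    exact Nat.le_add_left _ _
          _ = _ := by simp
      change Real.exp _ + t * ∑ i, Real.exp (-(ρ i * (m * 2 ^ B + hl' : ℕ))) ≤ _
      have h3 : (t : ℝ) * ∑ i, Real.exp (-(ρ i * (m * 2 ^ B + hl' : ℕ))) ≤
          t * (s * Real.exp (-(a * l))) := by gcongr
      linarith
    have := sizeErr_doublingSizes_le (ρ := ρ) (δ := Real.exp (-(a * l))) (x := x) (l := l)
      t m wl hl' 0 B (fun b _ hb => ?_) hlast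
    · rw [pow_zero, mul_one] at this
      refine this.trans ?_
      have : (B : ℝ) * Real.exp (-(a * l)) ≤ 2 * l * Real.exp (-(a * l)) := by gcongr
      linarith
    · refine h.doubling_step (B := b) hx0 hl0 hs hε hε1 ha hK hc1 ?_ (hBmin b (by omega)) ?_ ?_
      · push_cast; gcongr
      · refine le_trans ?_ (Nat.le_ceil _)
        have : 0 ≤ x / (96 * l) := by positivity
        linarith
      · refine le_trans ?_ (Nat.le_ceil _)
        have : 0 ≤ x / (48 * 2 ^ b) := by positivity
        linarith

end DoublingSizes

/-! ### Joining two given vertices above the threshold -/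

lemma eventually_mul_pow_le_exp (C : ℝ) (k : ℕ) {b : ℝ} (hb : 0 < b) :
    ∀ᶠ l : ℝ in atTop, C * l ^ k ≤ Real.exp (b * l) := by
  have h := ((isLittleO_pow_exp_pos_mul_atTop k hb).const_mul_left C).bound one_pos
  filter_upwards [h] with l hl
  rw [one_mul, Real.norm_of_nonneg (Real.exp_pos _).le] at hl
  exact (le_abs_self _).trans hl

/-- The vertex budget: growth pools take about `x / 8`, nucleus pools `x / 50`, and the reserve for
the seeds only `√x * l ^ 2`, against `x / 3` available vertices. -/
lemma total_pool_size_le {x l : ℝ} (hxl : x = Real.exp l) (hl4 : 4 ≤ l)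
    (f5 : 30 * l ^ 2 ≤ Real.exp (l / 2)) {N M w τ k : ℕ} (hN : x ≤ 3 * N)
    (hMl : (M : ℝ) + 1 ≤ l) (hM0 : (0 : ℝ) < M) (hτ : (τ : ℝ) ≤ Real.exp (l / 2))
    (hw : (w : ℝ) ≤ x / (50 * M) + 1) (hk : (k : ℝ) ≤ x / 8 + 2 * l + 1) :
    k + 2 + M * (w + τ * (M + 1)) + τ ≤ N := by
  have hx0 : 0 < x := hxl ▸ Real.exp_pos l
  have h1 : (M : ℝ) * w ≤ x / 50 + M := by
    calc (M : ℝ) * w ≤ M * (x / (50 * M) + 1) := by gcongr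
      _ = _ := by field_simp
  have h2 : (M : ℝ) * (τ * (M + 1)) ≤ l * (Real.exp (l / 2) * l) := by
    have : (M : ℝ) ≤ l := by linarith
    gcongr
  have h4 : 30 * l ^ 2 * Real.exp (l / 2) ≤ x := by
    have h3 : Real.exp (l / 2) * Real.exp (l / 2) = x := by
      rw [hxl, ← Real.exp_add]; congr 1; ring
    rw [← h3]
    gcongr
  have h5 : 1 ≤ Real.exp (l / 2) := Real.one_le_exp (by positivity)
  have h6 : 4 * l ≤ l ^ 2 := by nlinarith
  have h7 : l ^ 2 ≤ l ^ 2 * Real.exp (l / 2) := le_mul_of_one_le_right (by positivity) h5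
  have h8 : 16 * Real.exp (l / 2) ≤ l ^ 2 * Real.exp (l / 2) := by gcongr; linarith
  have h9 : l * (Real.exp (l / 2) * l) = l ^ 2 * Real.exp (l / 2) := by ring
  have : ((k + 2 + M * (w + τ * (M + 1)) + τ : ℕ) : ℝ) ≤ N := by
    push_cast
    rw [mul_add]
    linarith
  exact_mod_cast this

/-- With `n = exp l`, success probability `n^(-1/4)` and `√n` trials give `n^(1/4)` expected
successes up to constants, which dominates every multiple of `l`. -/
lemma mul_le_of_exp_le {s : ℕ} {l Δ τ g : ℝ} (hl0 : 0 ≤ l)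
    (hΔ : Real.exp (-(s + 1) + -(l / 4)) ≤ Δ)
    (h3 : (g + 1) * Real.exp (s + 1) * l + 1 ≤ Real.exp (l / 4))
    (hτ : Real.exp (l / 2) - 1 ≤ τ) : (g + 1) * l ≤ Δ * τ := by
  rw [Real.exp_add] at hΔ
  have h4 : Real.exp (-(l / 4)) * Real.exp (l / 2) = Real.exp (l / 4) := by
    rw [← Real.exp_add]; congr 1; ring
  have h5 : Real.exp (-(l / 4)) ≤ 1 := Real.exp_le_one_iff.2 (by linarith)
  have h6 : Real.exp (-((s : ℝ) + 1)) * Real.exp (s + 1) = 1 := by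
    rw [← Real.exp_add]; simp
  have h7 : 0 ≤ Real.exp (l / 2) - 1 := by
    have : 1 ≤ Real.exp (l / 2) := Real.one_le_exp (by positivity)
    linarith
  have h8 : 0 < Real.exp (-((s : ℝ) + 1)) * Real.exp (-(l / 4)) := by positivity
  calc (g + 1) * l = Real.exp (-((s : ℝ) + 1)) * ((g + 1) * Real.exp (s + 1) * l) := by
        linear_combination (-((g + 1) * l)) * h6
    _ ≤ Real.exp (-((s : ℝ) + 1)) * (Real.exp (l / 4) - Real.exp (-(l / 4))) := by
        gcongr; linarith
    _ = Real.exp (-((s : ℝ) + 1)) * Real.exp (-(l / 4)) * (Real.exp (l / 2) - 1) := by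
        rw [← h4]; ring
    _ ≤ Δ * τ := mul_le_mul hΔ hτ h7 (h8.le.trans hΔ)

section Joined

variable {V E : Type*} [DecidableEq V] {s : ℕ} {lab : E → Finset V} {T : Finset V}

/-- Being joined is tested by closed predicates `P`, so that a cluster of a closed partition can
later be substituted for `P`. -/
lemma Reach.mem_of_closed {ω : Fin s × E → Prop} {P : V → Prop}
    (hP : ∀ (X : Finset V) (y : V), (∀ x ∈ X, P x) → AllAdj lab ω X y → P y)
    (L : List (Finset V × ℕ)) (X : Finset V) (hX : ∀ x ∈ X, P x) (h : Reach lab T ω L X) :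
    ∀ t ∈ T, P t := by
  induction L generalizing X with
  | nil => exact fun t ht => hP X t hX (h t ht)
  | cons Q L ih =>
    obtain ⟨Y, -, -, h3, h4⟩ := h
    refine ih (X ∪ Y) (fun x hx => ?_) h4
    rcases Finset.mem_union.1 hx with hx | hx
    · exact hX x hx
    · exact hP X x hX (h3 x hx)

end Joined

set_option maxHeartbeats 1000000 in
/-- Above the threshold, two given vertices are joined by the growth of a single cluster, with
failure probability smaller than any fixed power. -/
theorem exists_joined_bound (s : ℕ) (hs : 2 ≤ s) (g : ℕ) : ∃ c₀ : ℝ, 0 < c₀ ∧ ∀ c, c₀ ≤ c →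
    ∀ᶠ n : ℕ in atTop, ∀ (V E : Type) [DecidableEq V] [Fintype V] [Fintype E]
      (lab : E → Finset V) (b : ℕ) (p : Fin s → unitInterval), n ≤ 3 * Fintype.card V →
      (∀ u v : V, u ≠ v → b ≤ Nat.card {e // lab e = {u, v}}) →
      RateBound (fun i => (p i : ℝ) * b) c n (Real.log n) →
      ∀ T : Finset V, T.card = 2 →
        pr (fun c : Fin s × E => p c.1) (fun ω => ¬ ∃ a, ∀ P : V → Prop, P a →
          (∀ (X : Finset V) (y : V), (∀ x ∈ X, P x) → AllAdj lab ω X y → P y) →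
            ∀ t ∈ T, P t) ≤ Real.exp (-(g * Real.log n)) := by
  -- For `M` close to `ε * log n` the nucleation probability `exp (-(s + 1) * M)` is about
  -- `n^(-1/4)`, so `√n` seeds suffice.
  set ε : ℝ := 1 / (4 * (s + 1)) with hε
  have hε0 : 0 < ε := by positivity
  have hs' : (2 : ℝ) ≤ s := by exact_mod_cast hs
  have hε1 : ε ≤ 1 / 12 := by
    rw [hε]; apply one_div_le_one_div_of_le (by norm_num); linarith
  -- Of the two extra powers of `n`, one absorbs the prefactor of `β` and half of the other pays for
  -- the `√n` trials.
  set a : ℝ := g + 2 with ha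
  set K : ℝ := 2 + 2 * a / ε with hK
  have hK0 : 0 < K := by positivity
  refine ⟨50 * 2 ^ s / ε ^ (s - 1) + 96 * K * 2 ^ s / ε ^ (s - 1) + 96 * K * 2 ^ s +
    400 * a * 2 ^ s, by positivity, fun c hc => ?_⟩
  have q1 : 0 < 50 * 2 ^ s / ε ^ (s - 1) := by positivity
  have q2 : 0 < 96 * K * 2 ^ s / ε ^ (s - 1) := by positivity
  have q3 : 0 < 96 * K * 2 ^ s := by positivity
  have q4 : 0 < 400 * a * 2 ^ s := by positivity
  have hc1 : 50 * 2 ^ s / ε ^ (s - 1) ≤ c := by linarith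
  have hc2 : 96 * K * 2 ^ s / ε ^ (s - 1) ≤ c := by linarith
  have hc3 : 96 * K * 2 ^ s ≤ c := by linarith
  have hc4 : 400 * a * 2 ^ s ≤ c := by linarith
  have hlog : Tendsto (fun n : ℕ => Real.log n) atTop atTop :=
    Real.tendsto_log_atTop.comp tendsto_natCast_atTop_atTop
  filter_upwards [hlog.eventually (eventually_ge_atTop 4),
    hlog.eventually (eventually_mul_pow_le_exp c 1 one_pos),
    hlog.eventually (eventually_mul_pow_le_exp (400 * 2 ^ s) 0 one_pos),
    hlog.eventually (eventually_mul_pow_le_exp (100 * 2 ^ s * a) 1 one_pos),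
    hlog.eventually (eventually_mul_pow_le_exp 30 2 (b := 1 / 2) (by norm_num)),
    hlog.eventually (eventually_mul_pow_le_exp ((g + 1) * Real.exp (s + 1) + 1) 1
      (b := 1 / 4) (by norm_num)),
    hlog.eventually (eventually_mul_pow_le_exp (3 + 2 * s) 1 one_pos),
    eventually_gt_atTop 0] with n hl4 f2 f3 f4 f5 f6 f7 hn
  intro V E _ _ _ lab b p hV hb hR T hT
  set l := Real.log n with hl
  set x : ℝ := (n : ℝ) with hx
  have hx0 : 0 < x := by rw [hx]; exact_mod_cast hn
  have hxl : x = Real.exp l := by rw [hl, Real.exp_log hx0]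
  rw [one_mul] at f2 f3 f4 f7
  rw [pow_one] at f2 f4 f6 f7
  rw [pow_zero, mul_one] at f3
  have hl0 : 0 < l := by linarith
  set M : ℕ := ⌈ε * l⌉₊ with hM
  have hM1 : ε * l ≤ M := Nat.le_ceil _
  have hM2 : (M : ℝ) ≤ ε * l + 1 := (Nat.ceil_lt_add_one (by positivity)).le
  have hMl : (M : ℝ) + 1 ≤ l := by nlinarith
  have hM0 : (0 : ℝ) < M := lt_of_lt_of_le (by positivity) hM1
  set τ : ℕ := ⌊Real.exp (l / 2)⌋₊ with hτ
  have hτ1 : (τ : ℝ) ≤ Real.exp (l / 2) := Nat.floor_le (Real.exp_pos _).le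
  have hτ2 : Real.exp (l / 2) - 1 ≤ τ := (Nat.sub_one_lt_floor _).le
  obtain ⟨sizes, hsum, herr⟩ := hR.exists_growth (a := a) hxl hl4 hs hε0 (by linarith)
    (by positivity) hK
    hc2 hc3 hc4 (by rw [hxl]; exact f3) (by rw [hxl, ← mul_assoc]; exact f4) (m := M + 1)
    (by push_cast; linarith) (by omega) 2
  set w : ℕ := ⌈x / (50 * M)⌉₊ with hw
  have hw1 : x / (50 * M) ≤ w := Nat.le_ceil _
  have hw2 : (w : ℝ) ≤ x / (50 * M) + 1 := (Nat.ceil_lt_add_one (by positivity)).le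
  set W : ℕ := w + τ * (M + 1) with hW
  have htotal : (sizes.map Prod.fst).sum + 2 + M * W + τ ≤ Fintype.card V := by
    have hV' : x ≤ 3 * Fintype.card V := by rw [hx]; exact_mod_cast hV
    exact total_pool_size_le hxl hl4 (by convert f5 using 2; ring) hV' hMl hM0 hτ1 hw2 hsum
  obtain ⟨L, hL1, hL2, hL3, hL4⟩ := exists_pools (s := s) (T := T) sizes (Finset.univ \ T)
    Finset.sdiff_disjoint (by
      rw [Finset.card_sdiff_of_subset (Finset.subset_univ _), Finset.card_univ]; omega)
  obtain ⟨U, hU, hUc⟩ := Finset.exists_subset_card_eq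
    (show M * W ≤ (Finset.univ \ poolUnion T L).card by
      rw [Finset.card_sdiff_of_subset (Finset.subset_univ _), Finset.card_univ]; omega)
  have hUL : Disjoint U (poolUnion T L) := Finset.sdiff_disjoint.mono_left hU
  obtain ⟨Ps, hP1, hP2, hP3, hP4⟩ := exists_nucleus_pools L hL1 M W U hUL hUc.ge
  obtain ⟨S, hS, hSc⟩ := Finset.exists_subset_card_eq
    (show τ ≤ (Finset.univ \ (U ∪ poolUnion T L)).card by
      rw [Finset.card_sdiff_of_subset (Finset.subset_univ _), Finset.card_univ,
        Finset.card_union_of_disjoint hUL]; omega)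
  set β := (2 * l + 1 + (2 : ℕ) * s) * Real.exp (-(a * l)) with hβ
  have hσ01 : ∀ m : ℕ, 0 ≤ min 1 (((m : ℝ) / M) ^ s / 2) := fun m => by positivity
  have htr := pr_all_trials_le (T := T) (p := p) hb (L := L) (M := M) (w := w) (β := β)
    -- The cap is inactive for `m ≤ M`; it only provides `σ m ≤ 1` for all `m`.
    (σ := fun m => min 1 (((m : ℝ) / M) ^ s / 2)) (by positivity) hσ01
    (fun m => min_le_left _ _) (fun m h1 h2 => by
      have := hR.nucleus_step hx0 hl0 hs hε0 hc1 (by rw [hxl]; exact f2) hM1 (by linarith) h1 h2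
        hw1
      have h3 := min_le_right (1 : ℝ) (((m : ℝ) / M) ^ s / 2)
      linarith)
    (fun X hX hXc => by
      refine (pr_not_reach_le hb L hL1 X hX).trans ?_
      rw [hXc, hL4, hT]
      exact herr) Ps S hP2 (Finset.sdiff_disjoint.mono hS hP3)
      (fun P hP => by rw [hSc]; exact hP4 P hP) hP1
  rw [hSc] at htr
  set Δ := ∏ i ∈ Finset.range M, min 1 ((((1 + i : ℕ) : ℝ) / M) ^ s / 2) with hΔ
  have hΔ1 : Real.exp (-((s + 1) * M)) ≤ Δ := by
    refine (exp_neg_le_prod_nucleus s M).trans (le_of_eq ?_)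
    refine Finset.prod_congr rfl fun i hi => (min_eq_right ?_).symm
    have h1 : (((1 + i : ℕ) : ℝ) / M) ^ s ≤ 1 := by
      refine pow_le_one₀ (by positivity) ?_
      rw [div_le_one hM0]
      have := Finset.mem_range.1 hi
      exact_mod_cast (by omega : 1 + i ≤ M)
    linarith
  have hΔ2 : Δ ≤ 1 := Finset.prod_le_one (fun i _ => hσ01 _) fun i _ => min_le_left _ _
  have hΔ3 : (g + 1) * l ≤ Δ * τ := by
    have h1 : ((s : ℝ) + 1) * M ≤ l / 4 + (s + 1) := by
      calc ((s : ℝ) + 1) * M ≤ (s + 1) * (ε * l + 1) := by gcongr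
        _ = _ := by rw [hε]; field_simp
    refine mul_le_of_exp_le (s := s) hl0.le ?_ ?_ hτ2
    · exact le_trans (Real.exp_le_exp.2 (by linarith)) hΔ1
    · have : Real.exp (1 / 4 * l) = Real.exp (l / 4) := by congr 1; ring
      rw [this] at f6
      linarith
  have e1 : (1 - Δ) ^ τ ≤ Real.exp (-(g * l)) * Real.exp (-l) := by
    calc (1 - Δ) ^ τ ≤ Real.exp (-Δ) ^ τ := by
          apply pow_le_pow_left₀ (by linarith)
          have := Real.add_one_le_exp (-Δ); linarith
      _ = Real.exp (-(Δ * τ)) := by rw [← Real.exp_nat_mul]; congr 1; ring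
      _ ≤ _ := by
          rw [← Real.exp_add]
          exact Real.exp_le_exp.2 (by linarith)
  have e2 : τ * β ≤ Real.exp (-(g * l)) * Real.exp (-(l / 2)) := by
    calc τ * β ≤ Real.exp (l / 2) * (Real.exp l * Real.exp (-(a * l))) := by
          rw [hβ]
          have : 2 * l + 1 + (2 : ℕ) * s ≤ Real.exp l := by
            refine le_trans ?_ f7
            push_cast
            nlinarith
          gcongr
      _ = _ := by
          rw [← Real.exp_add, ← Real.exp_add, ← Real.exp_add]; congr 1; rw [ha]; ring
  have e3 : Real.exp (-l) ≤ 1 / 2 := by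
    have := Real.add_one_le_exp l
    rw [Real.exp_neg, inv_eq_one_div]
    exact one_div_le_one_div_of_le (by norm_num) (by linarith)
  have e4 : Real.exp (-(l / 2)) ≤ 1 / 2 := by
    have := Real.add_one_le_exp (l / 2)
    rw [Real.exp_neg, inv_eq_one_div]
    exact one_div_le_one_div_of_le (by norm_num) (by linarith)
  calc _ ≤ pr (fun c : Fin s × E => p c.1)
        (fun ω => ∀ a ∈ S, ¬ Reach lab T ω (onePerPool Ps L) {a}) := by
        refine pr_mono fun ω hω a _ hr => hω ⟨a, fun P hPa hP => ?_⟩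
        exact hr.mem_of_closed hP _ _ (by simpa using hPa)
    _ ≤ (1 - Δ) ^ τ + τ * β := htr
    _ ≤ Real.exp (-(g * l)) * Real.exp (-l) + Real.exp (-(g * l)) * Real.exp (-(l / 2)) :=
        add_le_add e1 e2
    _ ≤ Real.exp (-(g * l)) * (1 / 2) + Real.exp (-(g * l)) * (1 / 2) := by gcongr
    _ = _ := by ring

/-! ### Reduction to the link of a `(j-1)`-set -/

section Link

variable {n j k s : ℕ}

/-- The label of a `k`-set containing `I`: its vertices in `A`. -/
def linkLabel (I A : Finset (Fin n)) (e : Set.powersetCard (Fin n) k) :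
    Finset {v // v ∈ A} :=
  if I ⊆ (e : Finset (Fin n)) then Finset.univ.filter fun v => (v : Fin n) ∈ (e : Finset (Fin n))
  else ∅

lemma subset_of_linkLabel_eq {I A : Finset (Fin n)} {e : Set.powersetCard (Fin n) k}
    {u v : {v // v ∈ A}} (h : linkLabel I A e = {u, v}) :
    insert (u : Fin n) I ⊆ (e : Finset (Fin n)) ∧ insert (v : Fin n) I ⊆ (e : Finset (Fin n)) := by
  unfold linkLabel at h
  split_ifs at h with hI
  · have hu : u ∈ ({u, v} : Finset {v // v ∈ A}) := by simp
    have hv : v ∈ ({u, v} : Finset {v // v ∈ A}) := by simp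
    rw [← h, Finset.mem_filter] at hu hv
    exact ⟨Finset.insert_subset hu.2 hI, Finset.insert_subset hv.2 hI⟩
  · exact absurd (h ▸ Finset.mem_insert_self u {v} : u ∈ (∅ : Finset _)) (by simp)

/-- Each choice of `k - j - 1` vertices outside `I ∪ A` completes `I ∪ {u, v}` to a different
`k`-set with this label. -/
lemma choose_le_card_linkLabel (hjk : j < k) {I A : Finset (Fin n)} (hI : I.card + 1 = j)
    (hIA : Disjoint I A) (u v : {v // v ∈ A}) (huv : u ≠ v) :
    ((I ∪ A)ᶜ.card).choose (k - j - 1) ≤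
      Nat.card {e : Set.powersetCard (Fin n) k // linkLabel I A e = {u, v}} := by
  classical
  rw [← Finset.card_powersetCard, Nat.card_eq_fintype_card,
    ← Fintype.card_coe (Finset.powersetCard (k - j - 1) (I ∪ A)ᶜ)]
  have huI : (u : Fin n) ∉ I := fun h => Finset.disjoint_left.1 hIA h u.2
  have hvI : (v : Fin n) ∉ I := fun h => Finset.disjoint_left.1 hIA h v.2
  have huv' : (u : Fin n) ≠ v := fun h => huv (Subtype.ext h)
  have hD : ∀ D ∈ Finset.powersetCard (k - j - 1) (I ∪ A)ᶜ,
      ∀ z ∈ D, z ∉ I ∧ z ∉ A := fun D hD z hz => by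
    have := (Finset.mem_powersetCard.1 hD).1 hz
    simpa using this
  have hcard : ∀ D ∈ Finset.powersetCard (k - j - 1) (I ∪ A)ᶜ,
      (insert (u : Fin n) (insert (v : Fin n) I) ∪ D).card = k := fun D h => by
    rw [Finset.card_union_of_disjoint, Finset.card_insert_of_notMem, Finset.card_insert_of_notMem,
      (Finset.mem_powersetCard.1 h).2]
    · omega
    · exact hvI
    · simp [huI, huv']
    · rw [Finset.disjoint_right]
      intro z hz hz'
      have := hD D h z hz
      rcases Finset.mem_insert.1 hz' with rfl | hz'
      · exact this.2 u.2
      rcases Finset.mem_insert.1 hz' with rfl | hz'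
      · exact this.2 v.2
      · exact this.1 hz'
  refine Fintype.card_le_of_injective (fun D => ⟨⟨insert (u : Fin n) (insert (v : Fin n) I) ∪ D,
    hcard D D.2⟩, ?_⟩) ?_
  · unfold linkLabel
    rw [if_pos]
    · ext z
      have hzI : (z : Fin n) ∉ I := fun h => Finset.disjoint_left.1 hIA h z.2
      have hzD : (z : Fin n) ∉ (D : Finset (Fin n)) := fun h => (hD D D.2 z h).2 z.2
      have e1 : z = u ↔ (z : Fin n) = u := Subtype.ext_iff
      have e2 : z = v ↔ (z : Fin n) = v := Subtype.ext_iff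
      simp only [Finset.mem_filter, Finset.mem_univ, true_and, Finset.mem_union,
        Finset.mem_insert, hzI, hzD, or_false, Finset.mem_singleton, e1, e2]
    · intro z hz
      exact Finset.mem_union_left _ (by simp [hz])
  · intro D D' h
    have h' : insert (u : Fin n) (insert (v : Fin n) I) ∪ (D : Finset (Fin n)) =
        insert (u : Fin n) (insert (v : Fin n) I) ∪ (D' : Finset (Fin n)) := by
      simpa using h
    have key : ∀ D ∈ Finset.powersetCard (k - j - 1) (I ∪ A)ᶜ, (insert (u : Fin n)
        (insert (v : Fin n) I) ∪ D) \ insert (u : Fin n) (insert (v : Fin n) I) = D := by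
      intro D h
      rw [Finset.union_sdiff_left, Finset.sdiff_eq_self_iff_disjoint, Finset.disjoint_left]
      intro z hz hz'
      have := hD D h z hz
      rcases Finset.mem_insert.1 hz' with rfl | hz'
      · exact this.2 u.2
      rcases Finset.mem_insert.1 hz' with rfl | hz'
      · exact this.2 v.2
      · exact this.1 hz'
    exact Subtype.ext (by rw [← key D D.2, h', key D' D'.2])

/-- If a closed partition separates `insert x I` from `insert y I`, then `x` and `y` are not joined
in the link of `I`. -/
lemma not_joined_of_separated (H : MultiKGraph (Fin n) k s) {I A : Finset (Fin n)}
    (hI : I.card + 1 = j) (hIA : Disjoint I A) (x y : {v // v ∈ A})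
    (C : Setoid (Set.powersetCard (Fin n) j)) (hC : H.IsClosedPartition C)
    (J J' : Set.powersetCard (Fin n) j) (hJ : (J : Finset (Fin n)) = insert (x : Fin n) I)
    (hJ' : (J' : Finset (Fin n)) = insert (y : Fin n) I) (hsep : ¬ C J J') :
    ¬ ∃ a, ∀ P : {v // v ∈ A} → Prop, P a →
      (∀ (X : Finset {v // v ∈ A}) (y : {v // v ∈ A}), (∀ x ∈ X, P x) →
        AllAdj (linkLabel I A) (fun c : Fin s × Set.powersetCard (Fin n) k => c.2 ∈ H c.1) X y →
          P y) → ∀ t ∈ ({x, y} : Finset {v // v ∈ A}), P t := by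
  rintro ⟨a, ha⟩
  have hcard : ∀ v : {v // v ∈ A}, (insert (v : Fin n) I).card = j := fun v => by
    rw [Finset.card_insert_of_notMem (fun h => Finset.disjoint_left.1 hIA h v.2), hI]
  let F : {v // v ∈ A} → Set.powersetCard (Fin n) j := fun v => ⟨insert (v : Fin n) I, hcard v⟩
  have := ha (fun v => C (F a) (F v)) (C.refl _) (fun X y hX hadj => by
    refine hC _ _ fun i => ?_
    obtain ⟨x, hx, e, he, hl⟩ := hadj i
    have := subset_of_linkLabel_eq hl
    exact ⟨F x, F y, hX x hx, C.refl _, e, he, this.1, this.2⟩)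
  have h1 : J = F x := Subtype.ext hJ
  have h2 : J' = F y := Subtype.ext hJ'
  apply hsep
  rw [h1, h2]
  exact C.trans (C.symm (this x (by simp))) (this y (by simp))

lemma pow_le_choose_third {m : ℕ} (t : ℕ) (hn : 6 * t ≤ n) (hm : n ≤ 3 * m) :
    1 / (6 ^ t * t.factorial : ℝ) * (n : ℝ) ^ t ≤ m.choose t := by
  have h := Nat.pow_le_choose (α := ℝ) t m
  rw [div_le_iff₀ (by positivity)] at h
  have h2 : (n : ℝ) / 6 ≤ (m + 1 - t : ℕ) := by
    have : n ≤ 6 * (m + 1 - t) := by omega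
    have : (n : ℝ) ≤ 6 * (m + 1 - t : ℕ) := by exact_mod_cast this
    linarith
  have h3 : ((n : ℝ) / 6) ^ t ≤ t.factorial * m.choose t :=
    by
    refine le_trans (pow_le_pow_left₀ (by positivity) h2 t) ?_
    rw [mul_comm]
    exact_mod_cast h
  rw [div_pow] at h3
  rw [div_mul_eq_mul_div, div_le_iff₀ (by positivity)]
  rw [div_le_iff₀ (by positivity)] at h3
  linarith

end Link

/-- The supercritical bound. -/
theorem exists_percolates_bound (j k s : ℕ) (hj : 1 ≤ j) (hjk : j < k) (hs : 2 ≤ s) (hs0 : 0 < s) :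
    ∃ c₀ : ℝ, 0 < c₀ ∧ ∀ c, c₀ ≤ c → ∀ᶠ n : ℕ in atTop, ∀ p : Fin s → unitInterval, Monotone p →
      c * Real.log n / (n : ℝ) ^ (k - j) ≤ (p ⟨0, hs0⟩ : ℝ) →
      (∀ r : ℕ, 2 ≤ r → r ≤ s →
        c / ((n : ℝ) ^ (r * (k - j - 1) + 1) * Real.log n ^ (r - 1)) ≤
          ∏ i ∈ Finset.univ.filter (fun i : Fin s => (i : ℕ) < r), (p i : ℝ)) →
      (randomMultiKGraph n k p).real {H | ¬ H.Percolates j} ≤ 1 / n := by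
  classical
  -- There are at most `n^(j+1)` triples `(I, x, y)`, so the exponent `j + 2` leaves `1 / n` after
  -- the union bound.
  obtain ⟨c₀, hc₀, hcore⟩ := exists_joined_bound s hs (j + 2)
  set t := k - j - 1 with ht
  set κ : ℝ := 1 / (6 ^ t * t.factorial : ℝ) with hκ
  have hκ0 : 0 < κ := by positivity
  have hκ1 : κ ≤ 1 := by
    rw [hκ, div_le_one (by positivity)]
    have h1 : (1 : ℝ) ≤ 6 ^ t := one_le_pow₀ (by norm_num)
    have h2 : (1 : ℝ) ≤ t.factorial := by exact_mod_cast Nat.one_le_iff_ne_zero.2 t.factorial_ne_zero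
    nlinarith
  -- A pair in the link has at least `κ * n ^ t` parallel edges; a product over `r ≤ s` colours
  -- loses `κ ^ r`, which is at least `κ ^ s`.
  refine ⟨c₀ / κ ^ s, by positivity, fun c hc => ?_⟩
  have hc' : c₀ ≤ κ ^ s * c := by
    rw [div_le_iff₀ (by positivity)] at hc
    linarith
  have hc0 : 0 < c := lt_of_lt_of_le (by positivity) hc
  have hlog : Tendsto (fun n : ℕ => Real.log n) atTop atTop :=
    Real.tendsto_log_atTop.comp tendsto_natCast_atTop_atTop
  filter_upwards [hcore _ hc', eventually_ge_atTop (3 * j + 6 * t + 6),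
    hlog.eventually (eventually_gt_atTop 0)] with n hn hnj hl0 p hp h1 h2
  have hn0 : (0 : ℝ) < n := by exact_mod_cast (by omega : 0 < n)
  have hsplit : k - j = t + 1 := by omega
  have hne : Nonempty (Set.powersetCard (Fin n) j) := by
    obtain ⟨J, -, hJ⟩ := Finset.exists_subset_card_eq (s := (Finset.univ : Finset (Fin n)))
      (n := j) (by rw [Finset.card_univ, Fintype.card_fin]; omega)
    exact ⟨⟨J, hJ⟩⟩
  set q : Fin s × Set.powersetCard (Fin n) k → unitInterval := fun c => p c.1 with hq
  let Bad : Finset (Fin n) × Fin n × Fin n → (Fin s × Set.powersetCard (Fin n) k → Prop) → Prop :=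
    fun z ω => ∃ C : Setoid (Set.powersetCard (Fin n) j),
      MultiKGraph.IsClosedPartition (fun i => {e | ω (i, e)}) C ∧
      ∃ J J' : Set.powersetCard (Fin n) j, (J : Finset (Fin n)) = insert z.2.1 z.1 ∧
        (J' : Finset (Fin n)) = insert z.2.2 z.1 ∧ ¬ C J J'
  let Z : Finset (Finset (Fin n) × Fin n × Fin n) :=
    (Finset.powersetCard (j - 1) Finset.univ ×ˢ Finset.univ ×ˢ Finset.univ).filter
      fun z => z.2.1 ∉ z.1 ∧ z.2.2 ∉ z.1 ∧ z.2.1 ≠ z.2.2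
  have hbad : ∀ z ∈ Z, pr q (Bad z) ≤ Real.exp (-((j + 2 : ℕ) * Real.log n)) := by
    rintro ⟨I, x, y⟩ hz
    simp only [Z, Finset.mem_filter, Finset.mem_product, Finset.mem_powersetCard,
      Finset.mem_univ, and_true, Finset.subset_univ, true_and] at hz
    obtain ⟨hI, hx, hy, hxy⟩ := hz
    have hI' : I.card + 1 = j := by omega
    -- Both `A` and the complement of `I ∪ A` need at least `n / 3` vertices: the first hosts the
    -- growth, the second supplies the parallel edges.
    obtain ⟨A, hA1, hA2, hA3⟩ := Finset.exists_subsuperset_card_eq (s := {x, y}) (t := Iᶜ)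
      (n := n / 3 + 1) (by
        intro z hz
        rcases Finset.mem_insert.1 hz with rfl | hz
        · simpa using hx
        · rw [Finset.mem_singleton] at hz; subst hz; simpa using hy)
      (by rw [Finset.card_pair hxy]; omega)
      (by rw [Finset.card_compl, Fintype.card_fin]; omega)
    have hIA : Disjoint I A := (Finset.subset_compl_iff_disjoint_left.1 hA2)
    have hBcard : n ≤ 3 * (I ∪ A)ᶜ.card := by
      rw [Finset.card_compl, Fintype.card_fin, Finset.card_union_of_disjoint hIA, hA3]
      omega
    set b := ((I ∪ A)ᶜ.card).choose t with hb
    have hbn : κ * (n : ℝ) ^ t ≤ b := pow_le_choose_third t (by omega) hBcard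
    have hrate : RateBound (fun i => (p i : ℝ) * b) (κ ^ s * c) n (Real.log n) := by
      refine ⟨fun i => mul_nonneg (p i).2.1 (by positivity), fun i i' h => ?_, fun i => ?_,
        fun r hr hrs => ?_⟩
      · exact mul_le_mul_of_nonneg_right (hp h) (by positivity)
      · have h3 : (p ⟨0, by omega⟩ : ℝ) ≤ p i := hp (Fin.mk_le_of_le_val (Nat.zero_le _))
        calc κ ^ s * c * Real.log n / n ≤ κ * c * Real.log n / n := by
              have : κ ^ s ≤ κ := pow_le_of_le_one hκ0.le hκ1 (by omega)
              gcongr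
          _ = c * Real.log n / (n : ℝ) ^ (k - j) * (κ * (n : ℝ) ^ t) := by
              rw [hsplit, pow_succ]; field_simp
          _ ≤ p i * b := by
              have := h1.trans h3
              gcongr
              exact (p i).2.1
      · have hcard : (Finset.univ.filter (fun i : Fin s => (i : ℕ) < r)).card = r := by
          rw [Fin.card_filter_val_lt]; omega
        rw [Finset.prod_mul_distrib, Finset.prod_const, hcard]
        have h3 := h2 r hr hrs
        calc κ ^ s * c / (n * Real.log n ^ (r - 1)) ≤ κ ^ r * c / (n * Real.log n ^ (r - 1)) := by
              have : κ ^ s ≤ κ ^ r := pow_le_pow_of_le_one hκ0.le hκ1 hrs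
              gcongr
          _ = c / ((n : ℝ) ^ (r * t + 1) * Real.log n ^ (r - 1)) * (κ * (n : ℝ) ^ t) ^ r := by
              rw [mul_pow, ← pow_mul, pow_succ, mul_comm t r]; field_simp
          _ ≤ _ := by
              have h4 : (0 : ℝ) ≤ ∏ i ∈ Finset.univ.filter (fun i : Fin s => (i : ℕ) < r), (p i : ℝ) :=
                Finset.prod_nonneg fun i _ => (p i).2.1
              gcongr
    have hxA : x ∈ A := hA1 (by simp)
    have hyA : y ∈ A := hA1 (by simp)
    have hmain := hn {v // v ∈ A} (Set.powersetCard (Fin n) k) (linkLabel I A) b p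
      (by rw [Fintype.card_coe, hA3]; omega)
      (fun u v huv => choose_le_card_linkLabel hjk hI' hIA u v huv) hrate {⟨x, hxA⟩, ⟨y, hyA⟩}
      (Finset.card_pair (by simpa using hxy))
    refine le_trans (pr_mono fun ω hω => ?_) hmain
    obtain ⟨C, hC, J, J', hJ, hJ', hsep⟩ := hω
    exact not_joined_of_separated (fun i => {e | ω (i, e)}) hI' hIA ⟨x, hxA⟩ ⟨y, hyA⟩ C hC J J'
      hJ hJ' hsep
  rw [randomMultiKGraph_real]
  have hZcard : (Z.card : ℝ) ≤ (n : ℝ) ^ (j + 1) := by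
    have : Z.card ≤ n ^ (j + 1) := by
      refine (Finset.card_filter_le _ _).trans ?_
      rw [Finset.card_product, Finset.card_product, Finset.card_powersetCard, Finset.card_univ,
        Fintype.card_fin]
      calc n.choose (j - 1) * (n * n) ≤ n ^ (j - 1) * (n * n) := by
            gcongr; exact Nat.choose_le_pow _ _
        _ = n ^ (j - 1 + 1 + 1) := by rw [pow_succ, pow_succ]; ring
        _ = _ := by congr 1; omega
    exact_mod_cast this
  calc pr q (fun ω => ¬ MultiKGraph.Percolates (fun i => {e | ω (i, e)}) j)
      ≤ pr q (fun ω => ∃ z ∈ Z, Bad z ω) := pr_mono fun ω hω => by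
        by_contra hcon
        apply hω
        refine MultiKGraph.percolates_of_exchange _ fun I x y hI hx hy hxy C hC J J' hJ hJ' => ?_
        by_contra hsep
        exact hcon ⟨(I, x, y), by simp [Z, hx, hy, hxy]; omega, C, hC, J, J', hJ, hJ', hsep⟩
    _ ≤ ∑ z ∈ Z, pr q (Bad z) := pr_exists_le _ _
    _ ≤ ∑ _z ∈ Z, Real.exp (-((j + 2 : ℕ) * Real.log n)) := Finset.sum_le_sum hbad
    _ = Z.card * Real.exp (-((j + 2 : ℕ) * Real.log n)) := by rw [Finset.sum_const, nsmul_eq_mul]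
    _ ≤ (n : ℝ) ^ (j + 1) * Real.exp (-((j + 2 : ℕ) * Real.log n)) := by gcongr
    _ = 1 / n := by
        rw [Real.exp_neg, Real.exp_nat_mul, Real.exp_log hn0, pow_succ (n : ℝ) (j + 1)]
        field_simp

/-! ### A weighted count of explorations -/

section ExplorationSum

variable {α E : Type*} [DecidableEq E]

/-- Every nonempty part of `F` has an element that touches `Q` or the rest of `F`: the set `F` can
be explored from `Q`. -/
def Explored (inc : α → E → Prop) (Q : Finset α) (F : Finset E) : Prop :=
  ∀ F' ⊆ F, F'.Nonempty → ∃ e ∈ F', (∃ J ∈ Q, inc J e) ∨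
    ∃ e' ∈ F, e' ∉ F' ∧ ∃ J, inc J e ∧ inc J e'

omit [DecidableEq E] in
lemma Explored.empty (inc : α → E → Prop) (Q : Finset α) : Explored inc Q ∅ := by
  intro F' hF' hne
  simp [Finset.subset_empty.1 hF'] at hne

lemma Explored.insert {inc : α → E → Prop} {Q : Finset α} {F : Finset E} (hF : Explored inc Q F)
    {e : E} (heF : e ∉ F) (he : (∃ J ∈ Q, inc J e) ∨ ∃ e' ∈ F, ∃ J, inc J e ∧ inc J e') :
    Explored inc Q (insert e F) := by
  intro F' hF' hne
  by_cases h : e ∈ F'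
  · rcases he with he | ⟨e', he', hJ⟩
    · exact ⟨e, h, Or.inl he⟩
    · by_cases h' : e' ∈ F'
      · obtain ⟨a, ha, ha'⟩ := hF (F'.erase e) (by
          intro z hz
          rw [Finset.mem_erase] at hz
          exact (Finset.mem_insert.1 (hF' hz.2)).resolve_left hz.1)
          ⟨e', Finset.mem_erase.2 ⟨fun h => heF (h ▸ he'), h'⟩⟩
        refine ⟨a, Finset.mem_of_mem_erase ha, ha'.imp_right ?_⟩
        rintro ⟨b, hb, hb', hJ⟩
        refine ⟨b, by simp [hb], fun h => hb' (Finset.mem_erase.2 ⟨?_, h⟩), hJ⟩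
        rintro rfl
        exact heF hb
      · exact ⟨e, h, Or.inr ⟨e', by simp [he'], h', hJ⟩⟩
  · obtain ⟨a, ha, ha'⟩ := hF F' (by
      intro z hz
      exact (Finset.mem_insert.1 (hF' hz)).resolve_left (by rintro rfl; exact h hz)) hne
    refine ⟨a, ha, ha'.imp_right ?_⟩
    rintro ⟨b, hb, hb', hJ⟩
    exact ⟨b, by simp [hb], hb', hJ⟩

open Classical in
/-- The total weight of the sets that can be explored from `Q`. -/
lemma sum_explored_le [Fintype α] (inc : α → E → Prop) (w : E → ℝ) (hw : ∀ e, 0 ≤ w e) {δ : ℝ}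
    {N : ℕ} (hN : ∀ e, (Finset.univ.filter fun J => inc J e).card ≤ N)
    (hNδ : Real.exp (2 * (N * δ)) ≤ 2) (A : Finset E)
    (hδ : ∀ J, ∑ e ∈ A.filter (fun e => inc J e), w e ≤ δ) (Q : Finset α) :
    ∑ F ∈ A.powerset, (if Explored inc Q F then ∏ e ∈ F, w e else 0) ≤
      Real.exp (2 * ∑ J ∈ Q, ∑ e ∈ A.filter (fun e => inc J e), w e) := by
  induction hA : A.card using Nat.strong_induction_on generalizing A Q with
  | _ m ih =>
    -- Decide whether an element `e` touching `Q` belongs to `F`. If not, only `A` shrinks. If so,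
    -- the weight `w e` is paid and `Q` gains at most `N` points, which costs a factor `exp (2 * (N
    -- * δ)) ≤ 2`. Then `1 + 2 * w e ≤ exp (2 * w e)` closes the induction.
    by_cases h : ∃ e ∈ A, ∃ J ∈ Q, inc J e
    · obtain ⟨e, he, J₀, hJ₀, hinc⟩ := h
      have hcard : (A.erase e).card < m := by rw [← hA]; exact Finset.card_erase_lt_of_mem he
      have hmono : ∀ J, ∑ e ∈ (A.erase e).filter (fun e => inc J e), w e ≤
          ∑ e ∈ A.filter (fun e => inc J e), w e := fun J =>
        Finset.sum_le_sum_of_subset_of_nonneg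
          (Finset.filter_subset_filter _ (Finset.erase_subset _ _)) (fun _ _ _ => hw _)
      have hδ' : ∀ J, ∑ e ∈ (A.erase e).filter (fun e => inc J e), w e ≤ δ :=
        fun J => (hmono J).trans (hδ J)
      have hJ₀' : ∑ f ∈ (A.erase e).filter (fun e => inc J₀ e), w f + w e =
          ∑ e ∈ A.filter (fun e => inc J₀ e), w e := by
        rw [Finset.filter_erase, Finset.sum_erase_add _ _ (Finset.mem_filter.2 ⟨he, hinc⟩)]
      set S := ∑ J ∈ Q, ∑ e ∈ (A.erase e).filter (fun e => inc J e), w e with hS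
      have hSA : S + w e ≤ ∑ J ∈ Q, ∑ e ∈ A.filter (fun e => inc J e), w e := by
        rw [hS, ← Finset.add_sum_erase Q _ hJ₀, ← Finset.add_sum_erase Q _ hJ₀, ← hJ₀']
        have := Finset.sum_le_sum (s := Q.erase J₀) (fun J _ => hmono J)
        linarith
      have h1 := ih _ hcard (A.erase e) hδ' Q rfl
      have h2 := ih _ hcard (A.erase e) hδ' (Q ∪ Finset.univ.filter fun J => inc J e) rfl
      have h3 : ∑ J ∈ Q ∪ Finset.univ.filter (fun J => inc J e),
          ∑ e ∈ (A.erase e).filter (fun e => inc J e), w e ≤ S + N * δ := by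
        have hnn : ∀ J, 0 ≤ ∑ e ∈ (A.erase e).filter (fun e => inc J e), w e :=
          fun J => Finset.sum_nonneg fun _ _ => hw _
        have hδ0 : 0 ≤ δ := (hnn J₀).trans (hδ' J₀)
        have hui := Finset.sum_union_inter (s₁ := Q) (s₂ := Finset.univ.filter fun J => inc J e)
          (f := fun J => ∑ e ∈ (A.erase e).filter (fun e => inc J e), w e)
        have hi : 0 ≤ ∑ J ∈ Q ∩ Finset.univ.filter (fun J => inc J e),
            ∑ e ∈ (A.erase e).filter (fun e => inc J e), w e :=
          Finset.sum_nonneg fun J _ => hnn J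
        have hle : ∑ J ∈ Finset.univ.filter (fun J => inc J e),
            ∑ e ∈ (A.erase e).filter (fun e => inc J e), w e ≤ N * δ := by
          calc _ ≤ ∑ J ∈ Finset.univ.filter (fun J => inc J e), δ :=
                Finset.sum_le_sum fun J _ => hδ' J
            _ = (Finset.univ.filter fun J => inc J e).card * δ := by
                rw [Finset.sum_const, nsmul_eq_mul]
            _ ≤ N * δ := by
                have := hN e
                gcongr
        linarith
      have h4 : ∑ F ∈ (A.erase e).powerset,
          (if Explored inc Q (insert e F) then ∏ f ∈ insert e F, w f else 0) ≤
          w e * ∑ F ∈ (A.erase e).powerset,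
            (if Explored inc (Q ∪ Finset.univ.filter fun J => inc J e) F then
              ∏ f ∈ F, w f else 0) := by
        rw [Finset.mul_sum]
        refine Finset.sum_le_sum fun F hF => ?_
        have heF : e ∉ F := fun h => by simpa using Finset.mem_powerset.1 hF h
        split_ifs with h5 h6 h6
        · rw [Finset.prod_insert heF]
        · exfalso
          apply h6
          intro F' hF' hne
          obtain ⟨a, ha, ha'⟩ := h5 F' (hF'.trans (Finset.subset_insert _ _)) hne
          refine ⟨a, ha, ?_⟩
          rcases ha' with ⟨J, hJ, hJ'⟩ | ⟨b, hb, hb', J, hJ, hJ'⟩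
          · exact Or.inl ⟨J, by simp [hJ], hJ'⟩
          · rcases Finset.mem_insert.1 hb with rfl | hb
            · exact Or.inl ⟨J, by simp [hJ'], hJ⟩
            · exact Or.inr ⟨b, hb, hb', J, hJ, hJ'⟩
        · have := Finset.prod_nonneg (s := F) (fun f _ => hw f)
          have := hw e
          positivity
        · simp
      conv_lhs => rw [← Finset.insert_erase he]
      rw [Finset.sum_powerset_insert (by simp)]
      have h5 : Real.exp (2 * (S + N * δ)) ≤ Real.exp (2 * S) * 2 := by
        rw [mul_add, Real.exp_add]
        gcongr
      have h6 := h2.trans (Real.exp_le_exp.2 (mul_le_mul_of_nonneg_left h3 zero_le_two))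
      calc _ ≤ Real.exp (2 * S) + w e * (Real.exp (2 * S) * 2) :=
            add_le_add h1 (h4.trans (mul_le_mul_of_nonneg_left (h6.trans h5) (hw e)))
        _ = Real.exp (2 * S) * (2 * w e + 1) := by ring
        _ ≤ Real.exp (2 * S) * Real.exp (2 * w e) := by
            gcongr; exact Real.add_one_le_exp _
        _ = Real.exp (2 * (S + w e)) := by rw [← Real.exp_add]; congr 1; ring
        _ ≤ _ := by gcongr
    -- Nothing touches `Q`, so only the empty set can be explored.
    · push Not at h
      have hle : ∑ F ∈ A.powerset, (if Explored inc Q F then ∏ e ∈ F, w e else 0) = 1 := by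
        rw [Finset.sum_eq_single ∅]
        · rw [if_pos (Explored.empty inc Q), Finset.prod_empty]
        · intro F hF hne
          rw [if_neg]
          intro hE
          obtain ⟨e, he, ⟨J, hJ, hJ'⟩ | ⟨e', he', he'', -⟩⟩ :=
            hE F subset_rfl (Finset.nonempty_iff_ne_empty.2 hne)
          · exact h e (Finset.mem_powerset.1 hF he) J hJ hJ'
          · exact he'' he'
        · simp
      rw [hle]
      refine Real.one_le_exp ?_
      have : 0 ≤ ∑ J ∈ Q, ∑ e ∈ A.filter (fun e => inc J e), w e :=
        Finset.sum_nonneg fun J _ => Finset.sum_nonneg fun e _ => hw e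
      linarith

end ExplorationSum

/-! ### Explorations as witnesses of connectedness, and their probability -/

section Witness

variable {V : Type*} [Fintype V] [DecidableEq V] {j k s : ℕ}

/-- Exploration inside `U`: the `j`-set `J ⊆ U` lies in the edge `e`. -/
def incIn (U : Finset V) (J : Set.powersetCard V j) (e : Set.powersetCard V k) : Prop :=
  (J : Finset V) ⊆ U ∧ (J : Finset V) ⊆ (e : Finset V)

/-- `F` explores all of `U` from `J₀`. -/
structure Explores (U : Finset V) (J₀ : Set.powersetCard V j)
    (F : Finset (Set.powersetCard V k)) : Prop where
  explored : Explored (incIn U) {J₀} F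
  large : ∀ e ∈ F, j + 1 ≤ ((e : Finset V) ∩ U).card
  gain : U.card - j ≤ ∑ e ∈ F, (((e : Finset V) ∩ U).card - j)

/-- Take a largest `F` for which the vertices seen number at most `j` plus the sum of the gains. If
some member of `A` is not reached, cut-connectedness gives an edge `e` containing a reached `J` and
an unreached `J'`. It has at least `j + 1` vertices in `U`, and since `J` was already seen it adds
at most `|e ∩ U| - j` new ones, so `F` could be enlarged. -/
lemma MultiKGraph.CutConnected.exists_explores {H : MultiKGraph V k s} {i : Fin s}
    {A : Finset (Set.powersetCard V j)} (hA : H.CutConnected i A) {J₀ : Set.powersetCard V j}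
    (hJ₀ : J₀ ∈ A) :
    ∃ F : Finset (Set.powersetCard V k), (∀ e ∈ F, e ∈ H i) ∧
      Explores (MultiKGraph.cover A) J₀ F := by
  classical
  set U := MultiKGraph.cover A with hU
  have hAU : ∀ J ∈ A, (J : Finset V) ⊆ U := fun J hJ =>
    Finset.subset_biUnion_of_mem (fun J : Set.powersetCard V j => (J : Finset V)) hJ
  let old : Finset (Set.powersetCard V k) → Finset V := fun F =>
    (J₀ : Finset V) ∪ F.biUnion fun e => (e : Finset V) ∩ U
  let S : Finset (Finset (Set.powersetCard V k)) := Finset.univ.filter fun F =>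
    (∀ e ∈ F, e ∈ H i) ∧ Explored (incIn U) {J₀} F ∧
      (∀ e ∈ F, j + 1 ≤ ((e : Finset V) ∩ U).card) ∧
      (old F).card ≤ j + ∑ e ∈ F, (((e : Finset V) ∩ U).card - j)
  have hS : S.Nonempty := ⟨∅, Finset.mem_filter.2 ⟨Finset.mem_univ _, by simp,
    Explored.empty _ _, by simp, by simp [old, Set.powersetCard.card_eq]⟩⟩
  obtain ⟨F, hF, hmax⟩ := S.exists_max_image Finset.card hS
  obtain ⟨-, hF1, hF2, hF3, hF4⟩ := Finset.mem_filter.1 hF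
  refine ⟨F, hF1, hF2, hF3, ?_⟩
  set D := A.filter fun J => J = J₀ ∨ ∃ e ∈ F, (J : Finset V) ⊆ (e : Finset V) with hD
  have hDold : ∀ J ∈ D, (J : Finset V) ⊆ old F := by
    intro J hJ
    obtain ⟨hJA, rfl | ⟨e, he, hJe⟩⟩ := Finset.mem_filter.1 hJ
    · exact Finset.subset_union_left
    · refine Finset.Subset.trans (Finset.subset_inter hJe (hAU J hJA)) ?_
      exact (Finset.subset_biUnion_of_mem (fun e : Set.powersetCard V k => (e : Finset V) ∩ U)
        he).trans Finset.subset_union_right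
  by_cases hDA : D = A
  · have : U ⊆ old F := by
      rw [hU]
      refine Finset.biUnion_subset.2 fun J hJ => hDold J (by rwa [hDA])
    have := Finset.card_le_card this
    omega
  · exfalso
    obtain ⟨J, hJ, J', hJ', hJD', e, he, hJe, hJe'⟩ := hA D (Finset.filter_subset _ _)
      ⟨J₀, Finset.mem_filter.2 ⟨hJ₀, Or.inl rfl⟩⟩ hDA
    have hJA := (Finset.mem_filter.1 hJ).1
    have heF : e ∉ F := fun h => hJD' (Finset.mem_filter.2 ⟨hJ', Or.inr ⟨e, h, hJe'⟩⟩)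
    have hne : J' ≠ J := by rintro rfl; exact hJD' hJ
    obtain ⟨x, hx, hx'⟩ := (Set.powersetCard.exists_mem_notMem_iff_ne J' J).1 hne
    have hlarge : j + 1 ≤ ((e : Finset V) ∩ U).card := by
      have hx1 : x ∈ (J' : Finset V) := hx
      have hx2 : x ∉ (J : Finset V) := hx'
      have h1 : (insert x (J : Finset V)).card = j + 1 := by
        rw [Finset.card_insert_of_notMem hx2, Set.powersetCard.card_eq]
      rw [← h1]
      exact Finset.card_le_card (Finset.insert_subset
        (Finset.mem_inter.2 ⟨hJe' hx1, hAU J' hJ' hx1⟩) (Finset.subset_inter hJe (hAU J hJA)))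
    have hnew : insert e F ∈ S := by
      refine Finset.mem_filter.2 ⟨Finset.mem_univ _, ?_, hF2.insert heF ?_, ?_, ?_⟩
      · intro f hf
        rcases Finset.mem_insert.1 hf with rfl | hf
        · exact he
        · exact hF1 f hf
      · obtain ⟨-, rfl | ⟨e', he', hJe''⟩⟩ := Finset.mem_filter.1 hJ
        · exact Or.inl ⟨J, by simp, hAU J hJA, hJe⟩
        · exact Or.inr ⟨e', he', J, ⟨hAU J hJA, hJe⟩, hAU J hJA, hJe''⟩
      · intro f hf
        rcases Finset.mem_insert.1 hf with rfl | hf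
        · exact hlarge
        · exact hF3 f hf
      · have h1 : old (insert e F) = ((e : Finset V) ∩ U) ∪ old F := by
          simp only [old, Finset.biUnion_insert]
          rw [Finset.union_left_comm]
        have h2 : (J : Finset V) ⊆ ((e : Finset V) ∩ U) ∩ old F :=
          Finset.subset_inter (Finset.subset_inter hJe (hAU J hJA)) (hDold J hJ)
        have h3 := Finset.card_le_card h2
        rw [Set.powersetCard.card_eq] at h3
        have h4 := Finset.card_union_add_card_inter ((e : Finset V) ∩ U) (old F)
        rw [h1, Finset.sum_insert heF]
        omega
    have := hmax _ hnew
    rw [Finset.card_insert_of_notMem heF] at this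
    omega

end Witness

section WitnessProbability

variable {n j k s : ℕ}

/-- Such an edge is determined by its `g` vertices in `U` outside `J` and its `k - j - g` vertices
outside `U`. -/
lemma card_filter_inter_card_le {U : Finset (Fin n)} {J : Set.powersetCard (Fin n) j}
    (hJ : (J : Finset (Fin n)) ⊆ U) (g : ℕ) :
    (Finset.univ.filter fun e : Set.powersetCard (Fin n) k =>
      (J : Finset (Fin n)) ⊆ (e : Finset (Fin n)) ∧
        ((e : Finset (Fin n)) ∩ U).card = j + g).card ≤ U.card ^ g * n ^ (k - j - g) := by
  calc _ ≤ ((Finset.powersetCard g U) ×ˢ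
        (Finset.powersetCard (k - j - g) (Finset.univ : Finset (Fin n)))).card := by
        refine Finset.card_le_card_of_injOn
          (fun e => (((e : Finset (Fin n)) ∩ U) \ J, (e : Finset (Fin n)) \ U)) ?_ ?_
        · intro e he
          obtain ⟨-, h1, h2⟩ := Finset.mem_filter.1 he
          refine Finset.mem_product.2 ⟨Finset.mem_powersetCard.2 ⟨?_, ?_⟩,
            Finset.mem_powersetCard.2 ⟨Finset.subset_univ _, ?_⟩⟩
          · exact Finset.sdiff_subset.trans Finset.inter_subset_right
          · dsimp only
            rw [Finset.card_sdiff_of_subset (Finset.subset_inter h1 hJ), h2,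
              Set.powersetCard.card_eq]
            omega
          · have := Finset.card_sdiff_add_card_inter (e : Finset (Fin n)) U
            rw [Set.powersetCard.card_eq, h2] at this
            dsimp only
            omega
        · intro e he e' he' h
          obtain ⟨-, h1, -⟩ := Finset.mem_filter.1 he
          obtain ⟨-, h1', -⟩ := Finset.mem_filter.1 he'
          obtain ⟨h2, h3⟩ := Prod.ext_iff.1 h
          dsimp only at h2 h3
          have h4 : (e : Finset (Fin n)) ∩ U = (e' : Finset (Fin n)) ∩ U := by
            rw [← Finset.sdiff_union_of_subset (Finset.subset_inter h1 hJ), h2,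
              Finset.sdiff_union_of_subset (Finset.subset_inter h1' hJ)]
          refine Subtype.ext ?_
          rw [← Finset.sdiff_union_inter e.1 U, ← Finset.sdiff_union_inter e'.1 U]
          exact congrArg₂ _ h3 h4
    _ ≤ _ := by
        rw [Finset.card_product, Finset.card_powersetCard, Finset.card_powersetCard,
          Finset.card_univ, Fintype.card_fin]
        exact Nat.mul_le_mul (Nat.choose_le_pow _ _) (Nat.choose_le_pow _ _)

open Classical in
lemma card_filter_incIn_le (U : Finset (Fin n)) (e : Set.powersetCard (Fin n) k) :
    (Finset.univ.filter fun J : Set.powersetCard (Fin n) j => incIn U J e).card ≤ 2 ^ k := by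
  calc _ ≤ (e : Finset (Fin n)).powerset.card := by
        refine Finset.card_le_card_of_injOn (fun J => (J : Finset (Fin n))) ?_ ?_
        · intro J hJ
          exact Finset.mem_powerset.2 (Finset.mem_filter.1 hJ).2.2
        · intro J _ J' _ h
          exact Subtype.ext h
    _ = 2 ^ k := by rw [Finset.card_powerset, Set.powersetCard.card_eq]

-- The edges of gain `g` contribute at most `P / (K * P) ^ g ≤ 1 / K`, where `g ≥ 1` and `P ≥ 1`
-- enter, and there are at most `k` possible gains.
open Classical in
lemma sum_weight_le {U : Finset (Fin n)} {p P K : ℝ} (hp : 0 ≤ p) (hjk : j < k)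
    (hn : 0 < n) (hU : 0 < U.card) (hP : P = p * (n : ℝ) ^ (k - j)) (hP1 : 1 ≤ P)
    (hK1 : 1 ≤ K) (J : Set.powersetCard (Fin n) j) :
    ∑ e ∈ (Finset.univ.filter fun e : Set.powersetCard (Fin n) k =>
        j + 1 ≤ ((e : Finset (Fin n)) ∩ U).card).filter (fun e => incIn U J e),
      p * (n / (U.card * K * P)) ^ (((e : Finset (Fin n)) ∩ U).card - j) ≤ k / K := by
  have hn' : (0 : ℝ) < n := by exact_mod_cast hn
  have hU' : (0 : ℝ) < U.card := by exact_mod_cast hU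
  by_cases hJU : (J : Finset (Fin n)) ⊆ U
  · set S := (Finset.univ.filter fun e : Set.powersetCard (Fin n) k =>
        j + 1 ≤ ((e : Finset (Fin n)) ∩ U).card).filter (fun e => incIn U J e) with hS
    have hmaps : ∀ e ∈ S, ((e : Finset (Fin n)) ∩ U).card - j ∈ Finset.Icc 1 (k - j) := by
      intro e he
      have h1 := (Finset.mem_filter.1 (Finset.mem_filter.1 he).1).2
      have h2 := Finset.card_le_card (Finset.inter_subset_left (s₁ := (e : Finset (Fin n)))
        (s₂ := U))
      rw [Set.powersetCard.card_eq] at h2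
      exact Finset.mem_Icc.2 ⟨by omega, by omega⟩
    rw [← Finset.sum_fiberwise_of_maps_to hmaps]
    calc _ ≤ ∑ _g ∈ Finset.Icc 1 (k - j), 1 / K := by
          refine Finset.sum_le_sum fun g hg => ?_
          obtain ⟨hg1, hg2⟩ := Finset.mem_Icc.1 hg
          have hcard : (S.filter fun e : Set.powersetCard (Fin n) k =>
              ((e : Finset (Fin n)) ∩ U).card - j = g).card ≤
              U.card ^ g * n ^ (k - j - g) := by
            refine le_trans (Finset.card_le_card ?_) (card_filter_inter_card_le (k := k) hJU g)
            intro e he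
            obtain ⟨he, h1⟩ := Finset.mem_filter.1 he
            have h2 := Finset.mem_filter.1 he
            have h3 := (Finset.mem_filter.1 h2.1).2
            exact Finset.mem_filter.2 ⟨Finset.mem_univ _, h2.2.2, by omega⟩
          have hcard' : ((S.filter fun e : Set.powersetCard (Fin n) k =>
              ((e : Finset (Fin n)) ∩ U).card - j = g).card : ℝ) ≤
              (U.card : ℝ) ^ g * (n : ℝ) ^ (k - j - g) := by exact_mod_cast hcard
          have hpow : (n : ℝ) ^ (k - j) = (n : ℝ) ^ (k - j - g) * (n : ℝ) ^ g := by
            rw [← pow_add]; congr 1; omega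
          rw [Finset.sum_congr rfl (g := fun _ => p * (n / (U.card * K * P)) ^ g) (by
            intro e he; rw [(Finset.mem_filter.1 he).2]), Finset.sum_const, nsmul_eq_mul]
          calc _ ≤ (U.card : ℝ) ^ g * (n : ℝ) ^ (k - j - g) *
                (p * (n / (U.card * K * P)) ^ g) := by gcongr
            _ = P / (K * P) ^ g := by
                rw [div_pow, mul_pow, mul_pow, mul_pow]
                field_simp
                rw [hP, hpow]
                ring
            _ ≤ P / (K * P) := by
                have h1 : 1 ≤ K * P := one_le_mul_of_one_le_of_one_le hK1 hP1
                have := le_self_pow₀ h1 (show g ≠ 0 by omega)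
                gcongr
            _ = 1 / K := by field_simp
      _ = ((k - j : ℕ) : ℝ) * (1 / K) := by simp
      _ ≤ k * (1 / K) := by
          have : ((k - j : ℕ) : ℝ) ≤ k := by exact_mod_cast Nat.sub_le _ _
          gcongr
      _ = k / K := by ring
  · rw [Finset.sum_eq_zero]
    · positivity
    · intro e he
      exact absurd (Finset.mem_filter.1 he).2.1 hJU

/-- The probability that one colour explores `U` from `J₀`. -/
lemma pr_exists_explores_le (p : Fin s → unitInterval) (i : Fin s) {U : Finset (Fin n)}
    {P K : ℝ} (hj : 1 ≤ j) (hjk : j < k) (hn : 0 < n) (hP : P = p i * (n : ℝ) ^ (k - j))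
    (hP1 : 1 ≤ P) (hK : K = 4 * 2 ^ k * k) (hU : U.card * K * P ≤ n) (hU0 : 0 < U.card)
    (J₀ : Set.powersetCard (Fin n) j) :
    pr (fun c : Fin s × Set.powersetCard (Fin n) k => p c.1)
      (fun ω => ∃ F, (∀ e ∈ F, ω (i, e)) ∧ Explores U J₀ F) ≤
        2 * (U.card * K * P / n) ^ (U.card - j) := by
  classical
  have hn' : (0 : ℝ) < n := by exact_mod_cast hn
  have hU' : (0 : ℝ) < U.card := by exact_mod_cast hU0
  have hk : (1 : ℝ) ≤ k := by exact_mod_cast (by omega : 1 ≤ k)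
  have h2k : (1 : ℝ) ≤ 2 ^ k := one_le_pow₀ (by norm_num)
  have hK1 : 1 ≤ K := by
    rw [hK]
    have := one_le_mul_of_one_le_of_one_le h2k hk
    linarith
  have hp0 : (0 : ℝ) ≤ p i := (p i).2.1
  -- An exponential Markov inequality: every unit of gain is weighted by `lam ≥ 1`, and since the
  -- total gain is at least `U.card - j`, each exploration is overcounted by `lam ^ (U.card - j)` or
  -- more.
  set lam : ℝ := n / (U.card * K * P) with hlam
  have hden : 0 < U.card * K * P := by positivity
  have hlam1 : 1 ≤ lam := by rw [hlam, le_div_iff₀ hden]; linarith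
  set A : Finset (Set.powersetCard (Fin n) k) := Finset.univ.filter fun e =>
    j + 1 ≤ ((e : Finset (Fin n)) ∩ U).card with hA
  let w : Set.powersetCard (Fin n) k → ℝ := fun e =>
    p i * lam ^ (((e : Finset (Fin n)) ∩ U).card - j)
  have hw : ∀ e, 0 ≤ w e := fun e => by positivity
  have hδ : ∀ J : Set.powersetCard (Fin n) j,
      ∑ e ∈ A.filter (fun e => incIn U J e), w e ≤ k / K :=
    fun J => sum_weight_le hp0 hjk hn hU0 hP hP1 hK1 J
  -- `K` is chosen such that `2 * (N * δ) = 1 / 2` for `N = 2 ^ k` and `δ = k / K`.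
  have hkK : k / K = 1 / (4 * 2 ^ k) := by rw [hK]; field_simp
  have hexp : Real.exp (1 / 2) ≤ 2 := by
    have h1 : Real.exp (1 / 2) * Real.exp (1 / 2) = Real.exp 1 := by
      rw [← Real.exp_add]; norm_num
    have h2 := Real.exp_one_lt_d9
    have h3 := Real.exp_pos (1 / 2)
    nlinarith
  have hsum := sum_explored_le (fun (J : Set.powersetCard (Fin n) j) e => incIn U J e) w hw
    (N := 2 ^ k) (fun e => card_filter_incIn_le U e) (by
      rw [hkK]
      refine le_trans (le_of_eq ?_) hexp
      congr 1
      push_cast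
      field_simp
      norm_num) A hδ {J₀}
  have hsum2 : ∑ F ∈ A.powerset, (if Explored (fun (J : Set.powersetCard (Fin n) j) e =>
      incIn U J e) {J₀} F then ∏ e ∈ F, w e else 0) ≤ 2 := by
    refine hsum.trans (le_trans (Real.exp_le_exp.2 ?_) hexp)
    rw [Finset.sum_singleton]
    have h1 := hδ J₀
    have h2 : k / K ≤ 1 / 4 := by
      rw [hkK]; apply one_div_le_one_div_of_le (by norm_num); linarith
    linarith
  have hpF : ∀ F : Finset (Set.powersetCard (Fin n) k),
      pr (fun c : Fin s × Set.powersetCard (Fin n) k => p c.1) (fun ω => ∀ e ∈ F, ω (i, e)) =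
        (p i : ℝ) ^ F.card := by
    intro F
    have := pr_forall_mem (q := fun c : Fin s × Set.powersetCard (Fin n) k => p c.1)
      (F.image fun e => (i, e))
    rw [Finset.prod_image (fun a _ b _ h => (Prod.ext_iff.1 h).2)] at this
    simp only [Finset.forall_mem_image, Finset.prod_const] at this
    exact this
  calc _ ≤ pr (fun c : Fin s × Set.powersetCard (Fin n) k => p c.1)
        (fun ω => ∃ F ∈ A.powerset.filter (fun F => Explores U J₀ F), ∀ e ∈ F, ω (i, e)) := by
        refine pr_mono fun ω hω => ?_
        obtain ⟨F, h1, h2⟩ := hω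
        refine ⟨F, Finset.mem_filter.2 ⟨Finset.mem_powerset.2 fun e he => ?_, h2⟩, h1⟩
        exact Finset.mem_filter.2 ⟨Finset.mem_univ _, h2.large e he⟩
    _ ≤ ∑ F ∈ A.powerset.filter (fun F => Explores U J₀ F), (p i : ℝ) ^ F.card := by
        refine (pr_exists_le _ _).trans (Finset.sum_le_sum fun F _ => (hpF F).le)
    _ = ∑ F ∈ A.powerset, if Explores U J₀ F then (p i : ℝ) ^ F.card else 0 :=
        Finset.sum_filter _ _
    _ ≤ ∑ F ∈ A.powerset, (lam ^ (U.card - j))⁻¹ *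
          (if Explored (fun (J : Set.powersetCard (Fin n) j) e =>
            incIn U J e) {J₀} F then ∏ e ∈ F, w e else 0) := by
        refine Finset.sum_le_sum fun F _ => ?_
        split_ifs with h1 h2 h2
        · have h3 : ∏ e ∈ F, w e = (p i : ℝ) ^ F.card *
              lam ^ (∑ e ∈ F, (((e : Finset (Fin n)) ∩ U).card - j)) := by
            rw [Finset.prod_mul_distrib, Finset.prod_const, Finset.prod_pow_eq_pow_sum]
          rw [h3, inv_mul_eq_div, le_div_iff₀ (by positivity)]
          have := pow_le_pow_right₀ hlam1 h1.gain
          gcongr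
        · exact absurd h1.explored h2
        · have := Finset.prod_nonneg (s := F) (fun e _ => hw e)
          positivity
        · simp
    _ = (lam ^ (U.card - j))⁻¹ * ∑ F ∈ A.powerset,
          (if Explored (fun (J : Set.powersetCard (Fin n) j) e =>
            incIn U J e) {J₀} F then ∏ e ∈ F, w e else 0) := by rw [Finset.mul_sum]
    _ ≤ (lam ^ (U.card - j))⁻¹ * 2 := by gcongr
    _ = _ := by rw [hlam, ← inv_pow, inv_div, mul_comm]

/-- Colours are independent, and only the first `r` of them are retained. -/
lemma pr_all_explore_le (p : Fin s → unitInterval) {U : Finset (Fin n)}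
    {K : ℝ} (hj : 1 ≤ j) (hjk : j < k) (hn : 0 < n) (r : ℕ) (hrs : r ≤ s)
    (hP1 : ∀ i : Fin s, (i : ℕ) < r → 1 ≤ p i * (n : ℝ) ^ (k - j)) (hK : K = 4 * 2 ^ k * k)
    (hU : ∀ i : Fin s, (i : ℕ) < r → U.card * K * (p i * (n : ℝ) ^ (k - j)) ≤ n)
    (hU0 : 0 < U.card) (J₀ : Set.powersetCard (Fin n) j) :
    pr (fun c : Fin s × Set.powersetCard (Fin n) k => p c.1)
      (fun ω => ∀ i : Fin s, ∃ F, (∀ e ∈ F, ω (i, e)) ∧ Explores U J₀ F) ≤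
        2 ^ r * ((U.card * K / n) ^ r * ((n : ℝ) ^ (k - j)) ^ r *
          ∏ i ∈ Finset.univ.filter (fun i : Fin s => (i : ℕ) < r), (p i : ℝ)) ^ (U.card - j) := by
  classical
  have hcard : (Finset.univ.filter (fun i : Fin s => (i : ℕ) < r)).card = r := by
    rw [Fin.card_filter_val_lt]; omega
  have hind := pr_forall_of_disjoint
    (q := fun c : Fin s × Set.powersetCard (Fin n) k => p c.1)
    (Finset.univ.filter (fun i : Fin s => (i : ℕ) < r))
    (fun i ω => ∃ F, (∀ e ∈ F, ω (i, e)) ∧ Explores U J₀ F) (fun i => {c | c.1 = i})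
    (fun i _ => by
      intro ω ω' h
      have : ∀ e, ω (i, e) = ω' (i, e) := fun e => h (i, e) rfl
      simp only [this])
    (fun i _ i' _ hne => Set.disjoint_left.2 fun c h1 h2 => hne (h1.symm.trans h2))
  refine (pr_mono (B := fun ω => ∀ i ∈ Finset.univ.filter (fun i : Fin s => (i : ℕ) < r),
    ∃ F, (∀ e ∈ F, ω (i, e)) ∧ Explores U J₀ F) fun ω hω i _ => hω i).trans ?_
  rw [hind]
  calc _ ≤ ∏ i ∈ Finset.univ.filter (fun i : Fin s => (i : ℕ) < r),
        2 * (U.card * K * (p i * (n : ℝ) ^ (k - j)) / n) ^ (U.card - j) := by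
        refine Finset.prod_le_prod (fun _ _ => pr_nonneg) fun i hi => ?_
        have hi' := (Finset.mem_filter.1 hi).2
        exact pr_exists_explores_le p i hj hjk hn rfl (hP1 i hi') hK (hU i hi') hU0 J₀
    _ = _ := by
        rw [Finset.prod_mul_distrib, Finset.prod_const, hcard, Finset.prod_pow]
        congr 2
        rw [← hcard, ← Finset.prod_const, ← Finset.prod_const, hcard, ← Finset.prod_mul_distrib,
          ← Finset.prod_mul_distrib]
        exact Finset.prod_congr rfl fun i _ => by ring

end WitnessProbability

/-! ### First moment bound when a product condition fails -/

section Subcritical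

variable {n j k s : ℕ}

/-- Since `n.choose v ≤ (e * n / v) ^ v`, all powers of `v` cancel: the factor `v ^ j`, which counts
the starting `j`-sets, makes up for the exponent `v - j`. -/
lemma choose_mul_pow_le {v : ℕ} {D : ℝ} (hn : 0 < n) (hv : 0 < v) (hjv : j ≤ v) :
    (n.choose v : ℝ) * (v : ℝ) ^ j * (v * Real.exp (-(1 + D)) / n) ^ (v - j) ≤
      (n : ℝ) ^ j * Real.exp (j + D * j - D * v) := by
  have hn' : (0 : ℝ) < n := by exact_mod_cast hn
  have hv' : (0 : ℝ) < v := by exact_mod_cast hv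
  have h1 : (n.choose v : ℝ) ≤ (n : ℝ) ^ v * (Real.exp v / (v : ℝ) ^ v) := by
    have h2 := Nat.choose_le_pow_div (α := ℝ) v n
    have h3 := Real.pow_div_factorial_le_exp (v : ℝ) hv'.le v
    refine h2.trans ?_
    rw [div_le_iff₀ (by positivity)] at h3 ⊢
    calc (n : ℝ) ^ v = (n : ℝ) ^ v * ((v : ℝ) ^ v / (v : ℝ) ^ v) := by
          rw [div_self (by positivity), mul_one]
      _ ≤ (n : ℝ) ^ v * ((Real.exp v * v.factorial) / (v : ℝ) ^ v) := by gcongr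
      _ = _ := by ring
  have e1 : (v : ℝ) ^ v = (v : ℝ) ^ j * (v : ℝ) ^ (v - j) := by rw [← pow_add]; congr 1; omega
  have e2 : (n : ℝ) ^ v = (n : ℝ) ^ j * (n : ℝ) ^ (v - j) := by rw [← pow_add]; congr 1; omega
  have e3 : Real.exp (-(1 + D)) ^ (v - j) * Real.exp v = Real.exp (j + D * j - D * v) := by
    rw [← Real.exp_nat_mul, ← Real.exp_add, Nat.cast_sub hjv]
    congr 1; ring
  calc _ ≤ (n : ℝ) ^ v * (Real.exp v / (v : ℝ) ^ v) * (v : ℝ) ^ j *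
        (v * Real.exp (-(1 + D)) / n) ^ (v - j) := by gcongr
    _ = (n : ℝ) ^ j * (Real.exp (-(1 + D)) ^ (v - j) * Real.exp v) := by
        rw [e1, e2, div_pow, mul_pow]; field_simp
    _ = _ := by rw [e3]

/-- A violated product condition can be chosen such that all edge probabilities involved are
small. -/
lemma exists_violated_product {p : Fin s → unitInterval} (hp : Monotone p) {c x l : ℝ} {t : ℕ}
    (hs0 : 0 < s) (hc : 0 < c) (hx : 0 < x) (hl : 1 ≤ l)
    (h0 : l / (c * x ^ (t + 1)) ≤ (p ⟨0, hs0⟩ : ℝ))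
    (h : ∃ r : ℕ, 2 ≤ r ∧ r ≤ s ∧
      ∏ i ∈ Finset.univ.filter (fun i : Fin s => (i : ℕ) < r), (p i : ℝ) ≤
        1 / (c * x ^ (r * t + 1) * l ^ (r - 1))) :
    ∃ r : ℕ, 2 ≤ r ∧ r ≤ s ∧
      ∏ i ∈ Finset.univ.filter (fun i : Fin s => (i : ℕ) < r), (p i : ℝ) ≤
        1 / (c * x ^ (r * t + 1) * l ^ (r - 1)) ∧
      ∀ i : Fin s, (i : ℕ) < r → (p i : ℝ) * x ^ (t + 1) ≤ x / l := by
  classical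
  -- Take the least violated `r`. The product over `r - 1` colours is then not too small (for `r =
  -- 2` by `h0`), and division bounds the largest of the first `r` probabilities by `1 / (x ^ t *
  -- l)`.
  obtain ⟨r, ⟨h2, hrs, hr⟩, hmin⟩ : ∃ r : ℕ, (2 ≤ r ∧ r ≤ s ∧
      ∏ i ∈ Finset.univ.filter (fun i : Fin s => (i : ℕ) < r), (p i : ℝ) ≤
        1 / (c * x ^ (r * t + 1) * l ^ (r - 1))) ∧ ∀ r' < r, ¬ (2 ≤ r' ∧ r' ≤ s ∧
      ∏ i ∈ Finset.univ.filter (fun i : Fin s => (i : ℕ) < r'), (p i : ℝ) ≤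
        1 / (c * x ^ (r' * t + 1) * l ^ (r' - 1))) :=
    ⟨Nat.find h, Nat.find_spec h, fun r' hr' => Nat.find_min h hr'⟩
  refine ⟨r, h2, hrs, hr, fun i hi => ?_⟩
  obtain ⟨r, rfl⟩ : ∃ r', r = r' + 2 := ⟨r - 2, by omega⟩
  have hl0 : 0 < l := by linarith
  have hprev : 1 / (c * x ^ ((r + 1) * t + 1) * l ^ r) ≤
      ∏ i ∈ Finset.univ.filter (fun i : Fin s => (i : ℕ) < r + 1), (p i : ℝ) := by
    rcases r with _ | r
    · have e : Finset.univ.filter (fun i : Fin s => (i : ℕ) < 0 + 1) = {⟨0, by omega⟩} := by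
        ext i; simp [Fin.ext_iff]
      rw [e, Finset.prod_singleton]
      refine le_trans ?_ h0
      simp only [zero_add, one_mul, pow_zero, mul_one]
      gcongr
    · by_contra hcon
      exact hmin (r + 2) (by omega) ⟨by omega, by omega, (not_le.1 hcon).le⟩
  have hlast : r + 1 < s := by omega
  have hsplit : ∏ i ∈ Finset.univ.filter (fun i : Fin s => (i : ℕ) < r + 2), (p i : ℝ) =
      p ⟨r + 1, hlast⟩ *
        ∏ i ∈ Finset.univ.filter (fun i : Fin s => (i : ℕ) < r + 1), (p i : ℝ) := by
    have hset : Finset.univ.filter (fun i : Fin s => (i : ℕ) < r + 2) =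
        insert ⟨r + 1, hlast⟩ (Finset.univ.filter fun i : Fin s => (i : ℕ) < r + 1) := by
      ext i
      simp only [Finset.mem_filter, Finset.mem_univ, true_and, Finset.mem_insert, Fin.ext_iff]
      omega
    rw [hset, Finset.prod_insert (by simp)]
  rw [hsplit] at hr
  have hp1 : (p ⟨r + 1, hlast⟩ : ℝ) ≤ 1 / (x ^ t * l) := by
    have h3 : (p ⟨r + 1, hlast⟩ : ℝ) * (1 / (c * x ^ ((r + 1) * t + 1) * l ^ r)) ≤
        1 / (c * x ^ ((r + 2) * t + 1) * l ^ (r + 1)) :=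
      le_trans (mul_le_mul_of_nonneg_left hprev (p _).2.1) hr
    rw [mul_one_div, div_le_iff₀ (by positivity)] at h3
    refine h3.trans (le_of_eq ?_)
    have : (r + 2) * t + 1 = ((r + 1) * t + 1) + t := by ring
    rw [this, pow_add, pow_succ l r]
    field_simp
  have hpi : (p i : ℝ) ≤ p ⟨r + 1, hlast⟩ := hp (Fin.mk_le_mk.2 (by omega) : i ≤ ⟨r + 1, hlast⟩)
  calc (p i : ℝ) * x ^ (t + 1) ≤ 1 / (x ^ t * l) * x ^ (t + 1) := by
        gcongr; exact hpi.trans hp1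
    _ = x / l := by rw [pow_succ]; field_simp

/-- The bound for the probability that some set of `v` vertices is explored in all colours. -/
lemma pr_exists_explored_set_le {p : Fin s → unitInterval} {c l K D : ℝ}
    (hj : 1 ≤ j) (hjk : j < k) (hn : 0 < n) (hl : 0 < l) (hK : K = 4 * 2 ^ k * k)
    (hc : K ^ s * Real.exp (1 + D) ≤ c) {r : ℕ} (hr2 : 2 ≤ r) (hrs : r ≤ s)
    (hprod : ∏ i ∈ Finset.univ.filter (fun i : Fin s => (i : ℕ) < r), (p i : ℝ) ≤
        1 / (c * (n : ℝ) ^ (r * (k - j - 1) + 1) * l ^ (r - 1)))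
    (hP1 : ∀ i : Fin s, (i : ℕ) < r → 1 ≤ p i * (n : ℝ) ^ (k - j))
    (hP2 : ∀ i : Fin s, (i : ℕ) < r → p i * (n : ℝ) ^ (k - j) ≤ n / l)
    {v : ℕ} (hjv : j < v) (hvl : v * K ≤ l) :
    pr (fun c : Fin s × Set.powersetCard (Fin n) k => p c.1)
      (fun ω => ∃ U ∈ Finset.powersetCard v (Finset.univ : Finset (Fin n)),
        ∃ J₀ : Set.powersetCard (Fin n) j, (J₀ : Finset (Fin n)) ⊆ U ∧
          ∀ i : Fin s, ∃ F, (∀ e ∈ F, ω (i, e)) ∧ Explores U J₀ F) ≤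
      2 ^ s * ((n : ℝ) ^ j * Real.exp (j + D * j - D * v)) := by
  classical
  have hn' : (0 : ℝ) < n := by exact_mod_cast hn
  have hv' : (0 : ℝ) < v := by exact_mod_cast (by omega : 0 < v)
  have hk : (1 : ℝ) ≤ k := by exact_mod_cast (by omega : 1 ≤ k)
  have h2k : (1 : ℝ) ≤ 2 ^ k := one_le_pow₀ (by norm_num)
  have hK1 : 1 ≤ K := by
    rw [hK]
    have := one_le_mul_of_one_le_of_one_le h2k hk
    linarith
  have hc0 : 0 < c := lt_of_lt_of_le (by positivity) hc
  have hvl1 : (v : ℝ) / l ≤ 1 := by rw [div_le_one hl]; nlinarith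
  set q : Fin s × Set.powersetCard (Fin n) k → unitInterval := fun c => p c.1
  let W : Finset (Fin n) → Set.powersetCard (Fin n) j →
      (Fin s × Set.powersetCard (Fin n) k → Prop) → Prop := fun U J₀ ω =>
    ∀ i : Fin s, ∃ F, (∀ e ∈ F, ω (i, e)) ∧ Explores U J₀ F
  have hone : ∀ U ∈ Finset.powersetCard v (Finset.univ : Finset (Fin n)),
      ∀ J₀, pr q (W U J₀) ≤ 2 ^ s * (v * Real.exp (-(1 + D)) / n) ^ (v - j) := by
    intro U hU J₀
    have hUc : U.card = v := (Finset.mem_powersetCard.1 hU).2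
    have h1 := pr_all_explore_le p (U := U) hj hjk hn r hrs hP1 hK (fun i hi => by
      rw [hUc]
      calc v * K * (p i * (n : ℝ) ^ (k - j)) ≤ l * (n / l) := by
            have := hP2 i hi
            have := hP1 i hi
            gcongr
        _ = n := by field_simp) (by omega) J₀
    rw [hUc] at h1
    refine h1.trans ?_
    -- All powers of `n` but one cancel and `(v / l) ^ (r - 1) ≤ 1` removes the logarithms, so at
    -- most `v * K ^ s / (c * n)` remains.
    have hY : (v * K / n) ^ r * ((n : ℝ) ^ (k - j)) ^ r *
        ∏ i ∈ Finset.univ.filter (fun i : Fin s => (i : ℕ) < r), (p i : ℝ) ≤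
        v * Real.exp (-(1 + D)) / n := by
      have e1 : (v : ℝ) ^ r = v * (v : ℝ) ^ (r - 1) := by rw [← pow_succ']; congr 1; omega
      have e2 : ((n : ℝ) ^ (k - j)) ^ r = (n : ℝ) ^ (r * (k - j - 1) + 1) * (n : ℝ) ^ r / n := by
        rw [eq_div_iff hn'.ne', ← pow_mul, ← pow_add, ← pow_succ]
        congr 1
        obtain ⟨t, ht⟩ : ∃ t, k - j = t + 1 := ⟨k - j - 1, by omega⟩
        rw [ht, Nat.add_sub_cancel]
        ring
      calc _ ≤ (v * K / n) ^ r * ((n : ℝ) ^ (k - j)) ^ r *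
            (1 / (c * (n : ℝ) ^ (r * (k - j - 1) + 1) * l ^ (r - 1))) := by gcongr
        _ = v * ((v : ℝ) / l) ^ (r - 1) * K ^ r / (c * n) := by
            rw [e2, div_pow, mul_pow, e1, div_pow]
            field_simp
        _ ≤ v * 1 * K ^ s / (c * n) := by
            have h2 : ((v : ℝ) / l) ^ (r - 1) ≤ 1 := pow_le_one₀ (by positivity) hvl1
            have h3 : K ^ r ≤ K ^ s := pow_le_pow_right₀ hK1 hrs
            gcongr
        _ ≤ v * Real.exp (-(1 + D)) / n := by
            rw [mul_one, Real.exp_neg, ← div_eq_mul_inv, div_div]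
            rw [div_le_div_iff₀ (by positivity) (by positivity)]
            calc (v : ℝ) * K ^ s * (Real.exp (1 + D) * n) =
                  v * (K ^ s * Real.exp (1 + D)) * n := by ring
              _ ≤ v * c * n := by gcongr
              _ = v * (c * n) := by ring
    have h2 : (2 : ℝ) ^ r ≤ 2 ^ s := pow_le_pow_right₀ (by norm_num) hrs
    have h3 : (0 : ℝ) ≤ ∏ i ∈ Finset.univ.filter (fun i : Fin s => (i : ℕ) < r), (p i : ℝ) :=
      Finset.prod_nonneg fun i _ => (p i).2.1
    gcongr
  have hJcard : ∀ U ∈ Finset.powersetCard v (Finset.univ : Finset (Fin n)),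
      ((Finset.univ.filter fun J₀ : Set.powersetCard (Fin n) j =>
        (J₀ : Finset (Fin n)) ⊆ U).card : ℝ) ≤ (v : ℝ) ^ j := by
    intro U hU
    have hUc : U.card = v := (Finset.mem_powersetCard.1 hU).2
    have : (Finset.univ.filter fun J₀ : Set.powersetCard (Fin n) j =>
        (J₀ : Finset (Fin n)) ⊆ U).card ≤ v ^ j := by
      calc _ ≤ (Finset.powersetCard j U).card := by
            refine Finset.card_le_card_of_injOn (fun J => (J : Finset (Fin n))) ?_ ?_
            · intro J hJ
              exact Finset.mem_powersetCard.2
                ⟨(Finset.mem_filter.1 hJ).2, Set.powersetCard.card_eq J⟩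
            · intro J _ J' _ h
              exact Subtype.ext h
        _ ≤ v ^ j := by
            rw [Finset.card_powersetCard, hUc]; exact Nat.choose_le_pow _ _
    exact_mod_cast this
  calc _ ≤ ∑ U ∈ Finset.powersetCard v (Finset.univ : Finset (Fin n)),
        pr q (fun ω => ∃ J₀ ∈ (Finset.univ.filter fun J₀ : Set.powersetCard (Fin n) j =>
          (J₀ : Finset (Fin n)) ⊆ U), W U J₀ ω) := by
        refine le_trans (pr_mono fun ω hω => ?_) (pr_exists_le _ _)
        obtain ⟨U, hU, J₀, hJ₀, h⟩ := hω
        exact ⟨U, hU, J₀, by simpa using hJ₀, h⟩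
    _ ≤ ∑ U ∈ Finset.powersetCard v (Finset.univ : Finset (Fin n)),
        (v : ℝ) ^ j * (2 ^ s * (v * Real.exp (-(1 + D)) / n) ^ (v - j)) := by
        refine Finset.sum_le_sum fun U hU => (pr_exists_le _ _).trans ?_
        calc _ ≤ ∑ _J₀ ∈ (Finset.univ.filter fun J₀ : Set.powersetCard (Fin n) j =>
              (J₀ : Finset (Fin n)) ⊆ U), 2 ^ s * (v * Real.exp (-(1 + D)) / n) ^ (v - j) :=
              Finset.sum_le_sum fun J₀ _ => hone U hU J₀
          _ ≤ _ := by
              rw [Finset.sum_const, nsmul_eq_mul]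
              have := hJcard U hU
              gcongr
    _ = 2 ^ s * ((n.choose v : ℝ) * (v : ℝ) ^ j *
          (v * Real.exp (-(1 + D)) / n) ^ (v - j)) := by
        rw [Finset.sum_const, nsmul_eq_mul, Finset.card_powersetCard, Finset.card_univ,
          Fintype.card_fin]
        ring
    _ ≤ _ := by
        have := choose_mul_pow_le (j := j) (D := D) hn (by omega : 0 < v) hjv.le
        gcongr

end Subcritical

/-- The subcritical bound when a product condition fails. -/
theorem exists_product_bound (j k s : ℕ) (hj : 1 ≤ j) (hjk : j < k) (hs0 : 0 < s) :
    ∃ c₀ : ℝ, 0 < c₀ ∧ ∀ c, c₀ ≤ c → ∀ᶠ n : ℕ in atTop, ∀ p : Fin s → unitInterval, Monotone p →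
      Real.log n / (c * (n : ℝ) ^ (k - j)) ≤ (p ⟨0, hs0⟩ : ℝ) →
      (∃ r : ℕ, 2 ≤ r ∧ r ≤ s ∧
        ∏ i ∈ Finset.univ.filter (fun i : Fin s => (i : ℕ) < r), (p i : ℝ) ≤
          1 / (c * (n : ℝ) ^ (r * (k - j - 1) + 1) * Real.log n ^ (r - 1))) →
      (randomMultiKGraph n k p).real {H | H.Percolates j} ≤ 1 / n := by
  classical
  set K : ℝ := 4 * 2 ^ k * k with hK
  have hk : (1 : ℝ) ≤ k := by exact_mod_cast (by omega : 1 ≤ k)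
  have h2k : (1 : ℝ) ≤ 2 ^ k := one_le_pow₀ (by norm_num)
  have hK1 : 1 ≤ K := by
    have := one_le_mul_of_one_le_of_one_le h2k hk
    rw [hK]; linarith
  -- This gives `2 * L ≤ log n / K`, as required for the scales `v < 2 * L`, and `D` is such that
  -- `exp (-D * L) ≤ n ^ (-(j + 3))`: `n ^ j` pays for the starting sets, `n ^ 2` for the number of
  -- scales and the constants.
  set ε : ℝ := 1 / (4 * K) with hε
  have hε0 : 0 < ε := by positivity
  set D : ℝ := (j + 3) / ε with hD
  refine ⟨K ^ s * Real.exp (1 + D), by positivity, fun c hc => ?_⟩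
  have hc0 : 0 < c := lt_of_lt_of_le (by positivity) hc
  have hlog : Tendsto (fun n : ℕ => Real.log n) atTop atTop :=
    Real.tendsto_log_atTop.comp tendsto_natCast_atTop_atTop
  filter_upwards [hlog.eventually (eventually_ge_atTop c),
    hlog.eventually (eventually_gt_atTop (j / ε)), hlog.eventually (eventually_ge_atTop (1 / ε)),
    eventually_gt_atTop 0,
    (tendsto_natCast_atTop_atTop (R := ℝ)).eventually
      (eventually_ge_atTop (2 ^ s * Real.exp (j + D * j)))] with n hlc hlj hl1 hn hnC p hp h0 hex
  set l := Real.log n with hl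
  have hn' : (0 : ℝ) < n := by exact_mod_cast hn
  have hnl : (n : ℝ) = Real.exp l := by rw [hl, Real.exp_log hn']
  have hε1 : 1 ≤ 1 / ε := by
    rw [hε, one_div_one_div]; linarith
  have hl0 : 1 ≤ l := hε1.trans hl1
  rw [div_le_iff₀ hε0] at hl1
  rw [div_lt_iff₀ hε0] at hlj
  set L : ℕ := ⌈l * ε⌉₊ with hL
  have hL1 : l * ε ≤ L := Nat.le_ceil _
  have hL2 : (L : ℝ) ≤ l * ε + 1 := (Nat.ceil_lt_add_one (by positivity)).le
  have hjL : j < L := by exact_mod_cast lt_of_lt_of_le hlj hL1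
  have h4 : (4 : ℝ) * (l * ε) = l / K := by rw [hε]; field_simp
  have h2L : ((2 * L : ℕ) : ℝ) ≤ l / K := by push_cast; linarith
  have hln : l / K ≤ n := by
    have h5 : l / K ≤ l := div_le_self (by linarith) hK1
    have h6 := Real.add_one_le_exp l
    linarith
  have h2Ln : 2 * L ≤ n := by exact_mod_cast h2L.trans hln
  have hkj : k - j = (k - j - 1) + 1 := by omega
  rw [hkj] at h0
  obtain ⟨r, hr2, hrs, hprod, hP2⟩ := exists_violated_product hp hs0 hc0 hn' hl0 h0 hex
  rw [← hkj] at h0 hP2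
  -- For large `n` one has `c ≤ log n`, so the lower bound on the smallest probability suffices.
  have hP1 : ∀ i : Fin s, (i : ℕ) < r → 1 ≤ p i * (n : ℝ) ^ (k - j) := by
    intro i _
    have h1 : (p ⟨0, by omega⟩ : ℝ) ≤ p i := hp (Fin.mk_le_of_le_val (Nat.zero_le _))
    have h2 := h0.trans h1
    rw [div_le_iff₀ (by positivity)] at h2
    have h3 : c * 1 ≤ c * (p i * (n : ℝ) ^ (k - j)) := by linarith
    exact le_of_mul_le_mul_left h3 hc0
  rw [randomMultiKGraph_real]
  calc _ ≤ pr (fun c : Fin s × Set.powersetCard (Fin n) k => p c.1)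
        (fun ω => ∃ v ∈ Finset.Ico L (2 * L),
          ∃ U ∈ Finset.powersetCard v (Finset.univ : Finset (Fin n)),
        ∃ J₀ : Set.powersetCard (Fin n) j, (J₀ : Finset (Fin n)) ⊆ U ∧
          ∀ i : Fin s, ∃ F, (∀ e ∈ F, ω (i, e)) ∧ Explores U J₀ F) := by
        refine pr_mono fun ω hω => ?_
        obtain ⟨A, ⟨J₀, hJ₀⟩, hA, h1, h2⟩ := hω.exists_cutConnected hj hjL
          (by rw [Fintype.card_fin]; omega)
        refine ⟨(MultiKGraph.cover A).card, Finset.mem_Ico.2 ⟨h1, h2⟩, MultiKGraph.cover A,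
          Finset.mem_powersetCard.2 ⟨Finset.subset_univ _, rfl⟩, J₀,
          Finset.subset_biUnion_of_mem
            (fun J : Set.powersetCard (Fin n) j => (J : Finset (Fin n))) hJ₀, fun i => ?_⟩
        obtain ⟨F, hF1, hF2⟩ := (hA i).exists_explores hJ₀
        exact ⟨F, hF1, hF2⟩
    _ ≤ ∑ v ∈ Finset.Ico L (2 * L), 2 ^ s * ((n : ℝ) ^ j * Real.exp (j + D * j - D * v)) := by
        refine (pr_exists_le _ _).trans (Finset.sum_le_sum fun v hv => ?_)
        obtain ⟨hv1, hv2⟩ := Finset.mem_Ico.1 hv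
        refine pr_exists_explored_set_le hj hjk hn (by linarith) hK hc hr2 hrs hprod hP1 hP2
          (by omega) ?_
        have h5 : (v : ℝ) ≤ l / K := le_trans (by exact_mod_cast hv2.le) h2L
        rwa [le_div_iff₀ (by linarith)] at h5
    _ ≤ ∑ _v ∈ Finset.Ico L (2 * L), 2 ^ s * ((n : ℝ) ^ j *
          (Real.exp (j + D * j) * (1 / (n : ℝ) ^ (j + 3)))) := by
        refine Finset.sum_le_sum fun v hv => ?_
        have hv1 : (L : ℝ) ≤ v := by exact_mod_cast (Finset.mem_Ico.1 hv).1
        have h5 : Real.exp (j + D * j - D * v) ≤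
            Real.exp (j + D * j) * (1 / (n : ℝ) ^ (j + 3)) := by
          rw [hnl, ← Real.exp_nat_mul, one_div, ← Real.exp_neg, ← Real.exp_add]
          apply Real.exp_le_exp.2
          have h6 : D * (l * ε) ≤ D * v := by
            have : 0 ≤ D := by positivity
            gcongr
            linarith
          have h7 : D * (l * ε) = (j + 3) * l := by rw [hD]; field_simp
          push_cast
          linarith
        gcongr
    _ = L * (2 ^ s * Real.exp (j + D * j)) * (1 / (n : ℝ) ^ 3) := by
        rw [Finset.sum_const, nsmul_eq_mul, Nat.card_Ico, pow_add]
        have : 2 * L - L = L := by omega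
        rw [this]
        field_simp
    _ ≤ n * n * (1 / (n : ℝ) ^ 3) := by
        have : (L : ℝ) ≤ n := by exact_mod_cast (by omega : L ≤ n)
        gcongr
    _ = 1 / n := by field_simp

/-! ### Isolated `j`-sets in the sparsest colour -/

namespace MultiKGraph

variable {V : Type*} {k s j : ℕ}

/-- A `j`-set that lies in no edge of some colour remains a cluster of its own. -/
lemma jigsaw_eq_of_isolated {H : MultiKGraph V k s} {i : Fin s} {J : Set.powersetCard V j}
    (hJ : ∀ e ∈ H i, ¬ (J : Finset V) ⊆ (e : Finset V)) (t : ℕ) (J' : Set.powersetCard V j)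
    (h : H.jigsaw j t J J') : J = J' := by
  induction t generalizing J' with
  | zero => exact h
  | succ t ih =>
    change (H.clusterGraph _).Reachable (Quotient.mk _ J) (Quotient.mk _ J') at h
    obtain ⟨w⟩ := h
    generalize hA : Quotient.mk (H.jigsaw j t) J = A at w
    generalize hB : Quotient.mk (H.jigsaw j t) J' = B at w
    cases w with
    | nil => exact ih J' (Quotient.exact (hA.trans hB.symm))
    | cons hadj _ =>
      obtain ⟨J₁, -, h1, -, e, he, h2, -⟩ := hadj.2 i
      rw [← ih J₁ (Quotient.exact (hA.trans h1.symm))] at h2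
      exact absurd h2 (hJ e he)

lemma Percolates.exists_edge [Nontrivial (Set.powersetCard V j)] {H : MultiKGraph V k s}
    (h : H.Percolates j) (i : Fin s) (J : Set.powersetCard V j) :
    ∃ e ∈ H i, (J : Finset V) ⊆ (e : Finset V) := by
  by_contra! hJ
  obtain ⟨t, ht⟩ := h
  obtain ⟨J', hJ'⟩ := exists_ne J
  have := (Nat.card_eq_one_iff_unique.1 ht).1
  exact hJ' (jigsaw_eq_of_isolated hJ t J' (Quotient.exact (Subsingleton.elim _ _))).symm

end MultiKGraph

section Isolated

variable {n j k s : ℕ}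

lemma card_filter_superset_le (K : Finset (Fin n)) :
    (Finset.univ.filter fun e : Set.powersetCard (Fin n) k =>
      K ⊆ (e : Finset (Fin n))).card ≤ n ^ (k - K.card) := by
  calc _ ≤ (Finset.powersetCard (k - K.card) (Finset.univ : Finset (Fin n))).card := by
        refine Finset.card_le_card_of_injOn (fun e => (e : Finset (Fin n)) \ K) ?_ ?_
        · intro e he
          refine Finset.mem_powersetCard.2 ⟨Finset.subset_univ _, ?_⟩
          rw [Finset.card_sdiff_of_subset (Finset.mem_filter.1 he).2, Set.powersetCard.card_eq]
        · intro e he e' he' h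
          refine Subtype.ext ?_
          rw [← Finset.sdiff_union_of_subset (Finset.mem_filter.1 he).2,
            ← Finset.sdiff_union_of_subset (Finset.mem_filter.1 he').2]
          exact congrArg (· ∪ K) h
    _ ≤ _ := by
        rw [Finset.card_powersetCard, Finset.card_univ, Fintype.card_fin]
        exact Nat.choose_le_pow _ _

lemma card_lt_card_union_of_ne {J J' : Set.powersetCard (Fin n) j} (h : J ≠ J') :
    j + 1 ≤ ((J : Finset (Fin n)) ∪ J').card := by
  by_contra! hlt
  have h1 := Set.powersetCard.card_eq J
  have h2 := Set.powersetCard.card_eq J'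
  have h3 : (J : Finset (Fin n)) = (J : Finset (Fin n)) ∪ J' :=
    Finset.eq_of_subset_of_card_le Finset.subset_union_left (by omega)
  have h4 : (J' : Finset (Fin n)) = (J : Finset (Fin n)) ∪ J' :=
    Finset.eq_of_subset_of_card_le Finset.subset_union_right (by omega)
  exact h (Subtype.ext (h3.trans h4.symm))

/-- Two distinct `j`-sets span at least `j + 1` vertices, so at most `n ^ (k - j - 1)` edges contain
both. -/
lemma card_filter_two_le (hn : 0 < n) (T : Finset (Set.powersetCard (Fin n) j)) :
    (Finset.univ.filter fun e : Set.powersetCard (Fin n) k => ∃ J ∈ T, ∃ J' ∈ T, J ≠ J' ∧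
      (J : Finset (Fin n)) ⊆ (e : Finset (Fin n)) ∧
      (J' : Finset (Fin n)) ⊆ (e : Finset (Fin n))).card ≤ T.card ^ 2 * n ^ (k - j - 1) := by
  classical
  calc _ ≤ (T.offDiag.biUnion fun x => Finset.univ.filter fun e : Set.powersetCard (Fin n) k =>
        (x.1 : Finset (Fin n)) ∪ x.2 ⊆ (e : Finset (Fin n))).card := by
        refine Finset.card_le_card fun e he => ?_
        obtain ⟨J, hJ, J', hJ', hne, h1, h2⟩ := (Finset.mem_filter.1 he).2
        exact Finset.mem_biUnion.2 ⟨(J, J'), Finset.mem_offDiag.2 ⟨hJ, hJ', hne⟩,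
          Finset.mem_filter.2 ⟨Finset.mem_univ _, Finset.union_subset h1 h2⟩⟩
    _ ≤ T.offDiag.card * n ^ (k - j - 1) := by
        refine Finset.card_biUnion_le_card_mul _ _ _ fun x hx => ?_
        have := card_lt_card_union_of_ne (Finset.mem_offDiag.1 hx).2.2
        exact (card_filter_superset_le _).trans (Nat.pow_le_pow_right hn (by omega))
    _ ≤ _ := by
        rw [Finset.offDiag_card, sq]
        exact Nat.mul_le_mul_right _ (Nat.sub_le _ _)

/-- Few `j`-sets are unlikely to be all contained in edges of a sparse colour. -/
lemma pr_percolates_le_of_sparse (hn : 0 < n) (p : Fin s → unitInterval) (i : Fin s)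
    (T : Finset (Set.powersetCard (Fin n) j)) (hT : 1 < T.card) :
    pr (fun c : Fin s × Set.powersetCard (Fin n) k => p c.1)
      (fun ω => MultiKGraph.Percolates (fun i => {e | ω (i, e)}) j) ≤
      (T.card : ℝ) ^ 2 * n ^ (k - j - 1) * p i +
        (1 - (1 - (p i : ℝ)) ^ (n ^ (k - j))) ^ T.card := by
  classical
  obtain ⟨J₀, hJ₀, J₁, hJ₁, hne⟩ := Finset.one_lt_card.1 hT
  have : Nontrivial (Set.powersetCard (Fin n) j) := ⟨J₀, J₁, hne⟩
  set q : Fin s × Set.powersetCard (Fin n) k → unitInterval := fun c => p c.1 with hq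
  set S : Finset (Set.powersetCard (Fin n) k) :=
    Finset.univ.filter fun e : Set.powersetCard (Fin n) k => ∃ J ∈ T, ∃ J' ∈ T, J ≠ J' ∧
      (J : Finset (Fin n)) ⊆ (e : Finset (Fin n)) ∧
      (J' : Finset (Fin n)) ⊆ (e : Finset (Fin n)) with hS
  -- Away from `S` an edge contains at most one member of `T`, so the families `E J` for `J ∈ T` are
  -- disjoint and the events that they are hit are independent.
  set E : Set.powersetCard (Fin n) j → Finset (Set.powersetCard (Fin n) k) := fun J =>
    Finset.univ.filter fun e : Set.powersetCard (Fin n) k =>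
      (J : Finset (Fin n)) ⊆ (e : Finset (Fin n)) ∧ e ∉ S with hE
  have hp0 : (0 : ℝ) ≤ p i := (p i).2.1
  have hp1 : (p i : ℝ) ≤ 1 := (p i).2.2
  have hA : ∀ J, pr q (fun ω => ∃ e ∈ E J, ω (i, e)) ≤ 1 - (1 - (p i : ℝ)) ^ (n ^ (k - j)) := by
    intro J
    have h1 : pr q (fun ω => ∃ e ∈ E J, ω (i, e)) =
        1 - pr q (fun ω => ∀ c ∈ (E J).image (fun e => (i, e)), ¬ ω c) := by
      rw [← pr_not]
      simp only [Finset.forall_mem_image, not_forall, not_not, exists_prop]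
    rw [h1, pr_forall_not_mem, Finset.prod_image (fun a _ b _ h => (Prod.ext_iff.1 h).2)]
    simp only [hq, Finset.prod_const]
    refine sub_le_sub_left (pow_le_pow_of_le_one (by linarith) (by linarith) ?_) 1
    refine (Finset.card_le_card (t := Finset.univ.filter fun e : Set.powersetCard (Fin n) k =>
      (J : Finset (Fin n)) ⊆ (e : Finset (Fin n))) fun e he => ?_).trans
        ((card_filter_superset_le _).trans (by rw [Set.powersetCard.card_eq]))
    exact Finset.mem_filter.2 ⟨Finset.mem_univ _, (Finset.mem_filter.1 he).2.1⟩
  calc _ ≤ pr q (fun ω => (∃ e ∈ S, ω (i, e)) ∨ ∀ J ∈ T, ∃ e ∈ E J, ω (i, e)) := by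
        refine pr_mono fun ω hω => ?_
        by_cases h : ∃ e ∈ S, ω (i, e)
        · exact Or.inl h
        · refine Or.inr fun J _ => ?_
          obtain ⟨e, he, hJe⟩ := hω.exists_edge i J
          exact ⟨e, Finset.mem_filter.2 ⟨Finset.mem_univ _, hJe, fun hs => h ⟨e, hs, he⟩⟩, he⟩
    _ ≤ pr q (fun ω => ∃ e ∈ S, ω (i, e)) + pr q (fun ω => ∀ J ∈ T, ∃ e ∈ E J, ω (i, e)) :=
        pr_or_le
    _ ≤ _ := by
        refine add_le_add ?_ ?_
        · calc _ ≤ ∑ e ∈ S, pr q (fun ω => ω (i, e)) := pr_exists_le S fun e ω => ω (i, e)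
            _ = S.card * p i := by simp [pr_apply, hq]
            _ ≤ _ := by
              refine mul_le_mul_of_nonneg_right ?_ hp0
              exact_mod_cast card_filter_two_le hn T
        · rw [pr_forall_of_disjoint T (fun J ω => ∃ e ∈ E J, ω (i, e))
            (fun J => {c | c.2 ∈ E J})]
          · calc _ ≤ ∏ _J ∈ T, (1 - (1 - (p i : ℝ)) ^ (n ^ (k - j))) :=
                  Finset.prod_le_prod (fun _ _ => pr_nonneg) fun J _ => hA J
              _ = _ := by rw [Finset.prod_const]
          · intro J _
            refine DependsOn.event_exists fun e => ?_
            by_cases he : e ∈ E J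
            · exact (dependsOn_event_const _).event_and (dependsOn_event_apply (by exact he))
            · intro x y _
              simp [he]
          · intro J hJ J' hJ' hne
            refine Set.disjoint_left.2 fun c h1 h2 => ?_
            obtain ⟨-, h3, h4⟩ := Finset.mem_filter.1 (show c.2 ∈ E J from h1)
            obtain ⟨-, h5, -⟩ := Finset.mem_filter.1 (show c.2 ∈ E J' from h2)
            exact h4 (Finset.mem_filter.2 ⟨Finset.mem_univ _, J, hJ, J', hJ', hne, h3, h5⟩)

lemma lt_choose_add (m j : ℕ) (hj : 1 ≤ j) : m < (m + j).choose j := by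
  induction j, hj using Nat.le_induction with
  | base => simp
  | succ j _ ih =>
    rw [← add_assoc, Nat.choose_succ_succ]
    omega

lemma exp_neg_two_mul_le {p : ℝ} (h0 : 0 ≤ p) (h1 : p ≤ 1 / 2) : Real.exp (-(2 * p)) ≤ 1 - p := by
  rw [Real.exp_neg, inv_le_comm₀ (Real.exp_pos _) (by linarith)]
  refine le_trans ?_ (Real.add_one_le_exp _)
  rw [inv_le_iff_one_le_mul₀ (by linarith)]
  nlinarith

end Isolated

/-- The subcritical bound when the sparsest colour has isolated `j`-sets. -/
theorem isolated_bound (j k s : ℕ) (hj : 1 ≤ j) (hjk : j < k) {c : ℝ} (hc : 16 ≤ c) :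
    ∀ᶠ n : ℕ in atTop, ∀ (p : Fin s → unitInterval) (i : Fin s),
      (p i : ℝ) ≤ Real.log n / (c * (n : ℝ) ^ (k - j)) →
      (randomMultiKGraph n k p).real {H | H.Percolates j} ≤ 2 * Real.exp (-(Real.log n / 4)) := by
  classical
  have hlog : Tendsto (fun n : ℕ => Real.log n) atTop atTop :=
    Real.tendsto_log_atTop.comp tendsto_natCast_atTop_atTop
  filter_upwards [hlog.eventually (eventually_ge_atTop 16), eventually_ge_atTop (2 * j),
    eventually_gt_atTop 0] with n hl hnj hn p i hpi
  rw [randomMultiKGraph_real]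
  set l := Real.log n with hl'
  have hn' : (0 : ℝ) < n := by exact_mod_cast hn
  have hnl : (n : ℝ) = Real.exp l := (Real.exp_log hn').symm
  have hn1 : (1 : ℝ) ≤ n := by exact_mod_cast hn
  -- About `n^(1/4)` sets are few enough that some edge contains two of them with probability at
  -- most `n^(-1/4)`, and many enough against the chance of at least `n^(-1/8)` that a given one is
  -- isolated.
  set τ := ⌊Real.exp (l / 4)⌋₊ with hτ
  have hτ1 : (τ : ℝ) ≤ Real.exp (l / 4) := Nat.floor_le (Real.exp_pos _).le
  have hτ2 : Real.exp (l / 4) < τ + 1 := Nat.lt_floor_add_one _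
  have hexp4 := Real.add_one_le_exp (l / 4)
  have hexp8 := Real.add_one_le_exp (l / 8)
  have hsq8 : Real.exp (l / 4) = Real.exp (l / 8) * Real.exp (l / 8) := by
    rw [← Real.exp_add]; ring_nf
  have hcard : τ ≤ (Finset.univ : Finset (Set.powersetCard (Fin n) j)).card := by
    rw [Finset.card_univ, ← Nat.card_eq_fintype_card, Set.powersetCard.card, Nat.card_fin]
    have h1 := lt_choose_add (n - j) j hj
    rw [Nat.sub_add_cancel (by omega)] at h1
    refine le_trans ?_ h1.le
    have h2 : 2 * τ ≤ n := by
      have h3 : Real.exp l = Real.exp (l / 4) * Real.exp (3 * l / 4) := by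
        rw [← Real.exp_add]; ring_nf
      have h4 := Real.add_one_le_exp (3 * l / 4)
      have : (2 : ℝ) * τ ≤ n := by
        rw [hnl, h3]
        nlinarith [Real.exp_pos (l / 4)]
      exact_mod_cast this
    omega
  obtain ⟨T, -, hTc⟩ := Finset.exists_subset_card_eq hcard
  have hT1 : 1 < T.card := by
    rw [hTc]
    have : (1 : ℝ) < τ := by linarith
    exact_mod_cast this
  have hp0 : (0 : ℝ) ≤ p i := (p i).2.1
  have hpN : (p i : ℝ) * (n : ℝ) ^ (k - j) ≤ l / c := by
    rw [← div_div, le_div_iff₀ (by positivity)] at hpi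
    exact hpi
  have hkj : (n : ℝ) ^ (k - j) = n ^ (k - j - 1) * n := by
    rw [← pow_succ]; congr 1; omega
  have hlc : l / c ≤ l / 16 := by gcongr
  refine (pr_percolates_le_of_sparse hn p i T hT1).trans ?_
  rw [hTc, two_mul]
  refine add_le_add ?_ ?_
  · have h1 : (τ : ℝ) ^ 2 * n ^ (k - j - 1) * p i * n ≤ Real.exp (-(l / 4)) * n := by
      calc (τ : ℝ) ^ 2 * n ^ (k - j - 1) * p i * n = τ ^ 2 * (p i * n ^ (k - j)) := by
            rw [hkj]; ring
        _ ≤ Real.exp (l / 4) ^ 2 * (l / 16) := by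
            gcongr; exact hpN.trans hlc
        _ ≤ Real.exp (l / 4) ^ 2 * Real.exp (l / 4) := by
            gcongr; linarith
        _ = _ := by
            rw [hnl, ← Real.exp_add, ← pow_succ, ← Real.exp_nat_mul]
            congr 1; push_cast; ring
    exact le_of_mul_le_mul_right h1 hn'
  · have hN1 : (1 : ℝ) ≤ n ^ (k - j - 1) := one_le_pow₀ hn1
    have hph : (p i : ℝ) ≤ 1 / 2 := by
      have h1 : (p i : ℝ) * n ≤ l / 16 := by
        refine le_trans ?_ (hpN.trans hlc)
        rw [hkj]
        have := mul_le_mul_of_nonneg_right hN1 (mul_nonneg hp0 hn'.le)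
        nlinarith
      have h2 : l ≤ n := (Real.log_le_sub_one_of_pos hn').trans (by linarith)
      nlinarith
    have hq : Real.exp (-(l / 8)) ≤ (1 - (p i : ℝ)) ^ (n ^ (k - j)) := by
      calc Real.exp (-(l / 8)) ≤ Real.exp (-(2 * (p i : ℝ))) ^ (n ^ (k - j)) := by
            rw [← Real.exp_nat_mul]
            refine Real.exp_le_exp.2 ?_
            push_cast
            nlinarith
        _ ≤ _ := pow_le_pow_left₀ (Real.exp_pos _).le (exp_neg_two_mul_le hp0 hph) _
    have hq1 : (1 - (p i : ℝ)) ^ (n ^ (k - j)) ≤ 1 :=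
      pow_le_one₀ (by linarith) (by linarith)
    calc _ ≤ Real.exp (-Real.exp (-(l / 8))) ^ τ := by
          refine pow_le_pow_left₀ (by linarith) ?_ _
          refine le_trans ?_ (Real.add_one_le_exp _)
          linarith
      _ ≤ _ := by
          rw [← Real.exp_nat_mul]
          refine Real.exp_le_exp.2 ?_
          have h1 : Real.exp (-(l / 8)) * Real.exp (l / 8) = 1 := by
            rw [← Real.exp_add]; simp
          have h2 : Real.exp (-(l / 8)) ≤ 1 := Real.exp_le_one_iff.2 (by linarith)
          have h3 : Real.exp (l / 8) ≤ (τ + 1) * Real.exp (-(l / 8)) := by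
            calc Real.exp (l / 8) = Real.exp (l / 4) * Real.exp (-(l / 8)) := by
                  rw [hsq8, mul_assoc, mul_comm (Real.exp (l / 8)) (Real.exp (-(l / 8))), h1,
                    mul_one]
              _ ≤ _ := by gcongr
          have h4 : l / 4 + 1 ≤ Real.exp (l / 8) := by
            have h5 := Real.quadratic_le_exp_of_nonneg (by positivity : 0 ≤ l / 8)
            nlinarith
          linarith

/-! ### Conclusion -/

instance (n k : ℕ) {s : ℕ} (p : Fin s → unitInterval) :
    IsProbabilityMeasure (randomMultiKGraph n k p) := by
  unfold randomMultiKGraph; infer_instance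

/-- If the complement has vanishing probability, the probability tends to one. -/
lemma tendsto_measure_one_of_real_not_le {k s : ℕ} {p : ℕ → Fin s → unitInterval}
    {P : ∀ n, MultiKGraph (Fin n) k s → Prop} {ε : ℕ → ℝ} (hε : Tendsto ε atTop (𝓝 0))
    (h : ∀ᶠ n in atTop, (randomMultiKGraph n k (p n)).real {H | ¬ P n H} ≤ ε n) :
    Tendsto (fun n => randomMultiKGraph n k (p n) {H | P n H}) atTop (𝓝 1) := by
  have h0 : Tendsto (fun n => (randomMultiKGraph n k (p n)).real {H | ¬ P n H}) atTop (𝓝 0) :=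
    squeeze_zero' (Eventually.of_forall fun _ => measureReal_nonneg) h hε
  have h1 : ∀ n, randomMultiKGraph n k (p n) {H | P n H} =
      ENNReal.ofReal (1 - (randomMultiKGraph n k (p n)).real {H | ¬ P n H}) := by
    intro n
    have h2 := probReal_compl_eq_one_sub (μ := randomMultiKGraph n k (p n))
      (s := {H | ¬ P n H}) MeasurableSet.of_discrete
    rw [← h2, ofReal_measureReal]
    congr 1
    ext H
    simp
  simp only [h1]
  have h3 := ENNReal.tendsto_ofReal (h0.const_sub 1)
  simpa using h3

theorem theorem4p2 (j k s : ℕ) (hj : 1 ≤ j) (hjk : j < k) (hs : 2 ≤ s) :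
    ∃ c : ℝ, 0 < c ∧
      ∀ p : ℕ → Fin s → unitInterval, (∀ n, Monotone (p n)) →
        ((∀ᶠ n : ℕ in atTop,
            (p n ⟨0, by omega⟩ : ℝ) ≤ Real.log n / (c * (n : ℝ) ^ (k - j)) ∨
            ∃ r : ℕ, 2 ≤ r ∧ r ≤ s ∧
              ∏ i ∈ Finset.univ.filter (fun i : Fin s => (i : ℕ) < r), (p n i : ℝ) ≤
                1 / (c * (n : ℝ) ^ (r * (k - j - 1) + 1) * Real.log n ^ (r - 1))) →
          Tendsto (fun n : ℕ => randomMultiKGraph n k (p n) {H | ¬ H.Percolates j})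
            atTop (𝓝 1)) ∧
        ((∀ᶠ n : ℕ in atTop,
            c * Real.log n / (n : ℝ) ^ (k - j) ≤ (p n ⟨0, by omega⟩ : ℝ) ∧
            ∀ r : ℕ, 2 ≤ r → r ≤ s →
              c / ((n : ℝ) ^ (r * (k - j - 1) + 1) * Real.log n ^ (r - 1)) ≤
                ∏ i ∈ Finset.univ.filter (fun i : Fin s => (i : ℕ) < r), (p n i : ℝ)) →
          Tendsto (fun n : ℕ => randomMultiKGraph n k (p n) {H | H.Percolates j})
            atTop (𝓝 1)) := by
  obtain ⟨c₁, hc₁, hsub⟩ := exists_product_bound j k s hj hjk (by omega)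
  obtain ⟨c₂, hc₂, hsup⟩ := exists_percolates_bound j k s hj hjk hs (by omega)
  have hc1 : c₁ ≤ c₁ + c₂ + 16 := by linarith
  have hc2 : c₂ ≤ c₁ + c₂ + 16 := by linarith
  have hc3 : 16 ≤ c₁ + c₂ + 16 := by linarith
  refine ⟨c₁ + c₂ + 16, by positivity, fun p hp => ⟨fun h => ?_, fun h => ?_⟩⟩
  · have hlog : Tendsto (fun n : ℕ => Real.log n) atTop atTop :=
      Real.tendsto_log_atTop.comp tendsto_natCast_atTop_atTop
    have hε : Tendsto (fun n : ℕ => 1 / (n : ℝ) + 2 * Real.exp (-(Real.log n / 4))) atTop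
        (𝓝 0) := by
      have h1 := (Real.tendsto_exp_neg_atTop_nhds_zero.comp
        (hlog.atTop_div_const (by norm_num : (0 : ℝ) < 4))).const_mul 2
      simpa using (tendsto_one_div_atTop_nhds_zero_nat (𝕜 := ℝ)).add h1
    refine tendsto_measure_one_of_real_not_le (P := fun n H => ¬ H.Percolates j) hε ?_
    filter_upwards [h, hsub _ hc1, isolated_bound j k s hj hjk hc3] with n h1 h2 h3
    simp only [not_not]
    have hexp := Real.exp_pos (-(Real.log n / 4))
    have hinv : (0 : ℝ) ≤ 1 / n := by positivity
    -- Which obstruction occurs may vary with `n`, so the cases are separated for each `n` under an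
    -- error bound that covers both.
    rcases le_total (p n ⟨0, by omega⟩ : ℝ)
      (Real.log n / ((c₁ + c₂ + 16) * (n : ℝ) ^ (k - j))) with h4 | h4
    · exact (h3 (p n) _ h4).trans (by linarith)
    · rcases h1 with h1 | h1
      · exact (h3 (p n) _ h1).trans (by linarith)
      · exact (h2 (p n) (hp n) h4 h1).trans (by linarith)
  · refine tendsto_measure_one_of_real_not_le (P := fun n H => H.Percolates j)
      (tendsto_one_div_atTop_nhds_zero_nat (𝕜 := ℝ)) ?_
    filter_upwards [h, hsup _ hc2] with n h1 h2
    exact h2 (p n) (hp n) h1.1 h1.2
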